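/- Let $(P,\pi)$ be a connected complex Poisson manifold of dimension $n$ with a holomorphic action of a complex torus $\mathbb{T}\cong(\mathbb{C}^\times)^m$ by Poisson automorphisms. Let $\mathfrak{t}$ be the Lie algebra of $\mathbb{T}$, let $\sigma:\mathfrak{t}\to\mathfrak{X}^1(P)$ be the infinitesimal action and write $\sigma_p(x)=\sigma(x)(p)$. A $\mathbb{T}$-leaf is a maximal connected integral (immersed) submanifold of the distribution $p\mapsto \mathrm{Im}(\sigma_p)+\mathrm{Im}(\pi(p)^\#)$, i.e. an orbit of the associated Lie algebroid $(P\times\mathfrak{t})\bowtie T^*P$. Assume that $(P,\pi)$ has a $\mathbb{T}$-leaf $L$ that is open and dense in $P$. Let $\mathrm{rk}(\pi)=2r$ be the maximal rank of $\pi$ on $P$. The leaf stabilizer $\mathfrak{t}_L=\{x\in\mathfrak{t}:\sigma_p(x)\in\mathrm{Im}(\pi(p)^\#)\}$ is the same for all $p\in L$. A $\mathbb{T}$-Poisson Pfaffian is an $n$-vector field $$\mathrm{Pf}_{\mathbb{T}}(\pi)=\wedge^r\pi\wedge\sigma(x_1)\wedge\cdots\wedge\sigma(x_{n-2r}),$$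 where $x_1,\dots,x_{n-2r}$ is a basis of a complement of $\mathfrak{t}_L$ in $\mathfrak{t}$. A $\mathbb{T}$-log-canonical system is an $n$-tuple $\Phi=(\varphi_1,\dots,\varphi_n)$ of holomorphic functions on $P$ with $d\varphi_1\wedge\cdots\wedge d\varphi_n\not\equiv0$, with $\{\varphi_i,\varphi_j\}_\pi\in\mathbb{C}\,\varphi_i\varphi_j$ for all $i,j$, and such that each $\varphi_i$ is a $\mathbb{T}$-weight vector. Put $\mu_\Phi=\dfrac{d\varphi_1\wedge\cdots\wedge d\varphi_n}{\varphi_1\cdots\varphi_n}$. Lowest degree terms at $p_0\in P$ are the lowest nonzero homogeneous parts of Taylor expansions in local coordinates centred at $p_0$, regarded as polynomial objects on $T_{p_0}P$. If the coefficients vanish to order exactly $e$ at $p_0$, the degree is $e$ for functions, $e+k$ for $k$-forms and $e-k$ for $k$-vector fields; for a meromorphic form, $\deg\big((\alpha/f)^{\rm low}\big)=\deg(\alpha^{\rm low})-\deg(f^{\rm low})$. If $\pi(p_0)=0$, let $\pi_0$ be the linearization of $\pi$ at $p_0$, a linear Poisson structure on $T_{p_0}P$ of maximal rank $\mathrm{rk}(\pi_0)$.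 One says that $\Phi$ has Property $\mathcal{I}$ at $p_0$ if $\deg(\mu_\Phi^{\rm low})=\tfrac12\mathrm{rk}(\pi_0)$. Then a $\mathbb{T}$-Poisson Pfaffian exists, and for every $\mathbb{T}$-Poisson Pfaffian $\mathrm{Pf}_{\mathbb{T}}(\pi)$ the following hold. 1) For every $\mathbb{T}$-log-canonical system $\Phi$ there is a constant $c\in\mathbb{C}$, $c\neq0$, with $$\langle d\varphi_1\wedge\cdots\wedge d\varphi_n,\ \mathrm{Pf}_{\mathbb{T}}(\pi)\rangle=c\,\varphi_1\cdots\varphi_n$$ on $P$, and $\deg(\mu_\Phi^{\rm low})=-\deg(\mathrm{Pf}_{\mathbb{T}}(\pi)^{\rm low})$ at every $p_0\in P$. 2) If $\pi(p_0)=0$ and $\deg(\mathrm{Pf}_{\mathbb{T}}(\pi)^{\rm low})=-\tfrac12\mathrm{rk}(\pi_0)$ at $p_0$, then every $\mathbb{T}$-log-canonical system $\Phi$ has Property $\mathcal{I}$ at $p_0$, and $\varphi_1^{\rm low},\dots,\varphi_n^{\rm low}$ contain a polynomial integrable system on $(T_{p_0}P,\pi_0)$: these polynomials are pairwise in involution with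 respect to $\pi_0$, and $n-\tfrac12\mathrm{rk}(\pi_0)$ of them are independent. 3) If $\pi(p_0)=0$, $p_0$ is fixed by $\mathbb{T}$, and $(P,\pi)$ admits a $\mathbb{T}$-log-canonical system, then $\deg(\mathrm{Pf}_{\mathbb{T}}(\pi)^{\rm low})=-\tfrac12\mathrm{rk}(\pi_0)$ at $p_0$, and every $\mathbb{T}$-log-canonical system has Property $\mathcal{I}$ at $p_0$. -/

import Mathlib

open scoped Manifold ContDiff

universe u

noncomputable section

namespace TPoisson

/-- The model space `ℂⁿ`. -/
abbrev Cn (n : ℕ) : Type := EuclideanSpace ℂ (Fin n)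

/-! ### Linear algebra of bivectors and multivectors -/

section Linear

variable {V : Type*} [AddCommGroup V] [Module ℂ V]

/-- The value `⟨α₁ ∧ ⋯ ∧ α_k, w⟩` of a `k`-vector `w` on `k` covectors, normalised by
`⟨α₁ ∧ ⋯ ∧ α_k, v₁ ∧ ⋯ ∧ v_k⟩ = det (α_j (v_i))`. -/
def pair {k : ℕ} (w : ⋀[ℂ]^k V) (α : Fin k → Module.Dual ℂ V) : ℂ :=
  exteriorPower.pairingDual ℂ V k (exteriorPower.ιMulti ℂ k α) w

/-- The image of `π^# : V* → V`, where `⟨π^#(α), β⟩ = π(α, β)` for all covectors `β`. -/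
def sharpRange (w : ⋀[ℂ]^2 V) : Submodule ℂ V where
  carrier := {v | ∃ α : Module.Dual ℂ V, ∀ β : Module.Dual ℂ V, β v = pair w ![α, β]}
  zero_mem' := by
    refine ⟨0, fun β => ?_⟩
    have h : exteriorPower.ιMulti ℂ 2 ![(0 : Module.Dual ℂ V), β] = 0 :=
      (exteriorPower.ιMulti ℂ 2).map_coord_zero (i := 0) rfl
    simp [pair, h]
  add_mem' := by
    rintro v v' ⟨α, h⟩ ⟨α', h'⟩
    refine ⟨α + α', fun β => ?_⟩
    have e : exteriorPower.ιMulti ℂ 2 ![α + α', β]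
        = exteriorPower.ιMulti ℂ 2 ![α, β] + exteriorPower.ιMulti ℂ 2 ![α', β] :=
      (exteriorPower.ιMulti ℂ 2).map_vecCons_add ![β] α α'
    rw [map_add, h, h']
    simp [pair, e]
  smul_mem' := by
    rintro c v ⟨α, h⟩
    refine ⟨c • α, fun β => ?_⟩
    have e : exteriorPower.ιMulti ℂ 2 ![c • α, β] = c • exteriorPower.ιMulti ℂ 2 ![α, β] :=
      (exteriorPower.ιMulti ℂ 2).map_vecCons_smul ![β] c α
    rw [map_smul, h]
    simp [pair, e]

end Linear

/-! ### Differential forms, multivector fields, Poisson structures -/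

section Manifold

variable {n : ℕ} {P : Type u} [TopologicalSpace P] [ChartedSpace (Cn n) P]

/-- The (holomorphic) tangent space of the `n`-dimensional complex manifold `P` at `p`. -/
abbrev Tan (n : ℕ) {P : Type u} [TopologicalSpace P] [ChartedSpace (Cn n) P] (p : P) : Type :=
  TangentSpace 𝓘(ℂ, Cn n) p

/-- `k`-vector fields on `P` (sections of `⋀ᵏ TP`). -/
abbrev MultivectorField (n k : ℕ) (P : Type u) [TopologicalSpace P] [ChartedSpace (Cn n) P] :
    Type u :=
  ∀ p : P, ⋀[ℂ]^k (Tan n p)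

/-- `k`-forms on `P` (sections of `⋀ᵏ T*P`). -/
abbrev FormField (n k : ℕ) (P : Type u) [TopologicalSpace P] [ChartedSpace (Cn n) P] : Type u :=
  ∀ p : P, ⋀[ℂ]^k (Module.Dual ℂ (Tan n p))

/-- The function `f` is holomorphic on the set `U`. -/
def HolOn (n : ℕ) {P : Type u} [TopologicalSpace P] [ChartedSpace (Cn n) P]
    (f : P → ℂ) (U : Set P) : Prop :=
  ContMDiffOn 𝓘(ℂ, Cn n) 𝓘(ℂ, ℂ) ω f U

/-- The differential `d_p f` as a covector at `p`. -/
def dAt (n : ℕ) {P : Type u} [TopologicalSpace P] [ChartedSpace (Cn n) P]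
    (f : P → ℂ) (p : P) : Module.Dual ℂ (Tan n p) :=
  (mvfderiv 𝓘(ℂ, Cn n) f p).toLinearMap

/-- The `k`-form `dF₁ ∧ ⋯ ∧ dF_k`. -/
def wedgeD (n : ℕ) {P : Type u} [TopologicalSpace P] [ChartedSpace (Cn n) P]
    {k : ℕ} (F : Fin k → P → ℂ) : FormField n k P :=
  fun p => exteriorPower.ιMulti ℂ k (fun i => dAt n (F i) p)

/-- A family of functions is independent if `dF₁ ∧ ⋯ ∧ dF_k` is not identically zero. -/
def Independent (n : ℕ) {P : Type u} [TopologicalSpace P] [ChartedSpace (Cn n) P]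
    {k : ℕ} (F : Fin k → P → ℂ) : Prop :=
  ∃ p, wedgeD n F p ≠ 0

/-- The bracket `{f, g}_π = π(df, dg)`. -/
def bracket (π : MultivectorField n 2 P) (f g : P → ℂ) : P → ℂ :=
  fun p => pair (π p) ![dAt n f p, dAt n g p]

/-- `π` is a holomorphic Poisson structure: it is a holomorphic bivector field (the bracket of
local holomorphic functions is holomorphic) and the bracket satisfies the Jacobi identity. -/
structure IsPoisson (π : MultivectorField n 2 P) : Prop where
  holomorphic : ∀ U : Set P, IsOpen U → ∀ f g : P → ℂ, HolOn n f U → HolOn n g U →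
    HolOn n (bracket π f g) U
  jacobi : ∀ U : Set P, IsOpen U → ∀ f g h : P → ℂ, HolOn n f U → HolOn n g U → HolOn n h U →
    ∀ p ∈ U, bracket π f (bracket π g h) p + bracket π g (bracket π h f) p
      + bracket π h (bracket π f g) p = 0

/-- The rank of `π` in `P`: the maximum over `p` of `dim Im (π(p)^#)`. -/
def rank (π : MultivectorField n 2 P) : ℕ :=
  ⨆ p : P, Module.finrank ℂ (sharpRange (π p))

/-! ### Lowest degree terms at a point -/

/-- The `i`-th coordinate function of the preferred chart at `p₀`. -/
def coord (n : ℕ) {P : Type u} [TopologicalSpace P] [ChartedSpace (Cn n) P]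
    (p₀ : P) (i : Fin n) : P → ℂ :=
  fun q => (chartAt (Cn n) p₀ q) i

/-- The coordinate vector `∂/∂z_i` of the preferred chart at `p₀`, at the point with
coordinates `x`. -/
def coordVec (n : ℕ) {P : Type u} [TopologicalSpace P] [ChartedSpace (Cn n) P]
    (p₀ : P) (i : Fin n) (x : Cn n) : Tan n ((chartAt (Cn n) p₀).symm x) :=
  mfderiv 𝓘(ℂ, Cn n) 𝓘(ℂ, Cn n) (chartAt (Cn n) p₀).symm x
    ((NormedSpace.fromTangentSpace x).symm (EuclideanSpace.single i (1 : ℂ)))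

/-- The smallest total degree of a nonzero Taylor coefficient at `x₀` of a member of the family
`c` of functions on `ℂⁿ`. -/
def vanishingOrder {n : ℕ} {ι : Type*} (c : ι → Cn n → ℂ) (x₀ : Cn n) : ℕ :=
  sInf {e : ℕ | ∃ i, iteratedFDeriv ℂ e (c i) x₀ ≠ 0}

/-- The degree of `f^low` at `p₀`, for a function `f`. -/
def funDeg (n : ℕ) {P : Type u} [TopologicalSpace P] [ChartedSpace (Cn n) P]
    (f : P → ℂ) (p₀ : P) : ℕ :=
  vanishingOrder (fun _ : Unit => f ∘ (chartAt (Cn n) p₀).symm) (chartAt (Cn n) p₀ p₀)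

/-- The lowest degree term `f^low` of `f` at `p₀`, i.e. the lowest nonzero homogeneous part of the
Taylor expansion in the chart at `p₀`, as a function on `T_{p₀}P`, which is identified with `ℂⁿ` by
means of the linear coordinates `d_{p₀}z₁, …, d_{p₀}z_n`. -/
def low {P : Type u} [TopologicalSpace P] [ChartedSpace (Cn n) P]
    (f : P → ℂ) (p₀ : P) : Cn n → ℂ :=
  fun v => ((funDeg n f p₀).factorial : ℂ)⁻¹ *
    iteratedFDeriv ℂ (funDeg n f p₀) (f ∘ (chartAt (Cn n) p₀).symm) (chartAt (Cn n) p₀ p₀)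
      (fun _ => v)

/-- The degree `e + k` of the lowest degree term at `p₀` of a `k`-form, where `e` is the vanishing
order of its coefficients in the basis `dz_{i₁} ∧ ⋯ ∧ dz_{i_k}`, `i₁ < ⋯ < i_k`. -/
def formDeg {k : ℕ} (α : FormField n k P) (p₀ : P) : ℤ :=
  (vanishingOrder (fun (s : Fin k ↪o Fin n) (x : Cn n) =>
    exteriorPower.pairingDual ℂ _ k (α ((chartAt (Cn n) p₀).symm x))
      (exteriorPower.ιMulti ℂ k (fun j => coordVec n p₀ (s j) x)))
    (chartAt (Cn n) p₀ p₀) : ℤ) + k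

/-- The degree `e - k` of the lowest degree term at `p₀` of a `k`-vector field, where `e` is the
vanishing order of its coefficients in the basis `∂/∂z_{i₁} ∧ ⋯ ∧ ∂/∂z_{i_k}`,
`i₁ < ⋯ < i_k`. -/
def vecDeg {k : ℕ} (w : MultivectorField n k P) (p₀ : P) : ℤ :=
  (vanishingOrder (fun (s : Fin k ↪o Fin n) (x : Cn n) =>
    pair (w ((chartAt (Cn n) p₀).symm x))
      (fun j => dAt n (coord n p₀ (s j)) ((chartAt (Cn n) p₀).symm x)))
    (chartAt (Cn n) p₀ p₀) : ℤ) - k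

/-- The degree of the lowest degree term at `p₀` of the log-volume form
`μ_Φ = (dφ₁ ∧ ⋯ ∧ dφ_n) / (φ₁ ⋯ φ_n)`: for a meromorphic form `α / f` it is
`deg (α^low) - deg (f^low)`. -/
def logVolumeDeg (Φ : Fin n → P → ℂ) (p₀ : P) : ℤ :=
  formDeg (wedgeD n Φ) p₀ - (funDeg n (fun p => ∏ i, Φ i p) p₀ : ℤ)

/-! ### Linearization and integrable systems -/

/-- The linearization `π₀` at `p₀` of a bivector field `π` with `π(p₀) = 0`: the linear bivector
field on `T_{p₀}P = ℂⁿ` with `π₀(v) = ∑_{i < j} d_{p₀}{z_i, z_j}(v) ∂_i ∧ ∂_j`. -/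
def linearization (π : MultivectorField n 2 P) (p₀ : P) : MultivectorField n 2 (Cn n) :=
  fun v => ∑ i : Fin n, ∑ j : Fin n, if i < j then
    (mvfderiv 𝓘(ℂ, Cn n) (bracket π (coord n p₀ i) (coord n p₀ j)) p₀ : Cn n → ℂ) v •
      exteriorPower.ιMulti ℂ 2
        ![(NormedSpace.fromTangentSpace v).symm (EuclideanSpace.single i (1 : ℂ)),
          (NormedSpace.fromTangentSpace v).symm (EuclideanSpace.single j (1 : ℂ))]
    else 0

/-- `F` is a polynomial function on `ℂⁿ`. -/
def IsPolynomialFun (F : Cn n → ℂ) : Prop :=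
  ∃ q : MvPolynomial (Fin n) ℂ, ∀ v : Cn n, F v = MvPolynomial.eval (fun i => v i) q

/-- The family `F` of functions on `(ℂⁿ, π)` contains a polynomial integrable system: its members
are polynomials, pairwise in involution, and `n - rk(π)/2` of them are independent. -/
def ContainsPolynomialIntegrableSystem {k : ℕ} (π : MultivectorField n 2 (Cn n))
    (F : Fin k → Cn n → ℂ) : Prop :=
  (∀ i, IsPolynomialFun (F i)) ∧ (∀ i j, ∀ v, bracket π (F i) (F j) v = 0) ∧
    ∃ (m : ℕ) (s : Fin m ↪ Fin k), 2 * m + rank π = 2 * n ∧ Independent n (fun a => F (s a))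

/-- A log-canonical system on `(P, π)`: `n = dim P` independent holomorphic functions with
`{φ_i, φ_j} ∈ ℂ φ_i φ_j`. -/
structure IsLogCanonicalSystem (π : MultivectorField n 2 P) (Φ : Fin n → P → ℂ) : Prop where
  holomorphic : ∀ i, HolOn n (Φ i) Set.univ
  independent : Independent n Φ
  logCanonical : ∀ i j, ∃ c : ℂ, ∀ p, bracket π (Φ i) (Φ j) p = c * (Φ i p * Φ j p)

/-- Property `I` at a zero `p₀` of `π`: `deg (μ_Φ^low) = rk(π₀) / 2`. -/
def PropertyI (π : MultivectorField n 2 P) (Φ : Fin n → P → ℂ) (p₀ : P) : Prop :=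
  2 * logVolumeDeg Φ p₀ = rank (linearization π p₀)

/-! ### Torus actions -/

/-- The complex torus `(ℂˣ)ᵐ`, as the complex Lie group of units of the algebra `ℂᵐ`. -/
abbrev Torus (m : ℕ) : Type := (Fin m → ℂ)ˣ

/-- The Lie algebra of the torus, that is, its tangent space at the identity. -/
abbrev TorusLie (m : ℕ) : Type := GroupLieAlgebra 𝓘(ℂ, Fin m → ℂ) (Torus m)

variable {m : ℕ} [MulAction (Torus m) P]

/-- The infinitesimal action `σ_p : 𝔱 → T_pP`, the derivative at `t = 1` of `t ↦ t • p`. -/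
def sigma (n m : ℕ) {P : Type u} [TopologicalSpace P] [ChartedSpace (Cn n) P]
    [MulAction (Torus m) P] (p : P) : TorusLie m →ₗ[ℂ] Tan n p :=
  (mfderiv 𝓘(ℂ, Fin m → ℂ) 𝓘(ℂ, Cn n) (fun t : Torus m => t • p) 1).toLinearMap

/-- The torus acts by automorphisms of `(P, π)`: `t_* π = π` for all `t`. -/
def ActsByPoisson (m : ℕ) [MulAction (Torus m) P] (π : MultivectorField n 2 P) : Prop :=
  ∀ (t : Torus m) (p : P),
    exteriorPower.map 2
      (mfderiv 𝓘(ℂ, Cn n) 𝓘(ℂ, Cn n) (fun q : P => t • q) p).toLinearMap (π p) = π (t • p)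

/-- `Im(σ_p) + Im(π(p)^#)`, the image at `p` of the anchor `-σ + π^#` of the Lie algebroid
`(P × 𝔱) ⋈ T*P`. -/
def anchorRange (m : ℕ) [MulAction (Torus m) P] (π : MultivectorField n 2 P) (p : P) :
    Submodule ℂ (Tan n p) :=
  LinearMap.range (sigma n m p) ⊔ sharpRange (π p)

/-- `L` is the image of a connected, injectively immersed complex submanifold whose tangent
space at each of its points `p` is `A p`. -/
def IsIntegralManifold (A : ∀ p : P, Submodule ℂ (Tan n p)) (L : Set P) : Prop :=
  ∃ (k : ℕ) (N : Type u) (_ : TopologicalSpace N) (_ : ChartedSpace (Cn k) N) (ι : N → P),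
    T2Space N ∧ SecondCountableTopology N ∧ ConnectedSpace N ∧
    IsManifold 𝓘(ℂ, Cn k) ω N ∧
    ContMDiff 𝓘(ℂ, Cn k) 𝓘(ℂ, Cn n) ω ι ∧ Function.Injective ι ∧ Set.range ι = L ∧
    ∀ x : N, Function.Injective (mfderiv 𝓘(ℂ, Cn k) 𝓘(ℂ, Cn n) ι x) ∧
      LinearMap.range (mfderiv 𝓘(ℂ, Cn k) 𝓘(ℂ, Cn n) ι x).toLinearMap = A (ι x)

/-- `L` is a `𝕋`-leaf of `(P, π)`, i.e. an orbit of the Lie algebroid `(P × 𝔱) ⋈ T*P`: a maximal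
connected integral manifold of the image of its anchor. -/
def IsTLeaf (m : ℕ) [MulAction (Torus m) P] (π : MultivectorField n 2 P) (L : Set P) : Prop :=
  Maximal (IsIntegralManifold (anchorRange m π)) L

/-- The stabilizer `{x ∈ 𝔱 : σ_p(x) ∈ Im(π(p)^#)}`; it is the same for all points `p` of a
`𝕋`-leaf `L`, and is then called the leaf stabilizer of `L`. -/
def leafStabilizer (m : ℕ) [MulAction (Torus m) P] (π : MultivectorField n 2 P) (p : P) :
    Submodule ℂ (TorusLie m) :=
  (sharpRange (π p)).comap (sigma n m p)

/-- `Pf` is a `𝕋`-Poisson Pfaffian of `(P, π)`, for the open dense `𝕋`-leaf `L`: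
`Pf = ∧ʳ π ∧ σ(x₁) ∧ ⋯ ∧ σ(x_{n-2r})`, where `2r = rk(π)` and `x₁, …, x_{n-2r}` is a basis of a
complement in `𝔱` of the leaf stabilizer of `L`. -/
def IsTPfaffian (m : ℕ) [MulAction (Torus m) P] (π : MultivectorField n 2 P) (L : Set P)
    (Pf : MultivectorField n n P) : Prop :=
  ∃ p ∈ L, ∃ (r d : ℕ) (x : Fin d → TorusLie m),
    2 * r = rank π ∧ 2 * r + d = n ∧ LinearIndependent ℂ x ∧
    IsCompl (Submodule.span ℂ (Set.range x)) (leafStabilizer m π p) ∧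
    ∀ q : P, (Pf q : ExteriorAlgebra ℂ (Tan n q)) =
      (π q : ExteriorAlgebra ℂ (Tan n q)) ^ r *
        ExteriorAlgebra.ιMulti ℂ d (fun i => sigma n m q (x i))

/-- `f` is a weight vector for the torus action on functions on `P`, for some character. -/
def IsWeightVector (m : ℕ) [MulAction (Torus m) P] (f : P → ℂ) : Prop :=
  ∃ χ : Torus m →* ℂˣ, ∀ (t : Torus m) (p : P), f (t • p) = (χ t : ℂ) * f p

/-- A `𝕋`-log-canonical system: a log-canonical system of `𝕋`-weight vectors. -/
structure IsTLogCanonicalSystem (m : ℕ) [MulAction (Torus m) P] (π : MultivectorField n 2 P)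
    (Φ : Fin n → P → ℂ) : Prop extends IsLogCanonicalSystem π Φ where
  weight : ∀ i, IsWeightVector m (Φ i)

end Manifold

end TPoisson

end

/-! In a chart the theorem reduces to one scalar identity, `J h = c φ₁⋯φₙ`, where `J` is the
Jacobian of the system and `h` is the coefficient of the Pfaffian. Everything about degrees then
follows by comparing Taylor orders along lines through `p₀`.

Nonvanishing. A leaf with open image has full dimension, so the anchor is onto along it
(`IsIntegralManifold.eq_top`). A dimension count then forces `2r = rk π(p)` at the point `p` where
the complement is taken, and the normal form `π(p) = ∑ eᵢ ∧ fᵢ` gives `Pf(p) ≠ 0` (`bivector_rank`,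
`IsPfaffianForm.ne_zero`). For existence, `p` is chosen in the dense leaf with `π(p)` of maximal
rank.

The identity. The map `(dφ₁, …, dφₙ) : T_qP → ℂⁿ` carries `π(q)` and the vectors `σ_q(x)` to the
images of a constant bivector and constant vectors under `diag(φᵢ(q))`. So it carries `Pf(q)` to the
image of a constant `n`-vector, and the pairing is a constant times `∏ φᵢ`
(`IsPfaffianForm.exists_pair_eq`). The constant is nonzero because `Pf(p) ≠ 0` and, by the identity
theorem, `J` vanishes identically on no open set. Orders of products add, since polynomials have no
zero divisors (`ord_mul`), whence `deg μ^low = -deg Pf^low`.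

Lowest terms at a zero of `π`. The leading coefficient of `{φᵢ, φⱼ} = c φᵢφⱼ` along a line gives
involution for `π₀`, as the right-hand side has higher order (`lowest_terms_involution`). A rank
estimate for the rescaled Jacobian matrix gives at least `n - deg μ^low` independent differentials
of lowest terms (`exists_independent_gradients`). Under Property I this is the number required of an
integrable system.

Fixed zeros. The independent differentials are isotropic for `π₀`, so `n - deg μ^low ≤ n - rk(π₀)/2`
(`rank_linearization_le`). Conversely, with `rk(π₀) = 2k`, the powers of `π₀` beyond the `k`-th
vanish and each `σ(x)` vanishes at `p₀`, so the Pfaffian has order at least `2r - k + d = n - k`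
(`IsPfaffianForm.neg_rank_le`). The two bounds meet. -/

noncomputable section

namespace TPoisson

/-! ### The pairing of multivectors with covectors -/

section Pairing

variable {V V' : Type*} [AddCommGroup V] [Module ℂ V] [AddCommGroup V'] [Module ℂ V']

/-- `pair w` as an alternating map. -/
def pairAlt {k : ℕ} (w : ⋀[ℂ]^k V) : AlternatingMap ℂ (Module.Dual ℂ V) ℂ (Fin k) :=
  (LinearMap.applyₗ w).compAlternatingMap (exteriorPower.alternatingMapToDual ℂ V k)

lemma pair_eq_pairAlt {k : ℕ} (w : ⋀[ℂ]^k V) (α : Fin k → Module.Dual ℂ V) :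
    pair w α = pairAlt w α := by
  simp [pair, pairAlt, exteriorPower.pairingDual]

/-- `pair` as a linear map in the multivector. -/
def pairLin {k : ℕ} (α : Fin k → Module.Dual ℂ V) : ⋀[ℂ]^k V →ₗ[ℂ] ℂ :=
  exteriorPower.pairingDual ℂ V k (exteriorPower.ιMulti ℂ k α)

@[simp] lemma pairLin_apply {k : ℕ} (α : Fin k → Module.Dual ℂ V) (w : ⋀[ℂ]^k V) :
    pairLin α w = pair w α := rfl

@[simp] lemma pair_ιMulti {k : ℕ} (v : Fin k → V) (α : Fin k → Module.Dual ℂ V) :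
    pair (exteriorPower.ιMulti ℂ k v) α = Matrix.det (.of fun i j => α j (v i)) := by
  simp [pair]

lemma pair_smul {k : ℕ} (c : ℂ) (w : ⋀[ℂ]^k V) (α : Fin k → Module.Dual ℂ V) :
    pair (c • w) α = c * pair w α := by simp [pair]

lemma pair_sum {ι : Type*} {k : ℕ} (s : Finset ι) (w : ι → ⋀[ℂ]^k V)
    (α : Fin k → Module.Dual ℂ V) :
    pair (∑ i ∈ s, w i) α = ∑ i ∈ s, pair (w i) α := by
  simp only [← pairLin_apply, map_sum]

@[simp] lemma pair_zero {k : ℕ} (α : Fin k → Module.Dual ℂ V) :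
    pair (0 : ⋀[ℂ]^k V) α = 0 := by simp [pair]

lemma pair_map {k : ℕ} (f : V →ₗ[ℂ] V') (w : ⋀[ℂ]^k V) (α : Fin k → Module.Dual ℂ V') :
    pair (exteriorPower.map k f w) α = pair w (fun j => α j ∘ₗ f) := by
  have : (pairLin α) ∘ₗ exteriorPower.map k f = pairLin (fun j => α j ∘ₗ f) := by
    apply exteriorPower.linearMap_ext
    ext v
    simp
  exact LinearMap.congr_fun this w

lemma pair_smul_univ {k : ℕ} (w : ⋀[ℂ]^k V) (c : Fin k → ℂ) (α : Fin k → Module.Dual ℂ V) :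
    pair w (fun i => c i • α i) = (∏ i, c i) * pair w α := by
  simp only [pair_eq_pairAlt]
  simpa using (pairAlt w).toMultilinearMap.map_smul_univ c α

/-- Pulled back to `ℂᵏ` by `e_j ↦ α_j`, the form becomes an alternating `k`-form on a
`k`-dimensional space, hence a multiple of the determinant. Jacobians enter through this lemma. -/
lemma pair_matrix {k : ℕ} (w : ⋀[ℂ]^k V) (B : Matrix (Fin k) (Fin k) ℂ)
    (α : Fin k → Module.Dual ℂ V) :
    pair w (fun i => ∑ j, B i j • α j) = B.det * pair w α := by
  let f : AlternatingMap ℂ (Fin k → ℂ) ℂ (Fin k) :=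
    (pairAlt w).compLinearMap (Fintype.linearCombination ℂ α)
  have h := f.eq_smul_basis_det (Pi.basisFun ℂ (Fin k))
  have h2 := congrArg (fun g => g (fun i => B i)) h
  have e1 : f (fun i => B i) = pair w (fun i => ∑ j, B i j • α j) := by
    rw [pair_eq_pairAlt]; rfl
  have e2 : f (fun i => Pi.basisFun ℂ (Fin k) i) = pair w α := by
    rw [pair_eq_pairAlt]
    change pairAlt w (fun i => Fintype.linearCombination ℂ α (Pi.basisFun ℂ (Fin k) i)) = _
    congr 1
    ext i : 1
    simp [Fintype.linearCombination_apply, Pi.single_apply]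
  rw [← e1]
  rw [h2, ← e2]
  simp only [AlternatingMap.smul_apply, smul_eq_mul, Pi.basisFun_det]
  rw [mul_comm]
  rfl

lemma pair_two_add_left (w : ⋀[ℂ]^2 V) (α α' β : Module.Dual ℂ V) :
    pair w ![α + α', β] = pair w ![α, β] + pair w ![α', β] := by
  simp only [pair_eq_pairAlt]
  exact (pairAlt w).map_vecCons_add ![β] α α'

lemma pair_two_smul_left (w : ⋀[ℂ]^2 V) (c : ℂ) (α β : Module.Dual ℂ V) :
    pair w ![c • α, β] = c * pair w ![α, β] := by
  simp only [pair_eq_pairAlt]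
  exact (pairAlt w).map_vecCons_smul ![β] c α

lemma pair_two_swap (w : ⋀[ℂ]^2 V) (α β : Module.Dual ℂ V) :
    pair w ![β, α] = - pair w ![α, β] := by
  simp only [pair_eq_pairAlt]
  have := (pairAlt w).map_swap ![α, β] (i := 0) (j := 1) (by decide)
  rw [← this]
  congr 1
  ext i : 1
  fin_cases i <;> rfl

lemma pair_two_self (w : ⋀[ℂ]^2 V) (α : Module.Dual ℂ V) : pair w ![α, α] = 0 := by
  simp only [pair_eq_pairAlt]
  exact (pairAlt w).map_eq_zero_of_eq _ (i := 0) (j := 1) rfl (by decide)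

/-- The bilinear form on covectors defined by a bivector. -/
def bilin (w : ⋀[ℂ]^2 V) : Module.Dual ℂ V →ₗ[ℂ] Module.Dual ℂ V →ₗ[ℂ] ℂ :=
  LinearMap.mk₂ ℂ (fun α β => pair w ![α, β])
    (pair_two_add_left w) (pair_two_smul_left w)
    (fun α β β' => by
      rw [pair_two_swap, pair_two_add_left, pair_two_swap w β, pair_two_swap w β']; ring)
    (fun c α β => by
      rw [pair_two_swap, pair_two_smul_left, pair_two_swap w β]; simp)

@[simp] lemma bilin_apply (w : ⋀[ℂ]^2 V) (α β : Module.Dual ℂ V) :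
    bilin w α β = pair w ![α, β] := rfl

lemma pair_two_sum {ι κ : Type*} (s : Finset ι) (t : Finset κ) (w : ⋀[ℂ]^2 V)
    (a : ι → ℂ) (b : κ → ℂ) (α : ι → Module.Dual ℂ V) (β : κ → Module.Dual ℂ V) :
    pair w ![∑ i ∈ s, a i • α i, ∑ j ∈ t, b j • β j]
      = ∑ i ∈ s, ∑ j ∈ t, a i * b j * pair w ![α i, β j] := by
  rw [← bilin_apply]
  simp only [map_sum, map_smul, LinearMap.sum_apply, LinearMap.smul_apply, bilin_apply,
    smul_eq_mul, Finset.mul_sum, mul_assoc]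
  rw [Finset.sum_comm]
  refine Finset.sum_congr rfl fun i _ => Finset.sum_congr rfl fun j _ => by ring

/-- A bivector is determined by its values on pairs of elements of a dual basis. -/
lemma bivector_ext {n : ℕ} (b : Module.Basis (Fin n) ℂ V) {w w' : ⋀[ℂ]^2 V}
    (h : ∀ i j, i < j → pair w ![b.coord i, b.coord j] = pair w' ![b.coord i, b.coord j]) :
    w = w' := by
  refine (b.exteriorPower 2).ext_elem fun s => ?_
  rw [exteriorPower.basis_repr_apply, exteriorPower.basis_repr_apply]
  set e := Set.powersetCard.ofFinEmbEquiv.symm s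
  have key : ∀ w : ⋀[ℂ]^2 V, exteriorPower.ιMultiDual ℂ 2 b s w
      = pair w ![b.coord (e 0), b.coord (e 1)] := by
    intro w
    unfold exteriorPower.ιMultiDual exteriorPower.ιMulti_family pair
    congr 3
  rw [key, key]
  exact h _ _ (e.strictMono (by decide))

/-- A finite chain has no nontrivial order automorphism. Hence a field of top degree has a single
coefficient in the definitions of degree. -/
lemma orderEmb_eq_refl {n : ℕ} (e : Fin n ↪o Fin n) : e = RelEmbedding.refl _ := by
  have h : RelIso.ofSurjective e (Finite.surjective_of_injective e.injective)
      = OrderIso.refl (Fin n) := Subsingleton.elim _ _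
  ext i : 1
  exact congrArg (fun g : Fin n ≃o Fin n => g i) h

/-- A nonzero multivector of top degree pairs nontrivially with any basis of covectors. -/
lemma pair_top_ne_zero {n : ℕ} (b : Module.Basis (Fin n) ℂ V) {w : ⋀[ℂ]^n V} (hw : w ≠ 0) :
    pair w (fun i => b.coord i) ≠ 0 := by
  contrapose! hw
  refine (b.exteriorPower n).ext_elem fun s => ?_
  rw [exteriorPower.basis_repr_apply]
  have he : Set.powersetCard.ofFinEmbEquiv.symm s = RelEmbedding.refl _ := orderEmb_eq_refl _
  have : exteriorPower.ιMultiDual ℂ n b s w = pair w (fun i => b.coord i) := by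
    unfold exteriorPower.ιMultiDual exteriorPower.ιMulti_family pair
    rw [he]; rfl
  rw [this, hw]
  simp

/-- Pairing with fixed covectors extends to a linear functional on the exterior algebra. -/
lemma exists_functional_pair {k : ℕ} (α : Fin k → Module.Dual ℂ V) :
    ∃ T : ExteriorAlgebra ℂ V →ₗ[ℂ] ℂ, ∀ w : ⋀[ℂ]^k V, T (w : ExteriorAlgebra ℂ V) = pair w α := by
  obtain ⟨T, hT⟩ := LinearMap.exists_extend (pairLin α)
  exact ⟨T, fun w => LinearMap.congr_fun hT w⟩

lemma coe_exteriorPower_map {k : ℕ} (f : V →ₗ[ℂ] V') (w : ⋀[ℂ]^k V) :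
    ((exteriorPower.map k f w : ⋀[ℂ]^k V') : ExteriorAlgebra ℂ V')
      = ExteriorAlgebra.map f (w : ExteriorAlgebra ℂ V) := by
  have : (⋀[ℂ]^k V').subtype ∘ₗ exteriorPower.map k f
      = (ExteriorAlgebra.map f).toLinearMap ∘ₗ (⋀[ℂ]^k V).subtype := by
    apply exteriorPower.linearMap_ext
    ext v
    simp [ExteriorAlgebra.map_apply_ιMulti]
  exact LinearMap.congr_fun this w

end Pairing

/-! ### The normal form of a bivector -/

section NormalForm

/-- The binomial expansion stops after the term linear in `y`. -/
lemma add_pow_of_mul_self_eq_zero {A : Type*} [Ring A] {S y : A} (hc : Commute S y)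
    (hy : y * y = 0) (m : ℕ) : (S + y) ^ (m + 1) = S ^ (m + 1) + (m + 1) • (S ^ m * y) := by
  induction m with
  | zero => simp
  | succ m ih =>
    rw [pow_succ, ih, add_mul, mul_add, mul_add, smul_mul_assoc, smul_mul_assoc, mul_assoc _ y y,
      hy, mul_assoc _ y S, ← hc.eq, ← mul_assoc, ← pow_succ, ← pow_succ, mul_zero, smul_zero,
      add_zero, succ_nsmul _ (m + 1), add_assoc, add_comm (S ^ (m + 1) * y)]

/-- Only squarefree monomials survive in the multinomial expansion: the product of all `k` elements
occurs `k!` times, and there is no squarefree monomial of degree `k + 1`. The induction needs both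
facts together. -/
lemma sum_pow_of_mul_self_eq_zero {A : Type*} [Ring A] {k : ℕ} (x : Fin k → A)
    (hc : ∀ i j, Commute (x i) (x j)) (hx : ∀ i, x i * x i = 0) :
    (∑ i, x i) ^ k = k.factorial • (List.ofFn x).prod ∧ (∑ i, x i) ^ (k + 1) = 0 := by
  induction k with
  | zero => simp
  | succ k ih =>
    obtain ⟨h1, h2⟩ := ih (fun i => x i.castSucc) (fun i j => hc _ _) (fun i => hx _)
    have hcs : Commute (∑ i : Fin k, x i.castSucc) (x (Fin.last k)) :=
      Commute.sum_left _ _ _ fun i _ => hc _ _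
    rw [Fin.sum_univ_castSucc, add_pow_of_mul_self_eq_zero hcs (hx _),
      add_pow_of_mul_self_eq_zero hcs (hx _), pow_succ _ (k + 1), h2, h1, List.ofFn_succ']
    simp [Nat.factorial_succ, mul_assoc]

variable {V : Type*} [AddCommGroup V] [Module ℂ V]

open ExteriorAlgebra (ι)

lemma ι_mul_ι_swap (x y : V) : ι ℂ x * ι ℂ y = - (ι ℂ y * ι ℂ x) :=
  eq_neg_of_add_eq_zero_left (ExteriorAlgebra.ι_add_mul_swap x y)

lemma commute_ι_mul_ι (a b c : V) : Commute (ι ℂ a * ι ℂ b) (ι ℂ c) := by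
  change _ * _ = _ * _
  rw [mul_assoc, ι_mul_ι_swap b c, mul_neg, ← mul_assoc, ι_mul_ι_swap a c, neg_mul, neg_neg,
    mul_assoc]

lemma commute_two (a b c d : V) : Commute (ι ℂ a * ι ℂ b) (ι ℂ c * ι ℂ d) :=
  (commute_ι_mul_ι a b c).mul_right (commute_ι_mul_ι a b d)

lemma ι_mul_ι_sq (a b : V) : (ι ℂ a * ι ℂ b) * (ι ℂ a * ι ℂ b) = 0 := by
  rw [mul_assoc, ← mul_assoc (ι ℂ b), ι_mul_ι_swap b a, neg_mul, mul_assoc (ι ℂ a) (ι ℂ b),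
    ExteriorAlgebra.ι_sq_zero]
  simp

/-- `w` is a sum of `k` decomposable bivectors. -/
def IsSumOfDecomposables (k : ℕ) (w : ExteriorAlgebra ℂ V) : Prop :=
  ∃ e f : Fin k → V, w = ∑ i, ι ℂ (e i) * ι ℂ (f i)

lemma exists_isSumOfDecomposables (w : ⋀[ℂ]^2 V) :
    ∃ k, IsSumOfDecomposables k (w : ExteriorAlgebra ℂ V) := by
  have hw : w ∈ Submodule.span ℂ (Set.range (exteriorPower.ιMulti ℂ 2 (M := V))) := by
    rw [exteriorPower.ιMulti_span]; trivial
  induction hw using Submodule.span_induction with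
  | mem x hx =>
    obtain ⟨v, rfl⟩ := hx
    refine ⟨1, fun _ => v 0, fun _ => v 1, ?_⟩
    simp [ExteriorAlgebra.ιMulti_apply]
    rfl
  | zero => exact ⟨0, 0, 0, by simp⟩
  | add x y _ _ hx hy =>
    obtain ⟨k, e, f, h⟩ := hx
    obtain ⟨k', e', f', h'⟩ := hy
    refine ⟨k + k', Fin.append e e', Fin.append f f', ?_⟩
    rw [Fin.sum_univ_add]
    simp [h, h']
  | smul c x _ hx =>
    obtain ⟨k, e, f, h⟩ := hx
    refine ⟨k, fun i => c • e i, f, ?_⟩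
    simp [h, Finset.smul_sum]

/-- Substitute the relation into `e_{i₀} ∧ f_{i₀}` and absorb it into the other summands, using `(e
- b f₀) ∧ (f + a f₀) = e ∧ f + (a e + b f) ∧ f₀`. -/
lemma IsSumOfDecomposables.reduce {k : ℕ} (e f : Fin (k + 1) → V) (i₀ : Fin (k + 1))
    (a b : Fin k → ℂ) (c : ℂ)
    (h : e i₀ = ∑ j, (a j • e (i₀.succAbove j) + b j • f (i₀.succAbove j)) + c • f i₀) :
    IsSumOfDecomposables k (∑ i, ι ℂ (e i) * ι ℂ (f i)) := by
  refine ⟨fun j => e (i₀.succAbove j) - b j • f i₀, fun j => f (i₀.succAbove j) + a j • f i₀, ?_⟩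
  rw [Fin.sum_univ_succAbove _ i₀, h]
  simp only [map_add, map_sum, map_smul, add_mul, Finset.sum_mul, smul_mul_assoc,
    ExteriorAlgebra.ι_sq_zero, smul_zero, add_zero, ← Finset.sum_add_distrib]
  refine Finset.sum_congr rfl fun j _ => ?_
  simp only [map_sub, map_smul, mul_add, sub_mul, smul_mul_assoc, mul_smul_comm,
    ExteriorAlgebra.ι_sq_zero, smul_zero]
  rw [ι_mul_ι_swap (f i₀) (f (i₀.succAbove j))]
  simp only [smul_neg, sub_zero]
  abel

/-- Every bivector is `∑ i, e_i ∧ f_i` with `e_i, f_i` linearly independent. -/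
lemma exists_normalForm (w : ⋀[ℂ]^2 V) :
    ∃ (k : ℕ) (e f : Fin k → V), LinearIndependent ℂ (Sum.elim e f) ∧
      (w : ExteriorAlgebra ℂ V) = ∑ i, ι ℂ (e i) * ι ℂ (f i) := by
  classical
  have hex := exists_isSumOfDecomposables w
  -- Take an expression with the fewest summands; a linear relation among its vectors would shorten
  -- it.
  obtain ⟨e, f, hw⟩ := Nat.find_spec hex
  refine ⟨Nat.find hex, e, f, ?_, hw⟩
  by_contra hdep
  rw [Fintype.not_linearIndependent_iff] at hdep
  obtain ⟨g, hg, i, hi⟩ := hdep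
  have hmin := fun m => Nat.find_min hex (m := m)
  generalize Nat.find hex = K at *
  cases K with
  | zero => rcases i with i | i <;> exact i.elim0
  | succ k =>
    refine hmin k (Nat.lt_succ_self k) ?_
    rw [Fintype.sum_sum_type] at hg
    simp only [Sum.elim_inl, Sum.elim_inr] at hg
    rcases i with i | i
    · rw [hw]
      refine IsSumOfDecomposables.reduce e f i
        (fun j => - (g (.inl i))⁻¹ * g (.inl (i.succAbove j)))
        (fun j => - (g (.inl i))⁻¹ * g (.inr (i.succAbove j))) (- (g (.inl i))⁻¹ * g (.inr i)) ?_
      rw [Fin.sum_univ_succAbove _ i, Fin.sum_univ_succAbove _ i] at hg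
      simp only [mul_smul, ← smul_add, ← Finset.smul_sum, Finset.sum_add_distrib]
      have : g (.inl i) • e i = -(∑ j, g (.inl (i.succAbove j)) • e (i.succAbove j)
          + ∑ j, g (.inr (i.succAbove j)) • f (i.succAbove j) + g (.inr i) • f i) := by
        rw [eq_neg_iff_add_eq_zero, ← hg]; abel
      rw [neg_smul, ← smul_neg, ← this, smul_smul, inv_mul_cancel₀ hi, one_smul]
    -- If the nonzero coefficient sits at some `f i`, rewrite `e ∧ f = f ∧ (-e)` to exchange the two
    -- roles.
    · have hw' : (w : ExteriorAlgebra ℂ V) = ∑ i, ι ℂ (f i) * ι ℂ ((-e) i) := by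
        rw [hw]
        refine Finset.sum_congr rfl fun j _ => ?_
        rw [ι_mul_ι_swap]; simp
      rw [hw']
      refine IsSumOfDecomposables.reduce f (-e) i
        (fun j => - (g (.inr i))⁻¹ * g (.inr (i.succAbove j)))
        (fun j => (g (.inr i))⁻¹ * g (.inl (i.succAbove j))) ((g (.inr i))⁻¹ * g (.inl i)) ?_
      rw [Fin.sum_univ_succAbove _ i, Fin.sum_univ_succAbove _ i] at hg
      simp only [Pi.neg_apply, smul_neg, ← neg_smul, ← neg_mul]
      simp only [mul_smul, ← smul_add, ← Finset.smul_sum, Finset.sum_add_distrib]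
      have : g (.inr i) • f i = -(∑ j, g (.inr (i.succAbove j)) • f (i.succAbove j)
          + ∑ j, g (.inl (i.succAbove j)) • e (i.succAbove j) + g (.inl i) • e i) := by
        rw [eq_neg_iff_add_eq_zero, ← hg]; abel
      rw [neg_smul, ← smul_neg, ← this, smul_smul, inv_mul_cancel₀ hi, one_smul]

lemma exists_dual_of_linearIndependent {κ : Type*} [DecidableEq κ] {v : κ → V}
    (hv : LinearIndependent ℂ v) (c : κ → ℂ) :
    ∃ α : Module.Dual ℂ V, ∀ i, α (v i) = c i := by
  obtain ⟨α, hα⟩ := LinearMap.exists_extend ((Module.Basis.span hv).constr ℂ c)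
  refine ⟨α, fun i => ?_⟩
  have h := LinearMap.congr_fun hα (Module.Basis.span hv i)
  rw [Module.Basis.constr_basis] at h
  simpa [Module.Basis.span_apply] using h

lemma pair_of_normalForm {k : ℕ} {e f : Fin k → V} {w : ⋀[ℂ]^2 V}
    (hw : (w : ExteriorAlgebra ℂ V) = ∑ i, ι ℂ (e i) * ι ℂ (f i)) (α β : Module.Dual ℂ V) :
    pair w ![α, β] = ∑ i, (α (e i) * β (f i) - α (f i) * β (e i)) := by
  have : w = ∑ i, exteriorPower.ιMulti ℂ 2 ![e i, f i] := by
    apply Subtype.ext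
    rw [hw]
    simp [ExteriorAlgebra.ιMulti_apply]
  rw [this, pair_sum]
  refine Finset.sum_congr rfl fun i _ => ?_
  rw [pair_ιMulti, Matrix.det_fin_two]
  simp
  ring

lemma sharpRange_of_normalForm {k : ℕ} {e f : Fin k → V} {w : ⋀[ℂ]^2 V}
    (hli : LinearIndependent ℂ (Sum.elim e f))
    (hw : (w : ExteriorAlgebra ℂ V) = ∑ i, ι ℂ (e i) * ι ℂ (f i)) :
    sharpRange w = Submodule.span ℂ (Set.range (Sum.elim e f)) := by
  classical
  apply le_antisymm
  · rintro v ⟨α, hα⟩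
    have : v = ∑ i, (α (e i) • f i - α (f i) • e i) := by
      rw [← sub_eq_zero, ← Module.forall_dual_apply_eq_zero_iff ℂ]
      intro β
      rw [map_sub, hα β, pair_of_normalForm hw]
      simp [map_sum]
    rw [this]
    refine Submodule.sum_mem _ fun i _ => Submodule.sub_mem _ ?_ ?_
    · exact Submodule.smul_mem _ _ (Submodule.subset_span ⟨.inr i, rfl⟩)
    · exact Submodule.smul_mem _ _ (Submodule.subset_span ⟨.inl i, rfl⟩)
  · rw [Submodule.span_le]
    rintro _ ⟨i | i, rfl⟩
    -- Since `w^#(α) = ∑ (α(e_i) f_i - α(f_i) e_i)`, the covector equal to `-1` on `f i` and `0` on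
    -- the other vectors is sent to `e i`.
    · obtain ⟨α, hα⟩ := exists_dual_of_linearIndependent hli (Pi.single (.inr i) (-1))
      refine ⟨α, fun β => ?_⟩
      have h1 : ∀ j, α (e j) = 0 := fun j => by simpa using hα (.inl j)
      have h2 : ∀ j, α (f j) = if j = i then -1 else 0 := fun j => by
        simpa [Pi.single_apply] using hα (.inr j)
      rw [pair_of_normalForm hw]
      simp [h1, h2]
    · obtain ⟨α, hα⟩ := exists_dual_of_linearIndependent hli (Pi.single (.inl i) 1)
      refine ⟨α, fun β => ?_⟩
      have h1 : ∀ j, α (f j) = 0 := fun j => by simpa using hα (.inr j)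
      have h2 : ∀ j, α (e j) = if j = i then 1 else 0 := fun j => by
        simpa [Pi.single_apply] using hα (.inl j)
      rw [pair_of_normalForm hw]
      simp [h1, h2]

/-- A spanning list of length `dim V` is a basis, and its wedge pairs to `1` with the dual basis. -/
lemma list_prod_ι_ne_zero [FiniteDimensional ℂ V] (l : List V)
    (hlen : l.length = Module.finrank ℂ V)
    (hspan : Submodule.span ℂ {v | v ∈ l} = ⊤) : (l.map (ι ℂ)).prod ≠ 0 := by
  have hr : Set.range l.get = {v | v ∈ l} := by ext v; simp [List.mem_iff_get]
  have hli : LinearIndependent ℂ l.get :=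
    linearIndependent_of_top_le_span_of_card_eq_finrank (by rw [hr, hspan]) (by simpa using hlen)
  let b : Module.Basis (Fin l.length) ℂ V :=
    Module.Basis.mk hli (by rw [hr, hspan])
  have hb : ∀ i, b i = l.get i := fun i => Module.Basis.mk_apply _ _ i
  have h1 : pair (exteriorPower.ιMulti ℂ l.length l.get) (fun i => b.coord i) = 1 := by
    rw [pair_ιMulti, ← Matrix.det_one (n := Fin l.length)]
    congr 1
    ext i j
    rw [Matrix.of_apply, ← hb, Module.Basis.coord_apply, Module.Basis.repr_self,
      Finsupp.single_apply, Matrix.one_apply]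
  intro h0
  have h2 : exteriorPower.ιMulti ℂ l.length l.get = 0 := by
    apply Subtype.ext
    rw [exteriorPower.ιMulti_apply_coe, ExteriorAlgebra.ιMulti_apply]
    have : (List.ofFn fun i => ι ℂ (l.get i)) = l.map (ι ℂ) := by
      conv_rhs => rw [← List.ofFn_get l, List.map_ofFn]
      rfl
    rw [this, h0]; rfl
  rw [h2] at h1
  simp at h1

lemma pow_mul_ιMulti_of_normalForm {k d : ℕ} (e f : Fin k → V) (v : Fin d → V) :
    (List.ofFn fun i => ι ℂ (e i) * ι ℂ (f i)).prod * ExteriorAlgebra.ιMulti ℂ d v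
      = ((List.flatten (List.ofFn fun i => [e i, f i]) ++ List.ofFn v).map (ι ℂ)).prod := by
  rw [List.map_append, List.prod_append, ExteriorAlgebra.ιMulti_apply, List.map_flatten,
    List.prod_flatten, List.map_ofFn, List.map_ofFn, List.map_ofFn]
  congr 2
  simp [Function.comp_def]

/-- The rank of a bivector `w` is `2k`, where `k` is the largest exponent with `w ^ k ≠ 0`. -/
lemma bivector_rank [FiniteDimensional ℂ V] (w : ⋀[ℂ]^2 V) :
    ∃ k, Module.finrank ℂ (sharpRange w) = 2 * k ∧
      (w : ExteriorAlgebra ℂ V) ^ k ≠ 0 ∧ (w : ExteriorAlgebra ℂ V) ^ (k + 1) = 0 ∧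
      ∀ (d : ℕ) (x : Fin d → V), 2 * k + d = Module.finrank ℂ V →
        sharpRange w ⊔ Submodule.span ℂ (Set.range x) = ⊤ →
        (w : ExteriorAlgebra ℂ V) ^ k * ExteriorAlgebra.ιMulti ℂ d x ≠ 0 := by
  classical
  obtain ⟨k, e, f, hli, hw⟩ := exists_normalForm w
  have hs := sharpRange_of_normalForm hli hw
  obtain ⟨h1, h2⟩ := sum_pow_of_mul_self_eq_zero (fun i => ι ℂ (e i) * ι ℂ (f i))
    (fun i j => commute_two _ _ _ _) (fun i => ι_mul_ι_sq _ _)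
  have hfr : Module.finrank ℂ (sharpRange w) = 2 * k := by
    rw [hs, finrank_span_eq_card hli]; simp [two_mul]
  have key : ∀ (d : ℕ) (x : Fin d → V), 2 * k + d = Module.finrank ℂ V →
        sharpRange w ⊔ Submodule.span ℂ (Set.range x) = ⊤ →
        (w : ExteriorAlgebra ℂ V) ^ k * ExteriorAlgebra.ιMulti ℂ d x ≠ 0 := by
    intro d x hd hx
    -- Here `w ^ k = k! e₁ ∧ f₁ ∧ ⋯ ∧ e_k ∧ f_k`, so the product is `k!` times the wedge of `2k + d
    -- = dim V` spanning vectors.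
    rw [hw, h1, smul_mul_assoc, pow_mul_ιMulti_of_normalForm, ← Nat.cast_smul_eq_nsmul ℂ]
    refine smul_ne_zero (by exact_mod_cast k.factorial_ne_zero) (list_prod_ι_ne_zero _ ?_ ?_)
    · rw [← hd]; simp [List.length_flatten, List.map_ofFn, Function.comp_def, mul_comm]
    · rw [eq_top_iff, ← hx, hs, ← Submodule.span_union]
      refine Submodule.span_mono ?_
      rintro _ (⟨i | i, rfl⟩ | ⟨i, rfl⟩)
      · simp; left; exact ⟨i, Or.inl rfl⟩
      · simp; left; exact ⟨i, Or.inr rfl⟩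
      · simp
  refine ⟨k, hfr, ?_, by rw [hw, h2], key⟩
  -- For `w ^ k ≠ 0`, complete by a basis of a complement of the range: the full product is nonzero,
  -- hence so is its left factor.
  obtain ⟨C, hC⟩ := (sharpRange w).exists_isCompl
  let b := Module.finBasis ℂ C
  have hd : 2 * k + Module.finrank ℂ C = Module.finrank ℂ V := by
    rw [← hfr]; exact Submodule.finrank_add_eq_of_isCompl hC
  have := key _ (fun i => (b i : V)) hd (by
    have : Submodule.span ℂ (Set.range fun i => (b i : V)) = C := by
      rw [show (fun i => (b i : V)) = C.subtype ∘ b from rfl, Set.range_comp,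
        ← Submodule.map_span, b.span_eq, Submodule.map_top, Submodule.range_subtype]
    rw [this, hC.sup_eq_top])
  exact left_ne_zero_of_mul this

end NormalForm

/-! ### Ranks, isotropic families and degenerate determinants -/

section Rank

variable {V V' : Type*} [AddCommGroup V] [Module ℂ V] [FiniteDimensional ℂ V]
  [AddCommGroup V'] [Module ℂ V']

lemma two_mul_le_finrank_sharpRange {w : ⋀[ℂ]^2 V} {j : ℕ}
    (h : (w : ExteriorAlgebra ℂ V) ^ j ≠ 0) : 2 * j ≤ Module.finrank ℂ (sharpRange w) := by
  obtain ⟨k, hk, -, h0, -⟩ := bivector_rank w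
  rw [hk]
  by_contra hlt
  exact h (pow_eq_zero_of_le (by omega) h0)

lemma pow_succ_eq_zero_of_finrank_sharpRange_le {w : ⋀[ℂ]^2 V} {j : ℕ}
    (h : Module.finrank ℂ (sharpRange w) ≤ 2 * j) : (w : ExteriorAlgebra ℂ V) ^ (j + 1) = 0 := by
  by_contra h0
  have := two_mul_le_finrank_sharpRange h0
  omega

lemma exists_finrank_sharpRange_eq (w : ⋀[ℂ]^2 V) :
    ∃ k, Module.finrank ℂ (sharpRange w) = 2 * k ∧ (w : ExteriorAlgebra ℂ V) ^ k ≠ 0 := by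
  obtain ⟨k, hk, h, -⟩ := bivector_rank w
  exact ⟨k, hk, h⟩

/-- The map `w^# : V* → V`. -/
def sharp (w : ⋀[ℂ]^2 V) : Module.Dual ℂ V →ₗ[ℂ] V :=
  (Module.evalEquiv ℂ V).symm.toLinearMap ∘ₗ bilin w

lemma dual_sharp (w : ⋀[ℂ]^2 V) (α β : Module.Dual ℂ V) : β (sharp w α) = pair w ![α, β] := by
  simp [sharp]

lemma range_sharp (w : ⋀[ℂ]^2 V) : LinearMap.range (sharp w) = sharpRange w := by
  ext v
  constructor
  · rintro ⟨α, rfl⟩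
    exact ⟨α, fun β => dual_sharp w α β⟩
  · rintro ⟨α, hα⟩
    refine ⟨α, ?_⟩
    rw [← sub_eq_zero, ← Module.forall_dual_apply_eq_zero_iff ℂ]
    intro β
    rw [map_sub, dual_sharp, hα, sub_self]

/-- An isotropic family of `q` independent covectors satisfies `q ≤ dim V - rk(w) / 2`. -/
lemma isotropic_card_le (w : ⋀[ℂ]^2 V) {ι : Type*} [Fintype ι] {α : ι → Module.Dual ℂ V}
    (hα : LinearIndependent ℂ α) (h : ∀ i j, pair w ![α i, α j] = 0) :
    2 * Fintype.card ι + Module.finrank ℂ (sharpRange w) ≤ 2 * Module.finrank ℂ V := by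
  set Q := Submodule.span ℂ (Set.range α)
  have hQ : Module.finrank ℂ Q = Fintype.card ι := finrank_span_eq_card hα
  have h1 := LinearMap.finrank_range_add_finrank_ker (sharp w)
  rw [range_sharp, Subspace.dual_finrank_eq] at h1
  have h2 := LinearMap.finrank_range_add_finrank_ker ((sharp w).domRestrict Q)
  have h3 : Module.finrank ℂ (LinearMap.ker ((sharp w).domRestrict Q))
      ≤ Module.finrank ℂ (LinearMap.ker (sharp w)) := by
    let f : LinearMap.ker ((sharp w).domRestrict Q) →ₗ[ℂ] LinearMap.ker (sharp w) :=
      LinearMap.codRestrict _ (Q.subtype ∘ₗ Submodule.subtype _) fun x => x.2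
    refine LinearMap.finrank_le_finrank_of_injective (f := f) fun x y hxy => ?_
    exact Subtype.ext (Subtype.ext
      (congrArg (fun z : LinearMap.ker (sharp w) => (z : Module.Dual ℂ V)) hxy))
  -- Isotropy says that `w^#` maps `Q` into its annihilator. Rank-nullity on `Q`, of dimension `q`,
  -- then gives `q ≤ (dim V - q) + (dim V - rk w)`.
  have h4 : LinearMap.range ((sharp w).domRestrict Q) ≤ Q.dualCoannihilator := by
    rintro _ ⟨⟨x, hx⟩, rfl⟩
    rw [Submodule.mem_dualCoannihilator]
    intro β hβ
    change β (sharp w x) = 0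
    rw [dual_sharp, ← bilin_apply]
    induction hx, hβ using Submodule.span_induction₂ with
    | mem_mem x y hx hy =>
      obtain ⟨i, rfl⟩ := hx
      obtain ⟨j, rfl⟩ := hy
      exact h i j
    | zero_left => simp
    | zero_right => rw [map_zero]
    | add_left x y z _ _ _ h1 h2 => rw [map_add, LinearMap.add_apply, h1, h2, add_zero]
    | add_right x y z _ _ _ h1 h2 => rw [map_add, h1, h2, add_zero]
    | smul_left c x y _ _ h1 => rw [map_smul, LinearMap.smul_apply, h1, smul_zero]
    | smul_right c x y _ _ h1 => rw [map_smul, h1, smul_zero]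
  have h5 := Submodule.finrank_mono h4
  have h6 := Subspace.finrank_add_finrank_dualCoannihilator_eq Q
  omega

end Rank

/-! ### Determinants of small perturbations of matrices of low rank. -/

section Det

open Asymptotics Filter

lemma isBigO_pow_of_le {a b : ℕ} (h : a ≤ b) :
    (fun s : ℂ => s ^ b) =O[nhds 0] (fun s : ℂ => s ^ a) := by
  rcases h.eq_or_lt with rfl | h
  · exact isBigO_refl _ _
  · exact (isLittleO_pow_pow h).isBigO

/-- If `A` has rank at most `q` and `R(s) = O(s)`, then `det (A + R(s)) = O(s^(n - q))`. -/
lemma det_add_isBigO {n q : ℕ} (A : Matrix (Fin n) (Fin n) ℂ) (R : ℂ → Matrix (Fin n) (Fin n) ℂ)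
    (hR : ∀ i j, (fun s => R s i j) =O[nhds 0] (fun s : ℂ => s))
    (hA : ∀ T : Finset (Fin n), q < T.card → ¬ LinearIndependent ℂ (fun i : T => A i)) :
    (fun s => (A + R s).det) =O[nhds 0] (fun s : ℂ => s ^ (n - q)) := by
  classical
  -- Multilinearity in the rows: `T` is the set of rows taken from `A`, the others coming from `R
  -- s`. If `T` has more than `q` elements, the rows from `A` are dependent and the term is zero.
  have hexp : ∀ s, (A + R s).det
      = ∑ T : Finset (Fin n), Matrix.det (T.piecewise (fun i => A i) (fun i => R s i)) :=
    fun s => Matrix.detRowAlternating.toMultilinearMap.map_add_univ (fun i => A i) (fun i => R s i)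
  simp only [hexp]
  refine IsBigO.fun_sum fun T _ => ?_
  by_cases hT : q < T.card
  · have : ∀ s, Matrix.det (T.piecewise (fun i => A i) (fun i => R s i)) = 0 := by
      intro s
      by_contra hne
      have hli := Matrix.linearIndependent_rows_of_det_ne_zero hne
      refine hA T hT ?_
      have h := hli.comp (fun i : T => (i : Fin n)) Subtype.val_injective
      have e : (fun i : T => A i)
          = (fun i => T.piecewise (fun i => A i) (fun i => R s i) i) ∘ fun i : T => (i : Fin n) := by
        ext i : 1
        simp [Finset.piecewise]
      rw [e]
      exact h
    simp only [this]
    exact isBigO_zero _ _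
  -- Otherwise at least `n - q` rows come from `R s`, each contributing a factor `O(s)`.
  · push Not at hT
    rw [funext fun s => Matrix.det_apply (T.piecewise (fun i => A i) (fun i => R s i))]
    refine IsBigO.fun_sum fun σ _ => ?_
    refine IsBigO.const_smul_left ?_ _
    have hprod : (fun s : ℂ => ∏ i, (T.piecewise (fun i => A i) (fun i => R s i)) (σ i) i)
        =O[nhds 0] (fun s : ℂ => ∏ i, if σ i ∈ T then (1 : ℂ) else s) := by
      refine IsBigO.finsetProd (f := fun i s => T.piecewise (fun i => A i) (fun i => R s i) (σ i) i)
        (g := fun i (s : ℂ) => if σ i ∈ T then (1 : ℂ) else s) fun i _ => ?_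
      by_cases hi : σ i ∈ T
      · simp only [Finset.piecewise, hi, if_true]
        exact isBigO_const_const (A (σ i) i) (one_ne_zero' ℂ) _
      · simp only [Finset.piecewise, hi, if_false]
        exact hR _ _
    refine hprod.trans ?_
    have : ∀ s : ℂ, (∏ i, if σ i ∈ T then (1 : ℂ) else s) = s ^ (n - T.card) := by
      intro s
      rw [Equiv.prod_comp σ (fun i => if i ∈ T then (1 : ℂ) else s), Finset.prod_ite]
      simp only [Finset.prod_const_one, one_mul, Finset.prod_const]
      congr 1
      rw [← Finset.compl_filter, Finset.card_compl]
      simp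
    simp only [this]
    exact isBigO_pow_of_le (by omega)

end Det

/-! ### Homogeneous parts and vanishing orders of analytic functions -/

section Taylor

open Asymptotics Filter Topology

variable {n : ℕ}

/-- The homogeneous part of degree `e` of the Taylor expansion of `f` at `x₀`. -/
def homPart (f : Cn n → ℂ) (x₀ : Cn n) (e : ℕ) (v : Cn n) : ℂ :=
  (e.factorial : ℂ)⁻¹ * iteratedFDeriv ℂ e f x₀ (fun _ => v)

/-- The restriction of `f` to the line through `x₀` with direction `v`. -/
def onLine {α : Type*} (f : Cn n → α) (x₀ v : Cn n) (s : ℂ) : α := f (x₀ + s • v)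

/-- The vanishing order of a single function. -/
def ord (f : Cn n → ℂ) (x₀ : Cn n) : ℕ := vanishingOrder (fun _ : Unit => f) x₀

lemma vanishingOrder_eq_ord {ι : Type*} [Unique ι] (c : ι → Cn n → ℂ) (x₀ : Cn n) :
    vanishingOrder c x₀ = ord (c default) x₀ := by
  unfold ord vanishingOrder
  congr 1
  ext e
  simp [Unique.exists_iff]

lemma iteratedFDeriv_congr {f g : Cn n → ℂ} {x₀ : Cn n} (h : f =ᶠ[𝓝 x₀] g) (e : ℕ) :
    iteratedFDeriv ℂ e f x₀ = iteratedFDeriv ℂ e g x₀ :=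
  (h.iteratedFDeriv ℂ e).eq_of_nhds

lemma ord_congr {f g : Cn n → ℂ} {x₀ : Cn n} (h : f =ᶠ[𝓝 x₀] g) : ord f x₀ = ord g x₀ := by
  unfold ord vanishingOrder
  simp only [iteratedFDeriv_congr h]

lemma tendsto_line (x₀ v : Cn n) : Tendsto (fun s : ℂ => x₀ + s • v) (𝓝 0) (𝓝 x₀) := by
  have : Continuous (fun s : ℂ => x₀ + s • v) := by fun_prop
  simpa using this.tendsto 0

/-- On a line through `x₀` the homogeneous parts become the coefficients of the powers of `s`. All
later comparisons of orders are therefore one-variable estimates. -/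
lemma onLine_sub_sum_isBigO {f : Cn n → ℂ} {x₀ : Cn n} (hf : AnalyticAt ℂ f x₀) (N : ℕ)
    (v : Cn n) :
    (fun s => onLine f x₀ v s - ∑ j ∈ Finset.range N, s ^ j * homPart f x₀ j v)
      =O[𝓝 0] (fun s : ℂ => s ^ N) := by
  obtain ⟨p, r, hp⟩ := hf
  have h := (HasFPowerSeriesOnBall.hasFPowerSeriesAt hp).isBigO_sub_partialSum_pow N
  have ht : Tendsto (fun s : ℂ => s • v) (𝓝 0) (𝓝 0) := by
    have : Continuous (fun s : ℂ => s • v) := by fun_prop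
    simpa using this.tendsto 0
  have h2 := h.comp_tendsto ht
  refine (h2.congr_left fun s => ?_).trans ?_
  · simp only [Function.comp, onLine, FormalMultilinearSeries.partialSum]
    congr 1
    refine Finset.sum_congr rfl fun j _ => ?_
    have e1 : p j (fun _ => s • v) = s ^ j * p j (fun _ => v) := by
      simpa using (p j).map_smul_univ (fun _ => s) (fun _ => v)
    rw [e1, homPart, ← hp.factorial_smul v j, nsmul_eq_mul, inv_mul_cancel_left₀]
    exact_mod_cast j.factorial_ne_zero
  · refine IsBigO.of_bound (‖v‖ ^ N) (Eventually.of_forall fun s => ?_)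
    simp [norm_smul, mul_pow, mul_comm]

/-- Dividing by `s ^ e` away from `0` gives `c = o(1)`. -/
lemma eq_zero_of_mul_pow_isBigO {c : ℂ} {e : ℕ}
    (h : (fun s : ℂ => s ^ e * c) =O[𝓝 0] (fun s : ℂ => s ^ (e + 1))) : c = 0 := by
  have h1 : (fun s : ℂ => s ^ e * c) =o[𝓝[≠] 0] (fun s : ℂ => s ^ e) :=
    (h.trans_isLittleO (isLittleO_pow_pow (Nat.lt_succ_self e))).mono nhdsWithin_le_nhds
  have h2 : (fun _ : ℂ => c) =o[𝓝[≠] 0] (fun _ : ℂ => (1 : ℂ)) := by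
    have h3 := (isBigO_refl (fun s : ℂ => (s ^ e)⁻¹) (𝓝[≠] 0)).mul_isLittleO h1
    refine h3.congr' ?_ ?_ <;>
    · filter_upwards [self_mem_nhdsWithin] with s hs
      have : s ^ e ≠ 0 := pow_ne_zero _ hs
      field_simp
  rw [isLittleO_const_const_iff] at h2
  simpa using h2

lemma onLine_sub_homPart_isBigO {f : Cn n → ℂ} {x₀ : Cn n} (hf : AnalyticAt ℂ f x₀) {e : ℕ}
    {v : Cn n} (h0 : ∀ j < e, homPart f x₀ j v = 0) :
    (fun s => onLine f x₀ v s - s ^ e * homPart f x₀ e v) =O[𝓝 0] (fun s : ℂ => s ^ (e + 1)) := by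
  refine (onLine_sub_sum_isBigO hf (e + 1) v).congr_left fun s => ?_
  rw [Finset.sum_range_succ, Finset.sum_eq_zero, zero_add]
  intro j hj
  rw [h0 j (Finset.mem_range.1 hj), mul_zero]

lemma onLine_isBigO {f : Cn n → ℂ} {x₀ : Cn n} (hf : AnalyticAt ℂ f x₀) {e : ℕ}
    {v : Cn n} (h0 : ∀ j < e, homPart f x₀ j v = 0) :
    onLine f x₀ v =O[𝓝 0] (fun s : ℂ => s ^ e) := by
  refine (onLine_sub_sum_isBigO hf e v).congr_left fun s => ?_
  rw [Finset.sum_eq_zero, sub_zero]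
  intro j hj
  rw [h0 j (Finset.mem_range.1 hj), mul_zero]

lemma homPart_eq_zero_of_isBigO {f : Cn n → ℂ} {x₀ : Cn n} (hf : AnalyticAt ℂ f x₀) {e : ℕ}
    {v : Cn n} (h : onLine f x₀ v =O[𝓝 0] (fun s : ℂ => s ^ e)) :
    ∀ j < e, homPart f x₀ j v = 0 := by
  intro j
  induction j using Nat.strong_induction_on with
  | _ j ih =>
    intro hj
    have h1 := onLine_sub_homPart_isBigO hf (e := j) (v := v) fun i hi => ih i hi (hi.trans hj)
    refine eq_zero_of_mul_pow_isBigO (e := j) ?_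
    refine ((h.trans (isBigO_pow_of_le hj)).sub h1).congr_left fun s => ?_
    ring

lemma homPart_eq_of_isBigO {f : Cn n → ℂ} {x₀ : Cn n} (hf : AnalyticAt ℂ f x₀) {e : ℕ}
    {v : Cn n} {c : ℂ}
    (h : (fun s => onLine f x₀ v s - s ^ e * c) =O[𝓝 0] (fun s : ℂ => s ^ (e + 1))) :
    homPart f x₀ e v = c := by
  have hO : onLine f x₀ v =O[𝓝 0] (fun s : ℂ => s ^ e) := by
    have h1 : (fun s : ℂ => s ^ e * c) =O[𝓝 0] (fun s : ℂ => s ^ e) := by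
      simpa [mul_comm] using (isBigO_refl (fun s : ℂ => s ^ e) (𝓝 0)).const_mul_left c
    refine ((h.trans (isBigO_pow_of_le e.le_succ)).add h1).congr_left fun s => by ring
  have h2 := onLine_sub_homPart_isBigO hf (homPart_eq_zero_of_isBigO hf hO)
  rw [← sub_eq_zero]
  refine eq_zero_of_mul_pow_isBigO (e := e) ?_
  exact (h.sub h2).congr_left fun s => by ring

/-- Polarization: the `e`-th derivative of the diagonal restriction of a symmetric `e`-linear form
is `e!` times the form. -/
lemma iteratedFDeriv_eq_zero_of_homPart {f : Cn n → ℂ} {x₀ : Cn n} (hf : AnalyticAt ℂ f x₀)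
    {e : ℕ} (h : ∀ v, homPart f x₀ e v = 0) : iteratedFDeriv ℂ e f x₀ = 0 := by
  have hne : (e.factorial : ℂ) ≠ 0 := by exact_mod_cast e.factorial_ne_zero
  have hd : ∀ v, iteratedFDeriv ℂ e f x₀ (fun _ => v) = 0 := fun v => by
    have := h v
    rw [homPart] at this
    exact (mul_eq_zero.1 this).resolve_left (inv_ne_zero hne)
  ext v
  have h1 := (iteratedFDeriv ℂ e f x₀).iteratedFDeriv_comp_diagonal (0 : Cn n) v
  have h2 : (fun x => iteratedFDeriv ℂ e f x₀ (fun _ => x)) = fun _ => 0 := funext hd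
  have h3 : ∀ σ : Equiv.Perm (Fin e), iteratedFDeriv ℂ e f x₀ (fun i => v (σ i))
      = iteratedFDeriv ℂ e f x₀ v := fun σ => hf.contDiffAt.iteratedFDeriv_comp_perm v σ
  rw [h2] at h1
  simp only [h3, Finset.sum_const, Finset.card_univ, Fintype.card_perm, Fintype.card_fin,
    nsmul_eq_mul] at h1
  have h4 : iteratedFDeriv ℂ e (fun _ : Cn n => (0 : ℂ)) 0 v = 0 := by
    simp
  rw [h4] at h1
  exact (mul_eq_zero.1 h1.symm).resolve_left hne

lemma homPart_eq_zero_of_lt_ord {f : Cn n → ℂ} {x₀ : Cn n} {j : ℕ} (hj : j < ord f x₀)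
    (v : Cn n) : homPart f x₀ j v = 0 := by
  have := Nat.notMem_of_lt_sInf hj
  simp only [Set.mem_ofPred_eq, not_exists, not_not] at this
  simp [homPart, this ()]

lemma iteratedFDeriv_eq_zero_of_lt_ord {f : Cn n → ℂ} {x₀ : Cn n} {j : ℕ}
    (hj : j < ord f x₀) : iteratedFDeriv ℂ j f x₀ = 0 := by
  have := Nat.notMem_of_lt_sInf hj
  simp only [Set.mem_ofPred_eq, not_exists, not_not] at this
  exact this ()

/-- The bounds on all lines exclude nonzero terms of degree below `e`, and a single direction
suffices to detect degree `e`. -/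
lemma ord_eq {f : Cn n → ℂ} {x₀ : Cn n} (hf : AnalyticAt ℂ f x₀) {e : ℕ}
    (h0 : ∀ v, onLine f x₀ v =O[𝓝 0] (fun s : ℂ => s ^ e)) {v : Cn n}
    (hv : homPart f x₀ e v ≠ 0) : ord f x₀ = e := by
  refine le_antisymm (Nat.sInf_le ⟨(), ?_⟩) ?_
  · intro h
    exact hv (by simp [homPart, h])
  · refine le_csInf ⟨e, (), fun h => hv (by simp [homPart, h])⟩ ?_
    rintro j ⟨_, hj⟩
    by_contra! hlt
    exact hj (iteratedFDeriv_eq_zero_of_homPart hf fun w =>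
      homPart_eq_zero_of_isBigO hf (h0 w) j hlt)

/-- A nonzero homogeneous part must be assumed: for a function with zero Taylor series, `ord` is the
infimum of the empty set, that is `0`. -/
lemma le_ord {f : Cn n → ℂ} {x₀ : Cn n} (hf : AnalyticAt ℂ f x₀) {e : ℕ}
    (h0 : ∀ v, onLine f x₀ v =O[𝓝 0] (fun s : ℂ => s ^ e))
    (hne : ∃ j v, homPart f x₀ j v ≠ 0) : e ≤ ord f x₀ := by
  obtain ⟨j, v, hv⟩ := hne
  refine le_csInf ⟨j, (), fun h => hv (by simp [homPart, h])⟩ ?_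
  rintro j ⟨_, hj⟩
  by_contra! hlt
  exact hj (iteratedFDeriv_eq_zero_of_homPart hf fun w =>
    homPart_eq_zero_of_isBigO hf (h0 w) j hlt)

/-- An analytic function with zero Taylor series vanishes near `x₀`, so the infimum defining `ord`
is attained; polarization then yields a direction. -/
lemma exists_homPart_ne_zero {f : Cn n → ℂ} {x₀ : Cn n} (hf : AnalyticAt ℂ f x₀)
    (hne : ¬ f =ᶠ[𝓝 x₀] 0) : ∃ v, homPart f x₀ (ord f x₀) v ≠ 0 := by
  have hex : ∃ e, iteratedFDeriv ℂ e f x₀ ≠ 0 := by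
    by_contra! hall
    apply hne
    obtain ⟨p, r, hp⟩ := hf
    filter_upwards [Metric.eball_mem_nhds x₀ hp.r_pos] with y hy
    have hy' : y - x₀ ∈ Metric.eball (0 : Cn n) r := by
      simpa [edist_eq_enorm_sub] using hy
    have h1 := hp.hasSum_iteratedFDeriv hy'
    have h2 : (fun m : ℕ => ((m.factorial : ℂ)⁻¹ • iteratedFDeriv ℂ m f x₀ fun _ => y - x₀))
        = fun _ => 0 := by
      ext m
      rw [hall m]
      simp
    rw [h2, add_sub_cancel] at h1
    exact h1.unique hasSum_zero
  have hmem : iteratedFDeriv ℂ (ord f x₀) f x₀ ≠ 0 := by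
    obtain ⟨e, he⟩ := hex
    obtain ⟨_, h⟩ := Nat.sInf_mem (s := {e : ℕ | ∃ _ : Unit, iteratedFDeriv ℂ e f x₀ ≠ 0})
      ⟨e, (), he⟩
    exact h
  by_contra! hall
  exact hmem (iteratedFDeriv_eq_zero_of_homPart hf hall)

lemma not_eventually_zero_of_homPart_ne_zero {f : Cn n → ℂ} {x₀ : Cn n} {e : ℕ} {v : Cn n}
    (h : homPart f x₀ e v ≠ 0) : ¬ f =ᶠ[𝓝 x₀] 0 := by
  intro h0
  apply h
  rw [homPart, iteratedFDeriv_congr h0]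
  simp

lemma onLine_isBigO_ord {f : Cn n → ℂ} {x₀ : Cn n} (hf : AnalyticAt ℂ f x₀) (v : Cn n) :
    onLine f x₀ v =O[𝓝 0] (fun s : ℂ => s ^ ord f x₀) :=
  onLine_isBigO hf fun _ hj => homPart_eq_zero_of_lt_ord hj v

lemma onLine_sub_isBigO_ord {f : Cn n → ℂ} {x₀ : Cn n} (hf : AnalyticAt ℂ f x₀) (v : Cn n) :
    (fun s => onLine f x₀ v s - s ^ ord f x₀ * homPart f x₀ (ord f x₀) v)
      =O[𝓝 0] (fun s : ℂ => s ^ (ord f x₀ + 1)) :=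
  onLine_sub_homPart_isBigO hf fun _ hj => homPart_eq_zero_of_lt_ord hj v

/-! ### Polynomial functions -/

lemma IsPolynomialFun.const (c : ℂ) : IsPolynomialFun (fun _ : Cn n => c) :=
  ⟨MvPolynomial.C c, fun v => by simp⟩

lemma IsPolynomialFun.coord (i : Fin n) : IsPolynomialFun (fun v : Cn n => v i) :=
  ⟨MvPolynomial.X i, fun v => by simp⟩

lemma IsPolynomialFun.mul {f g : Cn n → ℂ} (hf : IsPolynomialFun f) (hg : IsPolynomialFun g) :
    IsPolynomialFun (fun v => f v * g v) := by
  obtain ⟨p, hp⟩ := hf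
  obtain ⟨q, hq⟩ := hg
  exact ⟨p * q, fun v => by simp [hp, hq]⟩

lemma IsPolynomialFun.sum {ι : Type*} {s : Finset ι} {f : ι → Cn n → ℂ}
    (hf : ∀ i ∈ s, IsPolynomialFun (f i)) : IsPolynomialFun (fun v => ∑ i ∈ s, f i v) := by
  choose! p hp using hf
  exact ⟨∑ i ∈ s, p i, fun v => by
    rw [map_sum]; exact Finset.sum_congr rfl fun i hi => hp i hi v⟩

lemma IsPolynomialFun.prod {ι : Type*} {s : Finset ι} {f : ι → Cn n → ℂ}
    (hf : ∀ i ∈ s, IsPolynomialFun (f i)) : IsPolynomialFun (fun v => ∏ i ∈ s, f i v) := by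
  choose! p hp using hf
  exact ⟨∏ i ∈ s, p i, fun v => by
    rw [map_prod]; exact Finset.prod_congr rfl fun i hi => hp i hi v⟩

lemma IsPolynomialFun.of_linear (l : Cn n →ₗ[ℂ] ℂ) : IsPolynomialFun (fun v => l v) := by
  have : ∀ v : Cn n, l v = ∑ i, v i * l (EuclideanSpace.single i 1) := by
    intro v
    conv_lhs => rw [← (EuclideanSpace.basisFun (Fin n) ℂ).sum_repr v]
    simp [map_sum]
  rw [funext this]
  exact IsPolynomialFun.sum fun i _ => (IsPolynomialFun.coord i).mul (IsPolynomialFun.const _)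

/-- Polynomials over `ℂ` form a domain, and a nonzero one is a nonzero function. This lets several
generic conditions be imposed on one direction `v`. -/
lemma IsPolynomialFun.exists_mul_ne_zero {f g : Cn n → ℂ} (hf : IsPolynomialFun f)
    (hg : IsPolynomialFun g) (hf0 : ∃ v, f v ≠ 0) (hg0 : ∃ v, g v ≠ 0) :
    ∃ v, f v ≠ 0 ∧ g v ≠ 0 := by
  obtain ⟨p, hp⟩ := hf
  obtain ⟨q, hq⟩ := hg
  have hp0 : p ≠ 0 := by
    rintro rfl
    obtain ⟨v, hv⟩ := hf0
    exact hv (by simp [hp])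
  have hq0 : q ≠ 0 := by
    rintro rfl
    obtain ⟨v, hv⟩ := hg0
    exact hv (by simp [hq])
  have hpq := mul_ne_zero hp0 hq0
  obtain ⟨x, hx⟩ : ∃ x : Fin n → ℂ, MvPolynomial.eval x (p * q) ≠ 0 := by
    by_contra! h
    exact hpq (MvPolynomial.funext fun x => by rw [h x, map_zero])
  refine ⟨WithLp.toLp 2 x, ?_⟩
  rw [hp, hq]
  rw [map_mul] at hx
  exact ⟨left_ne_zero_of_mul hx, right_ne_zero_of_mul hx⟩

lemma isPolynomialFun_homPart (f : Cn n → ℂ) (x₀ : Cn n) (e : ℕ) :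
    IsPolynomialFun (homPart f x₀ e) := by
  have : ∀ v : Cn n, iteratedFDeriv ℂ e f x₀ (fun _ => v)
      = ∑ r : Fin e → Fin n, (∏ i, v (r i)) *
        iteratedFDeriv ℂ e f x₀ (fun i => EuclideanSpace.single (r i) 1) := by
    intro v
    have hv : v = ∑ i, v i • EuclideanSpace.single i (1 : ℂ) := by
      conv_lhs => rw [← (EuclideanSpace.basisFun (Fin n) ℂ).sum_repr v]
      simp
    conv_lhs => rw [hv]
    rw [ContinuousMultilinearMap.map_sum]
    refine Finset.sum_congr rfl fun r _ => ?_
    rw [ContinuousMultilinearMap.map_smul_univ, smul_eq_mul]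
  unfold homPart
  simp only [this]
  exact (IsPolynomialFun.const _).mul (IsPolynomialFun.sum fun r _ =>
    (IsPolynomialFun.prod fun i _ => IsPolynomialFun.coord _).mul (IsPolynomialFun.const _))

/-! ### Products -/

/-- The lowest term of the product is the product of the lowest terms, which is not the zero
polynomial. -/
lemma ord_mul {f g : Cn n → ℂ} {x₀ : Cn n} (hf : AnalyticAt ℂ f x₀) (hg : AnalyticAt ℂ g x₀)
    (hf0 : ¬ f =ᶠ[𝓝 x₀] 0) (hg0 : ¬ g =ᶠ[𝓝 x₀] 0) :
    ord (fun x => f x * g x) x₀ = ord f x₀ + ord g x₀ ∧ ¬ (fun x => f x * g x) =ᶠ[𝓝 x₀] 0 := by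
  have hmul : AnalyticAt ℂ (fun x => f x * g x) x₀ := hf.mul hg
  obtain ⟨v, hv1, hv2⟩ := (isPolynomialFun_homPart f x₀ (ord f x₀)).exists_mul_ne_zero
    (isPolynomialFun_homPart g x₀ (ord g x₀)) (exists_homPart_ne_zero hf hf0)
    (exists_homPart_ne_zero hg hg0)
  have hO : ∀ w, onLine (fun x => f x * g x) x₀ w =O[𝓝 0] (fun s : ℂ => s ^ (ord f x₀ + ord g x₀)) := by
    intro w
    refine ((onLine_isBigO_ord hf w).mul (onLine_isBigO_ord hg w)).congr_right fun s => ?_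
    rw [pow_add]
  have hh : homPart (fun x => f x * g x) x₀ (ord f x₀ + ord g x₀) v
      = homPart f x₀ (ord f x₀) v * homPart g x₀ (ord g x₀) v := by
    refine homPart_eq_of_isBigO hmul ?_
    have h1 := (onLine_sub_isBigO_ord hf v).mul (onLine_isBigO_ord hg v)
    have h2 : (fun s : ℂ => s ^ ord f x₀ * homPart f x₀ (ord f x₀) v) =O[𝓝 0]
        (fun s : ℂ => s ^ ord f x₀) := by
      simpa [mul_comm] using (isBigO_refl (fun s : ℂ => s ^ ord f x₀) (𝓝 0)).const_mul_left
        (homPart f x₀ (ord f x₀) v)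
    have h3 := h2.mul (onLine_sub_isBigO_ord hg v)
    have h1' := h1.congr_right (g₂ := fun s : ℂ => s ^ (ord f x₀ + ord g x₀ + 1)) fun s => by ring
    have h3' := h3.congr_right (g₂ := fun s : ℂ => s ^ (ord f x₀ + ord g x₀ + 1)) fun s => by ring
    refine (h1'.add h3').congr_left fun s => ?_
    simp only [onLine]
    ring
  have hne : homPart (fun x => f x * g x) x₀ (ord f x₀ + ord g x₀) v ≠ 0 := by
    rw [hh]; exact mul_ne_zero hv1 hv2
  exact ⟨ord_eq hmul hO hne, not_eventually_zero_of_homPart_ne_zero hne⟩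

lemma ord_const {c : ℂ} (hc : c ≠ 0) (x₀ : Cn n) : ord (fun _ => c) x₀ = 0 := by
  refine ord_eq analyticAt_const (fun v => ?_) (v := 0) (e := 0) ?_
  · simp only [pow_zero]; exact isBigO_const_const _ one_ne_zero _
  · simpa [homPart] using hc

lemma not_eventually_zero_const {c : ℂ} (hc : c ≠ 0) (x₀ : Cn n) :
    ¬ (fun _ => c) =ᶠ[𝓝 x₀] (0 : Cn n → ℂ) := fun h => hc h.eq_of_nhds

lemma ord_prod {ι : Type*} (s : Finset ι) {f : ι → Cn n → ℂ} {x₀ : Cn n}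
    (hf : ∀ i, AnalyticAt ℂ (f i) x₀) (hf0 : ∀ i, ¬ f i =ᶠ[𝓝 x₀] 0) :
    ord (fun x => ∏ i ∈ s, f i x) x₀ = ∑ i ∈ s, ord (f i) x₀ ∧
      ¬ (fun x => ∏ i ∈ s, f i x) =ᶠ[𝓝 x₀] 0 := by
  classical
  induction s using Finset.induction_on with
  | empty => simpa using ⟨ord_const one_ne_zero x₀, not_eventually_zero_const one_ne_zero x₀⟩
  | insert i s hi ih =>
    simp only [Finset.prod_insert hi, Finset.sum_insert hi]
    have := ord_mul (hf i) (Finset.analyticAt_fun_prod s fun j _ => hf j) (hf0 i) ih.2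
    rw [ih.1] at this
    exact this

/-! ### Gradients -/

/-- The `k`-th partial derivative. -/
def pderiv (k : Fin n) (f : Cn n → ℂ) (x : Cn n) : ℂ :=
  fderiv ℂ f x (EuclideanSpace.single k 1)

lemma AnalyticAt.pderiv {f : Cn n → ℂ} {x₀ : Cn n} (hf : AnalyticAt ℂ f x₀) (k : Fin n) :
    AnalyticAt ℂ (pderiv k f) x₀ :=
  ((ContinuousLinearMap.apply ℂ ℂ (EuclideanSpace.single k (1 : ℂ))).analyticAt _).comp hf.fderiv

lemma iteratedFDeriv_pderiv {f : Cn n → ℂ} {x₀ : Cn n} (hf : AnalyticAt ℂ f x₀) (k : Fin n)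
    (e : ℕ) (v : Fin e → Cn n) :
    iteratedFDeriv ℂ e (pderiv k f) x₀ v
      = iteratedFDeriv ℂ (e + 1) f x₀ (Fin.snoc v (EuclideanSpace.single k 1)) := by
  rw [iteratedFDeriv_succ_apply_right]
  simp only [Fin.init_snoc, Fin.snoc_last]
  have h := ContinuousLinearMap.iteratedFDeriv_comp_left
    (ContinuousLinearMap.apply ℂ ℂ (EuclideanSpace.single k (1 : ℂ)) : (Cn n →L[ℂ] ℂ) →L[ℂ] ℂ)
    (f := fderiv ℂ f) (x := x₀) (n := ω) (i := e) hf.fderiv.contDiffAt (by simp)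
  have h2 := congrArg (fun g => g v) h
  simp only [ContinuousLinearMap.compContinuousMultilinearMap_coe, Function.comp] at h2
  exact h2

/-- Differentiating the diagonal restriction of the symmetric form gives `e + 1` equal terms, which
turn `1 / (e + 1)!` into `1 / e!`. -/
lemma pderiv_homPart {f : Cn n → ℂ} {x₀ : Cn n} (hf : AnalyticAt ℂ f x₀) (k : Fin n)
    (e : ℕ) (v : Cn n) :
    pderiv k (homPart f x₀ (e + 1)) v = homPart (pderiv k f) x₀ e v := by
  set M := iteratedFDeriv ℂ (e + 1) f x₀
  have h1 : HasFDerivAt (fun v : Cn n => M (fun _ => v))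
      ((M.linearDeriv (fun _ => v)).comp
        (ContinuousLinearMap.pi fun _ => ContinuousLinearMap.id ℂ (Cn n))) v :=
    (M.hasFDerivAt (fun _ => v)).comp v (ContinuousLinearMap.hasFDerivAt
      (ContinuousLinearMap.pi fun _ => ContinuousLinearMap.id ℂ (Cn n)))
  have h2 : HasFDerivAt (homPart f x₀ (e + 1)) _ v := h1.const_mul ((e + 1).factorial : ℂ)⁻¹
  rw [pderiv, h2.fderiv]
  have hsymm : ∀ i : Fin (e + 1), M (Function.update (fun _ => v) i (EuclideanSpace.single k 1))
      = M (Fin.snoc (fun _ => v) (EuclideanSpace.single k 1)) := by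
    intro i
    have hp := hf.contDiffAt.iteratedFDeriv_comp_perm
      (Fin.snoc (fun _ : Fin e => v) (EuclideanSpace.single k (1 : ℂ))) (Equiv.swap i (Fin.last e))
    rw [← hp]
    congr 1
    ext j : 1
    by_cases hj : j = i
    · subst hj
      simp
    · rw [Function.update_of_ne hj]
      have hne : Equiv.swap i (Fin.last e) j ≠ Fin.last e := by
        intro h
        apply hj
        exact Equiv.injective _ (h.trans (Equiv.swap_apply_left i (Fin.last e)).symm)
      obtain ⟨j', hj'⟩ := Fin.exists_castSucc_eq.2 hne
      simp only [Function.comp, ← hj', Fin.snoc_castSucc]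
  simp only [_root_.smul_apply, ContinuousLinearMap.comp_apply,
    ContinuousMultilinearMap.linearDeriv_apply, ContinuousLinearMap.pi_apply,
    ContinuousLinearMap.id_apply, hsymm, Finset.sum_const, Finset.card_univ, Fintype.card_fin]
  rw [homPart, iteratedFDeriv_pderiv hf]
  have : (e.factorial : ℂ) ≠ 0 := by exact_mod_cast e.factorial_ne_zero
  have : ((e : ℂ) + 1) ≠ 0 := by exact_mod_cast e.succ_ne_zero
  rw [Nat.factorial_succ]
  simp only [smul_eq_mul, nsmul_eq_mul]
  push_cast
  field_simp
  rfl

/-- The leading term of the gradient along a line. -/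
lemma onLine_pderiv_isBigO {f : Cn n → ℂ} {x₀ : Cn n} (hf : AnalyticAt ℂ f x₀) (k : Fin n)
    (v : Cn n) :
    (fun s => s * onLine (pderiv k f) x₀ v s
        - s ^ ord f x₀ * pderiv k (homPart f x₀ (ord f x₀)) v)
      =O[𝓝 0] (fun s : ℂ => s ^ (ord f x₀ + 1)) := by
  -- The extra factor `s` in the statement avoids the exponent `ord - 1`. For order `0` the lowest
  -- term is constant, its gradient vanishes, and `s ∂_k f = O(s)` is all that is claimed.
  rcases h : ord f x₀ with _ | e
  · have h0 : pderiv k (homPart f x₀ 0) v = 0 := by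
      have : homPart f x₀ 0 = fun _ => f x₀ := by ext; simp [homPart]
      rw [this, pderiv]; simp
    have h1 := onLine_isBigO (AnalyticAt.pderiv hf k) (e := 0) (v := v) (by simp)
    have h2 := (isBigO_refl (fun s : ℂ => s) (𝓝 0)).mul h1
    refine (h2.congr_left fun s => ?_).congr_right fun s => ?_
    · rw [h0]; ring
    · ring
  · have h1 := onLine_sub_homPart_isBigO (AnalyticAt.pderiv hf k) (e := e) (v := v) (by
      intro j hj
      rw [homPart, iteratedFDeriv_pderiv hf, iteratedFDeriv_eq_zero_of_lt_ord (by omega)]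
      simp)
    have h2 := (isBigO_refl (fun s : ℂ => s) (𝓝 0)).mul h1
    refine (h2.congr_left fun s => ?_).congr_right fun s => ?_
    · rw [pderiv_homPart hf]; ring
    · ring

end Taylor

/-! ### Functions with values in a finite-dimensional algebra -/

section AlgebraValued

open Asymptotics Filter Topology

variable {X A : Type*} [Ring A] [Algebra ℂ A]

/-- Coordinates of a product are bilinear in the coordinates of the factors, so regularity and
growth bounds pass to products in the exterior algebra. -/
lemma functional_mul_eq [FiniteDimensional ℂ A] (l : A →ₗ[ℂ] ℂ) (a b : A) :
    l (a * b) = ∑ i, ∑ j, (Module.finBasis ℂ A).coord i a * (Module.finBasis ℂ A).coord j b *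
      l (Module.finBasis ℂ A i * Module.finBasis ℂ A j) := by
  conv_lhs => rw [← (Module.finBasis ℂ A).sum_repr a, ← (Module.finBasis ℂ A).sum_repr b]
  simp only [Finset.sum_mul, Finset.mul_sum, map_sum, smul_mul_assoc, mul_smul_comm, map_smul,
    smul_eq_mul, Module.Basis.coord_apply]
  rw [Finset.sum_comm]
  refine Finset.sum_congr rfl fun i _ => Finset.sum_congr rfl fun j _ => by ring

/-- All coordinates of `F` belong to the algebra of functions `R`. -/
def CoeffsIn (R : Subalgebra ℂ (X → ℂ)) (F : X → A) : Prop :=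
  ∀ l : A →ₗ[ℂ] ℂ, (fun x => l (F x)) ∈ R

namespace CoeffsIn

variable {R : Subalgebra ℂ (X → ℂ)} {F G : X → A}

lemma const (a : A) : CoeffsIn R (fun _ => a) := fun l => R.algebraMap_mem (l a)

lemma smul_const {f : X → ℂ} (hf : f ∈ R) (a : A) : CoeffsIn R (fun x => f x • a) := fun l => by
  have : (fun x => l (f x • a)) = f * algebraMap ℂ (X → ℂ) (l a) := by
    ext x; simp
  rw [this]
  exact R.mul_mem hf (R.algebraMap_mem _)

lemma sum {ι : Type*} {s : Finset ι} {F : ι → X → A} (hF : ∀ i ∈ s, CoeffsIn R (F i)) :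
    CoeffsIn R (fun x => ∑ i ∈ s, F i x) := fun l => by
  have : (fun x => l (∑ i ∈ s, F i x)) = ∑ i ∈ s, fun x => l (F i x) := by
    ext x; simp
  rw [this]
  exact R.sum_mem fun i hi => hF i hi l

lemma mul [FiniteDimensional ℂ A] (hF : CoeffsIn R F) (hG : CoeffsIn R G) :
    CoeffsIn R (fun x => F x * G x) := fun l => by
  have : (fun x => l (F x * G x)) = ∑ i, ∑ j,
      (fun x => (Module.finBasis ℂ A).coord i (F x)) *
      (fun x => (Module.finBasis ℂ A).coord j (G x)) *
      algebraMap ℂ (X → ℂ) (l (Module.finBasis ℂ A i * Module.finBasis ℂ A j)) := by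
    ext x
    rw [functional_mul_eq]
    simp
  rw [this]
  exact R.sum_mem fun i _ => R.sum_mem fun j _ =>
    R.mul_mem (R.mul_mem (hF _) (hG _)) (R.algebraMap_mem _)

lemma pow [FiniteDimensional ℂ A] (hF : CoeffsIn R F) (m : ℕ) : CoeffsIn R (fun x => F x ^ m) := by
  induction m with
  | zero => simpa using const 1
  | succ m ih => simpa only [pow_succ] using ih.mul hF

lemma list_prod [FiniteDimensional ℂ A] {d : ℕ} {F : Fin d → X → A} (hF : ∀ i, CoeffsIn R (F i)) :
    CoeffsIn R (fun x => (List.ofFn fun i => F i x).prod) := by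
  induction d with
  | zero => simpa using const 1
  | succ d ih =>
    simp only [List.ofFn_succ, List.prod_cons]
    exact (hF 0).mul (ih fun i => hF i.succ)

end CoeffsIn

/-- All coordinates of `F` are `O(s^e)` as `s → 0`. -/
def IsOrd (e : ℕ) (F : ℂ → A) : Prop :=
  ∀ l : A →ₗ[ℂ] ℂ, (fun s => l (F s)) =O[𝓝 0] (fun s : ℂ => s ^ e)

namespace IsOrd

variable {F G : ℂ → A} {e e' : ℕ}

lemma mono (hF : IsOrd e F) (h : e' ≤ e) : IsOrd e' F := fun l => (hF l).trans (isBigO_pow_of_le h)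

lemma const (a : A) : IsOrd 0 (fun _ => a) := fun l => by
  simp only [pow_zero]
  exact isBigO_const_const _ one_ne_zero _

lemma smul_const {f : ℂ → ℂ} (hf : f =O[𝓝 0] (fun s : ℂ => s ^ e)) (a : A) :
    IsOrd e (fun s => f s • a) := fun l => by
  simpa [mul_comm] using hf.const_mul_left (l a)

lemma sum {ι : Type*} {s : Finset ι} {F : ι → ℂ → A} (hF : ∀ i ∈ s, IsOrd e (F i)) :
    IsOrd e (fun x => ∑ i ∈ s, F i x) := fun l => by
  simp only [map_sum]
  exact IsBigO.fun_sum fun i hi => hF i hi l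

lemma mul [FiniteDimensional ℂ A] (hF : IsOrd e F) (hG : IsOrd e' G) :
    IsOrd (e + e') (fun s => F s * G s) := fun l => by
  rw [funext fun s => functional_mul_eq l (F s) (G s)]
  refine IsBigO.fun_sum fun i _ => IsBigO.fun_sum fun j _ => ?_
  simp only [mul_comm _ (l _)]
  refine IsBigO.const_mul_left ?_ _
  simp only [pow_add]
  exact (hF _).mul (hG _)

lemma pow [FiniteDimensional ℂ A] (hF : IsOrd e F) (m : ℕ) : IsOrd (m * e) (fun s => F s ^ m) := by
  induction m with
  | zero => simpa using const 1
  | succ m ih =>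
    simp only [pow_succ, Nat.succ_mul]
    exact ih.mul hF

lemma list_prod [FiniteDimensional ℂ A] {d : ℕ} {F : Fin d → ℂ → A} (hF : ∀ i, IsOrd 1 (F i)) :
    IsOrd d (fun x => (List.ofFn fun i => F i x).prod) := by
  induction d with
  | zero => simpa using const 1
  | succ d ih =>
    simp only [List.ofFn_succ, List.prod_cons]
    exact ((hF 0).mul (ih fun i => hF i.succ)).mono (by omega)

end IsOrd

end AlgebraValued

/-! ### Bivectors on `ℂⁿ` and the coefficients of Pfaffian expressions. -/

section StandardBivectors

variable {n : ℕ}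

/-- The functions analytic at `x₀`. -/
def analyticSubalgebra (x₀ : Cn n) : Subalgebra ℂ (Cn n → ℂ) where
  carrier := {f | AnalyticAt ℂ f x₀}
  mul_mem' hf hg := AnalyticAt.mul hf hg
  add_mem' hf hg := AnalyticAt.add hf hg
  algebraMap_mem' _ := analyticAt_const

/-- The polynomial functions. -/
def polynomialSubalgebra (n : ℕ) : Subalgebra ℂ (Cn n → ℂ) where
  carrier := {f | IsPolynomialFun f}
  mul_mem' hf hg := IsPolynomialFun.mul hf hg
  add_mem' := by
    rintro f g ⟨p, hp⟩ ⟨q, hq⟩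
    exact ⟨p + q, fun v => by simp [hp, hq]⟩
  algebraMap_mem' _ := IsPolynomialFun.const _

/-- The standard basis of `ℂⁿ`. -/
def stdBasis (n : ℕ) : Module.Basis (Fin n) ℂ (Cn n) := (EuclideanSpace.basisFun (Fin n) ℂ).toBasis

@[simp] lemma stdBasis_apply (i : Fin n) : stdBasis n i = EuclideanSpace.single i (1 : ℂ) := by
  simp [stdBasis]

@[simp] lemma stdBasis_coord (i : Fin n) (v : Cn n) : (stdBasis n).coord i v = v i := by
  simp [stdBasis]

/-- The coefficient function `w(e^k, e^l)` of a bivector on `ℂⁿ`. -/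
def bcoef (w : ⋀[ℂ]^2 (Cn n)) (k l : Fin n) : ℂ :=
  pair w ![(stdBasis n).coord k, (stdBasis n).coord l]

lemma bcoef_swap (w : ⋀[ℂ]^2 (Cn n)) (k l : Fin n) : bcoef w l k = - bcoef w k l :=
  pair_two_swap _ _ _

lemma bcoef_self (w : ⋀[ℂ]^2 (Cn n)) (k : Fin n) : bcoef w k k = 0 := pair_two_self _ _

/-- The bivector with prescribed coefficients. -/
def ofCoeffs (c : Fin n → Fin n → ℂ) : ⋀[ℂ]^2 (Cn n) :=
  ∑ i : Fin n, ∑ j : Fin n, if i < j then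
    c i j • exteriorPower.ιMulti ℂ 2 ![EuclideanSpace.single i (1 : ℂ), EuclideanSpace.single j 1]
    else 0

lemma bcoef_ofCoeffs (c : Fin n → Fin n → ℂ) {k l : Fin n} (h : k < l) :
    bcoef (ofCoeffs c) k l = c k l := by
  have hd : ∀ i j : Fin n, pair (exteriorPower.ιMulti ℂ 2
      ![EuclideanSpace.single i (1 : ℂ), EuclideanSpace.single j 1])
      ![(stdBasis n).coord k, (stdBasis n).coord l]
      = (if k = i then 1 else 0) * (if l = j then 1 else 0)
        - (if l = i then 1 else 0) * (if k = j then 1 else 0) := by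
    intro i j
    rw [pair_ιMulti, Matrix.det_fin_two]
    simp only [Matrix.of_apply, Matrix.cons_val_zero, Matrix.cons_val_one, stdBasis_coord,
      PiLp.single_apply]
  unfold bcoef ofCoeffs
  simp only [pair_sum]
  rw [Finset.sum_eq_single k, Finset.sum_eq_single l]
  · rw [if_pos h, pair_smul, hd]
    simp [h.ne]
  · intro j _ hj
    split_ifs with hkj
    · rw [pair_smul, hd]
      simp [hj.symm, hkj.ne]
    · simp
  · simp
  · intro i _ hi
    refine Finset.sum_eq_zero fun j _ => ?_
    split_ifs with hij
    · rw [pair_smul, hd]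
      by_cases hli : l = i
      · subst hli
        simp [hi.symm, (h.trans hij).ne]
      · simp [hi.symm, hli]
    · simp
  · simp

lemma bcoef_ofCoeffs_of_skew {c : Fin n → Fin n → ℂ} (hc : ∀ k l, c l k = - c k l)
    (k l : Fin n) : bcoef (ofCoeffs c) k l = c k l := by
  rcases lt_trichotomy k l with h | rfl | h
  · exact bcoef_ofCoeffs c h
  · rw [bcoef_self]
    have := hc k k
    rw [eq_neg_iff_add_eq_zero, ← two_mul] at this
    simpa [eq_comm] using this
  · rw [bcoef_swap, bcoef_ofCoeffs c h, hc k l, neg_neg]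

lemma ofCoeffs_bcoef (w : ⋀[ℂ]^2 (Cn n)) : ofCoeffs (bcoef w) = w :=
  bivector_ext (stdBasis n) fun _ _ h => bcoef_ofCoeffs _ h

lemma coe_ofCoeffs (c : Fin n → Fin n → ℂ) :
    ((ofCoeffs c : ⋀[ℂ]^2 (Cn n)) : ExteriorAlgebra ℂ (Cn n))
      = ∑ i : Fin n, ∑ j : Fin n, c i j • (if i < j then
        ExteriorAlgebra.ιMulti ℂ 2 ![EuclideanSpace.single i (1 : ℂ), EuclideanSpace.single j 1]
          else 0) := by
  rw [ofCoeffs]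
  push_cast
  refine Finset.sum_congr rfl fun i _ => Finset.sum_congr rfl fun j _ => ?_
  split_ifs <;> simp

lemma coe_eq_sum (w : ⋀[ℂ]^2 (Cn n)) :
    (w : ExteriorAlgebra ℂ (Cn n)) = ∑ i : Fin n, ∑ j : Fin n, bcoef w i j • (if i < j then
        ExteriorAlgebra.ιMulti ℂ 2 ![EuclideanSpace.single i (1 : ℂ), EuclideanSpace.single j 1]
          else 0) := by
  rw [← coe_ofCoeffs, ofCoeffs_bcoef]

instance : FiniteDimensional ℂ (ExteriorAlgebra ℂ (Cn n)) :=
  Module.Finite.of_basis (stdBasis n).ExteriorAlgebra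

lemma commute_bivectors {V : Type*} [AddCommGroup V] [Module ℂ V] (w w' : ⋀[ℂ]^2 V) :
    Commute (w : ExteriorAlgebra ℂ V) (w' : ExteriorAlgebra ℂ V) := by
  obtain ⟨k, e, f, h⟩ := exists_isSumOfDecomposables w
  obtain ⟨k', e', f', h'⟩ := exists_isSumOfDecomposables w'
  rw [h, h']
  exact Commute.sum_left _ _ _ fun i _ => Commute.sum_right _ _ _ fun j _ => commute_two _ _ _ _

lemma coeffsIn_bivector {X : Type*} {R : Subalgebra ℂ (X → ℂ)} {W : X → ⋀[ℂ]^2 (Cn n)}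
    (hW : ∀ k l, (fun x => bcoef (W x) k l) ∈ R) :
    CoeffsIn R (fun x => (W x : ExteriorAlgebra ℂ (Cn n))) := by
  simp only [coe_eq_sum]
  exact CoeffsIn.sum fun i _ => CoeffsIn.sum fun j _ => CoeffsIn.smul_const (hW i j) _

lemma ι_eq_sum (v : Cn n) : ExteriorAlgebra.ι ℂ v
    = ∑ i, v i • ExteriorAlgebra.ι ℂ (EuclideanSpace.single i (1 : ℂ) : Cn n) := by
  conv_lhs => rw [← (EuclideanSpace.basisFun (Fin n) ℂ).sum_repr v]
  simp [map_sum]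

lemma coeffsIn_pow_mul_ιMulti {X : Type*} {R : Subalgebra ℂ (X → ℂ)} {W : X → ⋀[ℂ]^2 (Cn n)}
    (hW : ∀ k l, (fun x => bcoef (W x) k l) ∈ R) {d : ℕ} {U : Fin d → X → Cn n}
    (hU : ∀ i k, (fun x => U i x k) ∈ R) (r : ℕ) :
    CoeffsIn R (fun x => (W x : ExteriorAlgebra ℂ (Cn n)) ^ r *
      ExteriorAlgebra.ιMulti ℂ d (fun i => U i x)) := by
  refine ((coeffsIn_bivector hW).pow r).mul ?_
  simp only [ExteriorAlgebra.ιMulti_apply]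
  refine CoeffsIn.list_prod fun i => ?_
  rw [funext fun x => ι_eq_sum (U i x)]
  exact CoeffsIn.sum fun k _ => CoeffsIn.smul_const (hU i k) _

open Asymptotics Filter Topology

/-- If `W(x₀ + sv) = s W₀(v) + O(s²)` with `W₀(v) ^ (k₀ + 1) = 0` and `U_i(x₀ + sv) = O(s)`, then
`W ^ r ∧ U₁ ∧ ⋯ ∧ U_d` is `O(s^(2r + d - k₀))`. -/
lemma isOrd_pow_mul_ιMulti {W : ℂ → ⋀[ℂ]^2 (Cn n)} {W₀ : ⋀[ℂ]^2 (Cn n)}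
    (hW : ∀ k l, (fun s => bcoef (W s) k l - s * bcoef W₀ k l) =O[𝓝 0] (fun s : ℂ => s ^ 2))
    {k₀ : ℕ} (hk : (W₀ : ExteriorAlgebra ℂ (Cn n)) ^ (k₀ + 1) = 0)
    {d : ℕ} {U : Fin d → ℂ → Cn n}
    (hU : ∀ i k, (fun s => U i s k) =O[𝓝 0] (fun s : ℂ => s ^ 1)) (r e : ℕ)
    (he : e + k₀ ≤ 2 * r + d) :
    IsOrd e (fun s => (W s : ExteriorAlgebra ℂ (Cn n)) ^ r *
      ExteriorAlgebra.ιMulti ℂ d (fun i => U i s)) := by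
  have hU' : IsOrd d (fun s => ExteriorAlgebra.ιMulti ℂ d (fun i => U i s)) := by
    simp only [ExteriorAlgebra.ιMulti_apply]
    refine IsOrd.list_prod fun i => ?_
    rw [funext fun x => ι_eq_sum (U i x)]
    exact IsOrd.sum fun k _ => IsOrd.smul_const (hU i k) _
  -- Split `W s = s W₀ + D s` with `D = O(s²)`. Bivectors commute, so the binomial formula applies.
  set D : ℂ → ExteriorAlgebra ℂ (Cn n) := fun s => ((W s - s • W₀ : ⋀[ℂ]^2 (Cn n)) :
    ExteriorAlgebra ℂ (Cn n)) with hD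
  have hDord : IsOrd 2 D := by
    simp only [hD, coe_eq_sum]
    refine IsOrd.sum fun i _ => IsOrd.sum fun j _ => IsOrd.smul_const ?_ _
    refine (hW i j).congr_left fun s => ?_
    simp only [bcoef, ← pairLin_apply, map_sub, map_smul, smul_eq_mul]
  have hexp : ∀ s, (W s : ExteriorAlgebra ℂ (Cn n)) ^ r
      = ∑ j ∈ Finset.range (r + 1), (s ^ j • (W₀ : ExteriorAlgebra ℂ (Cn n)) ^ j) * D s ^ (r - j)
        * (r.choose j : ExteriorAlgebra ℂ (Cn n)) := by
    intro s
    have hsum : (W s : ExteriorAlgebra ℂ (Cn n))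
        = ((s • W₀ : ⋀[ℂ]^2 (Cn n)) : ExteriorAlgebra ℂ (Cn n)) + D s := by
      simp [hD]
    rw [hsum, (commute_bivectors (s • W₀) (W s - s • W₀)).add_pow]
    refine Finset.sum_congr rfl fun j _ => ?_
    congr 2
    push_cast
    rw [smul_pow]
  have hWord : IsOrd (2 * r - k₀) (fun s => (W s : ExteriorAlgebra ℂ (Cn n)) ^ r) := by
    simp only [hexp]
    refine IsOrd.sum fun j hj => ?_
    rw [Finset.mem_range] at hj
    -- The term with `j` factors `s W₀` has order `j + 2(r - j) = 2r - j`, and it vanishes for `j >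
    -- k₀`; hence the order is at least `2r - k₀`.
    rcases Nat.lt_or_ge k₀ j with hlt | hge
    · have : (W₀ : ExteriorAlgebra ℂ (Cn n)) ^ j = 0 := pow_eq_zero_of_le hlt hk
      simp only [this, smul_zero, zero_mul]
      exact fun l => by simpa using isBigO_zero _ _
    · refine ((((IsOrd.smul_const (isBigO_refl _ _) _).mul (hDord.pow (r - j))).mul
        (IsOrd.const _))).mono (by omega)
  exact (hWord.mul hU').mono (by omega)

end StandardBivectors

/-! ### Lowest degree terms of log-canonical systems in local coordinates -/

section LowestTerms

open Asymptotics Filter Topology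

variable {n : ℕ}

/-- The Jacobian determinant. -/
def jac (φ : Fin n → Cn n → ℂ) (x : Cn n) : ℂ :=
  Matrix.det (.of fun i k => pderiv k (φ i) x)

lemma analyticAt_jac {φ : Fin n → Cn n → ℂ} {x₀ : Cn n} (hφ : ∀ i, AnalyticAt ℂ (φ i) x₀) :
    AnalyticAt ℂ (jac φ) x₀ := by
  unfold jac
  simp only [Matrix.det_apply]
  refine Finset.analyticAt_fun_sum _ fun σ _ => ?_
  simp only [Units.smul_def, zsmul_eq_mul]
  exact analyticAt_const.mul (Finset.analyticAt_fun_prod _ fun i _ => AnalyticAt.pderiv (hφ _) _)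

/-- The covector `d_v f` as a linear functional. -/
def covec (f : Cn n → ℂ) (v : Cn n) : Module.Dual ℂ (Cn n) := (fderiv ℂ f v).toLinearMap

lemma covec_eq_sum (f : Cn n → ℂ) (v : Cn n) :
    covec f v = ∑ k, pderiv k f v • (stdBasis n).coord k := by
  refine (stdBasis n).ext fun k => ?_
  rw [LinearMap.sum_apply]
  simp only [LinearMap.smul_apply, stdBasis_coord]
  simp [covec, pderiv]

lemma pair_covec (w : ⋀[ℂ]^2 (Cn n)) (f g : Cn n → ℂ) (v : Cn n) :
    pair w ![covec f v, covec g v]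
      = ∑ k, ∑ l, pderiv k f v * pderiv l g v * bcoef w k l := by
  rw [covec_eq_sum, covec_eq_sum, pair_two_sum]
  rfl

lemma exists_finset_of_max {ι : Type*} [Fintype ι] {E : Type*} [AddCommGroup E] [Module ℂ E]
    (A : ι → E) : ∃ T : Finset ι, LinearIndependent ℂ (fun i : T => A i) ∧
      ∀ S : Finset ι, T.card < S.card → ¬ LinearIndependent ℂ (fun i : S => A i) := by
  classical
  have hne : (Finset.univ.filter fun S : Finset ι =>
      LinearIndependent ℂ (fun i : S => A i)).Nonempty :=
    ⟨∅, by simp⟩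
  obtain ⟨T, hT, hmax⟩ := Finset.exists_max_image _ Finset.card hne
  refine ⟨T, (Finset.mem_filter.1 hT).2, fun S hS hli => ?_⟩
  have := hmax S (by simpa using hli)
  omega

/-- Multiplying by `s` makes the bound hold at `s = 0` as well. -/
lemma eq_zero_of_mul_pow_isBigO_punctured {c : ℂ} {e : ℕ}
    (h : (fun s : ℂ => s ^ e * c) =O[𝓝[≠] 0] (fun s : ℂ => s ^ (e + 1))) : c = 0 := by
  refine eq_zero_of_mul_pow_isBigO (e := e + 1) ?_
  obtain ⟨C, hC⟩ := h.bound
  refine IsBigO.of_bound C ?_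
  rw [eventually_nhdsWithin_iff] at hC
  filter_upwards [hC] with s hs
  by_cases h0 : s = 0
  · simp [h0]
  · have := hs h0
    rw [pow_succ s e, pow_succ s (e + 1), mul_right_comm, norm_mul, norm_mul _ s, ← mul_assoc]
    exact mul_le_mul_of_nonneg_right this (norm_nonneg _)

/-- At a direction where the lowest term of the Jacobian does not vanish, at least
`∑ deg φᵢ^low - ord J` of the differentials of the lowest terms are independent. -/
lemma exists_independent_gradients {φ : Fin n → Cn n → ℂ} {x₀ : Cn n}
    (hφ : ∀ i, AnalyticAt ℂ (φ i) x₀) {v : Cn n}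
    (hv : homPart (jac φ) x₀ (ord (jac φ) x₀) v ≠ 0) :
    ∃ T : Finset (Fin n),
      LinearIndependent ℂ (fun i : T => covec (homPart (φ i) x₀ (ord (φ i) x₀)) v) ∧
      ∑ i, ord (φ i) x₀ ≤ ord (jac φ) x₀ + T.card := by
  set a := fun i => ord (φ i) x₀ with ha
  set A : Matrix (Fin n) (Fin n) ℂ := .of fun i k => pderiv k (homPart (φ i) x₀ (a i)) v with hA
  -- The rows of `A` are the gradients at `v` of the lowest terms; `T` indexes a largest independent
  -- set of rows.
  obtain ⟨T, hT, hmax⟩ := exists_finset_of_max (fun i => A i)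
  refine ⟨T, ?_, ?_⟩
  · let ev : Module.Dual ℂ (Cn n) →ₗ[ℂ] (Fin n → ℂ) :=
      LinearMap.pi fun k => LinearMap.applyₗ (EuclideanSpace.single k (1 : ℂ))
    refine LinearIndependent.of_comp ev ?_
    exact hT
  by_contra! hlt
  replace hlt : ord (jac φ) x₀ + T.card < ∑ i, a i := hlt
  have hTn : T.card ≤ n := by simpa using T.card_le_univ
  -- Multiplied by `s ^ (1 - aᵢ)`, the gradient of `φᵢ` on the line becomes `A i + O(s)`. The
  -- remainder is set to `0` at `s = 0`, where this rescaling is meaningless.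
  let R : ℂ → Matrix (Fin n) (Fin n) ℂ := fun s => .of fun i k =>
    if s = 0 then 0 else (s ^ a i)⁻¹ * (s * onLine (pderiv k (φ i)) x₀ v s) - A i k
  have hR : ∀ i k, (fun s => R s i k) =O[𝓝 0] (fun s : ℂ => s) := by
    intro i k
    obtain ⟨C, hC⟩ := (onLine_pderiv_isBigO (hφ i) k v).bound
    refine IsBigO.of_bound C ?_
    filter_upwards [hC] with s hs
    by_cases h0 : s = 0
    · simp [R, h0]
    · have hp : s ^ a i ≠ 0 := pow_ne_zero _ h0
      have e1 : R s i k = (s ^ a i)⁻¹ * (s * onLine (pderiv k (φ i)) x₀ v s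
          - s ^ a i * A i k) := by
        simp only [R, Matrix.of_apply, h0, if_false]
        field_simp
      rw [e1, norm_mul, norm_inv]
      rw [pow_succ, norm_mul, ← mul_assoc, mul_comm C, mul_assoc] at hs
      rw [inv_mul_le_iff₀ (norm_pos_iff.2 hp)]
      exact hs
  have hdet := det_add_isBigO A R hR hmax
  -- Scaling the rows one by one compares the Jacobian with `det (A + R s)`.
  have hJ : ∀ s : ℂ, s ≠ 0 → s ^ n * onLine (jac φ) x₀ v s
      = s ^ (∑ i, a i) * (A + R s).det := by
    intro s hs
    rw [← Finset.prod_pow_eq_pow_sum, ← Matrix.det_mul_column]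
    have e2 : s ^ n = ∏ _i : Fin n, s := by simp
    rw [e2, onLine, jac, ← Matrix.det_mul_column]
    congr 1
    ext i k
    have hp : s ^ a i ≠ 0 := pow_ne_zero _ hs
    simp only [Matrix.of_apply, Matrix.add_apply, R, hs, if_false, onLine]
    field_simp
    ring
  have hlead := (onLine_sub_isBigO_ord (analyticAt_jac hφ) v).mono (nhdsWithin_le_nhds (s := {0}ᶜ))
  -- If `∑ aᵢ > ord J + |T|`, the determinant estimate makes `s ^ n J` of order above `n + ord J`,
  -- which contradicts the nonzero leading coefficient at `v`.
  have h1 : (fun s : ℂ => s ^ n * onLine (jac φ) x₀ v s) =O[𝓝[≠] 0]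
      (fun s : ℂ => s ^ (n + ord (jac φ) x₀ + 1)) := by
    have h2 : (fun s : ℂ => s ^ (∑ i, a i) * (A + R s).det) =O[𝓝[≠] 0]
        (fun s : ℂ => s ^ (∑ i, a i) * s ^ (n - T.card)) :=
      ((isBigO_refl _ _).mul hdet).mono nhdsWithin_le_nhds
    have h3 : (fun s : ℂ => s ^ n * onLine (jac φ) x₀ v s) =O[𝓝[≠] 0]
        (fun s : ℂ => s ^ (∑ i, a i) * s ^ (n - T.card)) := by
      refine h2.congr' ?_ EventuallyEq.rfl
      filter_upwards [self_mem_nhdsWithin] with s hs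
      exact (hJ s hs).symm
    refine h3.trans ?_
    simp only [← pow_add]
    exact (isBigO_pow_of_le (by omega)).mono nhdsWithin_le_nhds
  have h4 := (isBigO_refl (fun s : ℂ => s ^ n) (𝓝[≠] 0)).mul hlead
  have h4' := h4.congr_right (g₂ := fun s : ℂ => s ^ (n + ord (jac φ) x₀ + 1)) fun s => by ring
  apply hv
  refine eq_zero_of_mul_pow_isBigO_punctured (e := n + ord (jac φ) x₀) ?_
  refine (h1.sub h4').congr_left fun s => ?_
  ring

lemma onLine_sub_linear_isBigO {f : Cn n → ℂ} {x₀ : Cn n} (hf : AnalyticAt ℂ f x₀)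
    (h0 : f x₀ = 0) (v : Cn n) :
    (fun s => onLine f x₀ v s - s * fderiv ℂ f x₀ v) =O[𝓝 0] (fun s : ℂ => s ^ 2) := by
  refine (onLine_sub_sum_isBigO hf 2 v).congr_left fun s => ?_
  simp [Finset.sum_range_succ, homPart, h0, iteratedFDeriv_one_apply]

lemma onLine_isBigO_one {f : Cn n → ℂ} {x₀ : Cn n} (hf : AnalyticAt ℂ f x₀)
    (h0 : f x₀ = 0) (v : Cn n) :
    onLine f x₀ v =O[𝓝 0] (fun s : ℂ => s ^ 1) :=
  onLine_isBigO hf fun j hj => by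
    obtain rfl : j = 0 := by omega
    simp [homPart, h0]

/-- Lowest degree terms of a log-canonical pair at a zero of the Poisson structure are in
involution for the linearized Poisson structure. -/
lemma lowest_terms_involution {f g : Cn n → ℂ} {x₀ : Cn n} (hf : AnalyticAt ℂ f x₀)
    (hg : AnalyticAt ℂ g x₀) {M : Fin n → Fin n → Cn n → ℂ}
    (hM : ∀ k l, AnalyticAt ℂ (M k l) x₀) (hM0 : ∀ k l, M k l x₀ = 0) {c : ℂ}
    (h : ∀ᶠ x in 𝓝 x₀, ∑ k, ∑ l, pderiv k f x * pderiv l g x * M k l x = c * (f x * g x))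
    (v : Cn n) :
    ∑ k, ∑ l, pderiv k (homPart f x₀ (ord f x₀)) v * pderiv l (homPart g x₀ (ord g x₀)) v *
      fderiv ℂ (M k l) x₀ v = 0 := by
  set a := ord f x₀
  set b := ord g x₀
  -- After multiplication of the hypothesis by `s²`, the right-hand side has order `a + b + 2`,
  -- whereas the left-hand side begins with `s ^ (a + b + 1)` times the sum in question.
  refine eq_zero_of_mul_pow_isBigO (e := a + b + 1) ?_
  have h1 : (fun s : ℂ => s ^ 2 * (c * (onLine f x₀ v s * onLine g x₀ v s)))
      =O[𝓝 0] (fun s : ℂ => s ^ (a + b + 1 + 1)) := by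
    have := (isBigO_refl (fun s : ℂ => s ^ 2) (𝓝 0)).mul
      (((onLine_isBigO_ord hf v).mul (onLine_isBigO_ord hg v)).const_mul_left c)
    exact this.congr_right fun s => by ring
  have hterm : ∀ k l, (fun s : ℂ => (s * onLine (pderiv k f) x₀ v s) *
        (s * onLine (pderiv l g) x₀ v s) * onLine (M k l) x₀ v s
      - s ^ (a + b + 1) * (pderiv k (homPart f x₀ a) v * pderiv l (homPart g x₀ b) v *
        fderiv ℂ (M k l) x₀ v)) =O[𝓝 0] (fun s : ℂ => s ^ (a + b + 1 + 1)) := by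
    intro k l
    have hp := onLine_pderiv_isBigO hf k v
    have hq := onLine_pderiv_isBigO hg l v
    have hm := onLine_sub_linear_isBigO (hM k l) (hM0 k l) v
    have hm1 := onLine_isBigO_one (hM k l) (hM0 k l) v
    have hcst : ∀ (e : ℕ) (z : ℂ), (fun s : ℂ => s ^ e * z) =O[𝓝 0] (fun s : ℂ => s ^ e) := by
      intro e z
      simpa [mul_comm] using (isBigO_refl (fun s : ℂ => s ^ e) (𝓝 0)).const_mul_left z
    have hq1 : (fun s : ℂ => s * onLine (pderiv l g) x₀ v s) =O[𝓝 0] (fun s : ℂ => s ^ b) :=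
      ((hq.trans (isBigO_pow_of_le b.le_succ)).add (hcst b _)).congr_left fun s => by ring
    -- The three factors are replaced by their leading terms one at a time.
    have t1 := (hp.mul hq1).mul hm1
    have t2 := ((hcst a (pderiv k (homPart f x₀ a) v)).mul hq).mul hm1
    have t3 := ((hcst a (pderiv k (homPart f x₀ a) v)).mul
      (hcst b (pderiv l (homPart g x₀ b) v))).mul hm
    have t1' := t1.congr_right (g₂ := fun s : ℂ => s ^ (a + b + 1 + 1)) fun s => by ring
    have t2' := t2.congr_right (g₂ := fun s : ℂ => s ^ (a + b + 1 + 1)) fun s => by ring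
    have t3' := t3.congr_right (g₂ := fun s : ℂ => s ^ (a + b + 1 + 1)) fun s => by ring
    refine ((t1'.add t2').add t3').congr_left fun s => ?_
    ring
  have hsum := IsBigO.fun_sum (s := Finset.univ) fun k _ =>
    IsBigO.fun_sum (s := Finset.univ) fun l _ => hterm k l
  refine (h1.sub hsum).congr' ?_ EventuallyEq.rfl
  have hev := (tendsto_line x₀ v).eventually h
  filter_upwards [hev] with s hs
  simp only [onLine]
  rw [← hs]
  simp only [Finset.mul_sum, Finset.sum_sub_distrib]
  have : ∀ k l, s * pderiv k f (x₀ + s • v) * (s * pderiv l g (x₀ + s • v)) * M k l (x₀ + s • v)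
      = s ^ 2 * (pderiv k f (x₀ + s • v) * pderiv l g (x₀ + s • v) * M k l (x₀ + s • v)) := by
    intro k l; ring
  simp only [this, sub_sub_cancel]

end LowestTerms

/-! ### Local coordinates -/

section Charts

open Filter Topology

variable {n : ℕ} {P : Type u} [TopologicalSpace P] [ChartedSpace (Cn n) P]

/-- The differential at `q` of the preferred chart at `p₀`. -/
def chartMap (n : ℕ) {P : Type u} [TopologicalSpace P] [ChartedSpace (Cn n) P]
    (p₀ q : P) : Tan n q →ₗ[ℂ] Cn n :=
  (mvfderiv 𝓘(ℂ, Cn n) (chartAt (Cn n) p₀) q).toLinearMap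

/-- The expression of a function in the preferred chart at `p₀`. -/
def inChart {α : Type*} (n : ℕ) {P : Type u} [TopologicalSpace P] [ChartedSpace (Cn n) P]
    (p₀ : P) (f : P → α) : Cn n → α :=
  f ∘ (chartAt (Cn n) p₀).symm

/-- The expression of a bivector field in the preferred chart at `p₀`. -/
def bivInChart (p₀ : P) (π : MultivectorField n 2 P) (x : Cn n) : ⋀[ℂ]^2 (Cn n) :=
  exteriorPower.map 2 (chartMap n p₀ ((chartAt (Cn n) p₀).symm x))
    (π ((chartAt (Cn n) p₀).symm x))

lemma dAt_eq_covec (f : Cn n → ℂ) (v : Cn n) : dAt n f v = covec f v := by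
  unfold dAt covec mvfderiv
  rw [mfderiv_eq_fderiv]
  rfl

lemma HolOn.mdifferentiableAt {f : P → ℂ} {U : Set P} (hf : HolOn n f U) (hU : IsOpen U) {q : P}
    (hq : q ∈ U) : MDifferentiableAt 𝓘(ℂ, Cn n) 𝓘(ℂ, ℂ) f q :=
  (hf.contMDiffAt (hU.mem_nhds hq)).mdifferentiableAt (by simp)

variable [IsManifold 𝓘(ℂ, Cn n) ω P]

lemma mdifferentiable_chartAt (p₀ : P) :
    (chartAt (Cn n) p₀).MDifferentiable 𝓘(ℂ, Cn n) 𝓘(ℂ, Cn n) :=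
  haveI : IsManifold 𝓘(ℂ, Cn n) 1 P := IsManifold.of_le (n := ω) (by simp)
  mdifferentiable_chart p₀

lemma chartMap_bijective {p₀ q : P} (hq : q ∈ (chartAt (Cn n) p₀).source) :
    Function.Bijective (chartMap n p₀ q) :=
  (mdifferentiable_chartAt p₀).mfderiv_bijective hq

lemma dAt_eq_comp_chartMap {p₀ q : P} (hq : q ∈ (chartAt (Cn n) p₀).source) {f : P → ℂ}
    (hf : MDifferentiableAt 𝓘(ℂ, Cn n) 𝓘(ℂ, ℂ) f q) :
    dAt n f q = covec (inChart n p₀ f) (chartAt (Cn n) p₀ q) ∘ₗ chartMap n p₀ q := by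
  set ψ := chartAt (Cn n) p₀
  have hψ := mdifferentiable_chartAt (n := n) p₀
  have hinv : MDifferentiableAt 𝓘(ℂ, Cn n) 𝓘(ℂ, ℂ) (inChart n p₀ f) (ψ q) := by
    refine MDifferentiableAt.comp (I' := 𝓘(ℂ, Cn n)) _ ?_
      (hψ.mdifferentiableAt_symm (ψ.map_source hq))
    rwa [ψ.left_inv hq]
  have hcomp := mvfderiv_comp q hinv (hψ.mdifferentiableAt hq)
  have heq : (inChart n p₀ f) ∘ ψ =ᶠ[𝓝 q] f := by
    filter_upwards [ψ.open_source.mem_nhds hq] with y hy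
    simp [inChart, ψ.left_inv hy, ψ]
  have h1 : mfderiv 𝓘(ℂ, Cn n) 𝓘(ℂ, ℂ) (inChart n p₀ f ∘ ψ) q
      = mfderiv 𝓘(ℂ, Cn n) 𝓘(ℂ, ℂ) f q := heq.mfderiv_eq
  ext v
  have h2 := congrArg (fun L => L v) hcomp
  have h3 : dAt n f q v = mvfderiv 𝓘(ℂ, Cn n) (inChart n p₀ f ∘ ψ) q v := by
    unfold dAt mvfderiv
    rw [ContinuousLinearMap.coe_coe, ContinuousLinearMap.comp_apply,
      ContinuousLinearMap.comp_apply, h1]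
    rfl
  rw [h3, h2, LinearMap.comp_apply, ← dAt_eq_covec]
  rfl

lemma mdifferentiableAt_coord {p₀ q : P} (hq : q ∈ (chartAt (Cn n) p₀).source) (i : Fin n) :
    MDifferentiableAt 𝓘(ℂ, Cn n) 𝓘(ℂ, ℂ) (coord n p₀ i) q := by
  have h1 := (mdifferentiable_chartAt (n := n) p₀).mdifferentiableAt hq
  have h2 : MDifferentiableAt 𝓘(ℂ, Cn n) 𝓘(ℂ, ℂ) (fun x : Cn n => x i) (chartAt (Cn n) p₀ q) :=
    (EuclideanSpace.proj (𝕜 := ℂ) i).differentiableAt.mdifferentiableAt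
  exact h2.comp q h1

lemma dAt_coord {p₀ q : P} (hq : q ∈ (chartAt (Cn n) p₀).source) (i : Fin n) :
    dAt n (coord n p₀ i) q = (stdBasis n).coord i ∘ₗ chartMap n p₀ q := by
  rw [dAt_eq_comp_chartMap hq (mdifferentiableAt_coord hq i)]
  congr 1
  have hev : inChart n p₀ (coord n p₀ i) =ᶠ[𝓝 (chartAt (Cn n) p₀ q)]
      (EuclideanSpace.proj (𝕜 := ℂ) i : Cn n →L[ℂ] ℂ) := by
    filter_upwards [(chartAt (Cn n) p₀).open_target.mem_nhds ((chartAt (Cn n) p₀).map_source hq)]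
      with y hy
    simp [inChart, coord, (chartAt (Cn n) p₀).right_inv hy]
  unfold covec
  rw [hev.fderiv_eq, ContinuousLinearMap.fderiv]
  ext v
  simp [stdBasis]

lemma chartMap_coordVec (p₀ : P) (i : Fin n) {x : Cn n} (hx : x ∈ (chartAt (Cn n) p₀).target) :
    chartMap n p₀ ((chartAt (Cn n) p₀).symm x) (coordVec n p₀ i x)
      = EuclideanSpace.single i (1 : ℂ) := by
  have h := (mdifferentiable_chartAt (n := n) p₀).comp_symm_deriv hx
  exact congrArg (fun L => L (EuclideanSpace.single i (1 : ℂ))) h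

lemma pair_dAt_coord {k : ℕ} {p₀ q : P} (hq : q ∈ (chartAt (Cn n) p₀).source)
    (w : ⋀[ℂ]^k (Tan n q)) (s : Fin k → Fin n) :
    pair w (fun j => dAt n (coord n p₀ (s j)) q)
      = pair (exteriorPower.map k (chartMap n p₀ q) w) (fun j => (stdBasis n).coord (s j)) := by
  rw [pair_map]
  simp only [dAt_coord hq]

lemma bracket_eq_pair {p₀ : P} (π : MultivectorField n 2 P) {f g : P → ℂ} {x : Cn n}
    (hx : x ∈ (chartAt (Cn n) p₀).target)
    (hf : MDifferentiableAt 𝓘(ℂ, Cn n) 𝓘(ℂ, ℂ) f ((chartAt (Cn n) p₀).symm x))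
    (hg : MDifferentiableAt 𝓘(ℂ, Cn n) 𝓘(ℂ, ℂ) g ((chartAt (Cn n) p₀).symm x)) :
    bracket π f g ((chartAt (Cn n) p₀).symm x)
      = pair (bivInChart p₀ π x) ![covec (inChart n p₀ f) x, covec (inChart n p₀ g) x] := by
  have hs := (chartAt (Cn n) p₀).map_target hx
  unfold bracket bivInChart
  rw [pair_map, dAt_eq_comp_chartMap hs hf, dAt_eq_comp_chartMap hs hg,
    (chartAt (Cn n) p₀).right_inv hx]
  congr 1
  ext j : 1
  fin_cases j <;> rfl

lemma bcoef_bivInChart {p₀ : P} (π : MultivectorField n 2 P) {x : Cn n}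
    (hx : x ∈ (chartAt (Cn n) p₀).target) (k l : Fin n) :
    bcoef (bivInChart p₀ π x) k l
      = bracket π (coord n p₀ k) (coord n p₀ l) ((chartAt (Cn n) p₀).symm x) := by
  have hs := (chartAt (Cn n) p₀).map_target hx
  unfold bracket bivInChart bcoef
  rw [pair_map, dAt_coord hs, dAt_coord hs]
  congr 1
  ext j : 1
  fin_cases j <;> rfl

lemma analyticAt_inChart_of_contMDiffAt {p₀ : P} {f : P → ℂ} {x : Cn n}
    (hx : x ∈ (chartAt (Cn n) p₀).target)
    (hf : ContMDiffAt 𝓘(ℂ, Cn n) 𝓘(ℂ, ℂ) ω f ((chartAt (Cn n) p₀).symm x)) :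
    AnalyticAt ℂ (inChart n p₀ f) x := by
  have h1 : ContMDiffAt 𝓘(ℂ, Cn n) 𝓘(ℂ, Cn n) ω (chartAt (Cn n) p₀).symm x :=
    (contMDiffOn_chart_symm (I := 𝓘(ℂ, Cn n)) (x := p₀)).contMDiffAt
      ((chartAt (Cn n) p₀).open_target.mem_nhds hx)
  have h2 : ContMDiffAt 𝓘(ℂ, Cn n) 𝓘(ℂ, ℂ) ω (inChart n p₀ f) x := hf.comp x h1
  rw [contMDiffAt_iff_contDiffAt] at h2
  exact h2.analyticAt

lemma HolOn.analyticAt_inChart {p₀ : P} {f : P → ℂ} {U : Set P} (hf : HolOn n f U)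
    (hU : IsOpen U) {x : Cn n} (hx : x ∈ (chartAt (Cn n) p₀).target)
    (hxU : (chartAt (Cn n) p₀).symm x ∈ U) : AnalyticAt ℂ (inChart n p₀ f) x :=
  analyticAt_inChart_of_contMDiffAt hx (hf.contMDiffAt (hU.mem_nhds hxU))

lemma holOn_coord (p₀ : P) (i : Fin n) : HolOn n (coord n p₀ i) (chartAt (Cn n) p₀).source := by
  have h1 : ContMDiffOn 𝓘(ℂ, Cn n) 𝓘(ℂ, Cn n) ω (chartAt (Cn n) p₀) (chartAt (Cn n) p₀).source :=
    contMDiffOn_chart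
  have h2 : ContMDiff 𝓘(ℂ, Cn n) 𝓘(ℂ, ℂ) ω (fun x : Cn n => x i) :=
    (EuclideanSpace.proj (𝕜 := ℂ) i : Cn n →L[ℂ] ℂ).contDiff.contMDiff
  exact h2.comp_contMDiffOn h1

lemma analyticAt_bcoef {p₀ : P} {π : MultivectorField n 2 P} (hπ : IsPoisson π) {x : Cn n}
    (hx : x ∈ (chartAt (Cn n) p₀).target) (k l : Fin n) :
    AnalyticAt ℂ (fun y => bcoef (bivInChart p₀ π y) k l) x := by
  have h1 := hπ.holomorphic _ (chartAt (Cn n) p₀).open_source _ _ (holOn_coord p₀ k)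
    (holOn_coord p₀ l)
  have h2 := h1.analyticAt_inChart (chartAt (Cn n) p₀).open_source hx
    ((chartAt (Cn n) p₀).map_target hx)
  refine h2.congr ?_
  filter_upwards [(chartAt (Cn n) p₀).open_target.mem_nhds hx] with y hy
  exact (bcoef_bivInChart π hy k l).symm

lemma linearization_eq {p₀ : P} {π : MultivectorField n 2 P} (hπ : IsPoisson π) (v : Cn n) :
    linearization π p₀ v = ofCoeffs (fun i j =>
      fderiv ℂ (fun y => bcoef (bivInChart p₀ π y) i j) (chartAt (Cn n) p₀ p₀) v) := by
  have key : ∀ i j, (mvfderiv 𝓘(ℂ, Cn n) (bracket π (coord n p₀ i) (coord n p₀ j)) p₀ :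
      Cn n → ℂ) v
      = fderiv ℂ (fun y => bcoef (bivInChart p₀ π y) i j) (chartAt (Cn n) p₀ p₀) v := by
    intro i j
    have h1 := hπ.holomorphic _ (chartAt (Cn n) p₀).open_source _ _ (holOn_coord p₀ i)
      (holOn_coord p₀ j)
    have h2 := (h1.mdifferentiableAt (chartAt (Cn n) p₀).open_source
      (mem_chart_source (Cn n) p₀)).mvfderiv
    rw [h2]
    have hev : writtenInExtChartAt 𝓘(ℂ, Cn n) 𝓘(ℂ, ℂ) p₀ (bracket π (coord n p₀ i) (coord n p₀ j))
        =ᶠ[𝓝 (chartAt (Cn n) p₀ p₀)] (fun y => bcoef (bivInChart p₀ π y) i j) := by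
      filter_upwards [(chartAt (Cn n) p₀).open_target.mem_nhds
        ((chartAt (Cn n) p₀).map_source (mem_chart_source (Cn n) p₀))] with y hy
      rw [bcoef_bivInChart π hy]
      rfl
    simp only [modelWithCornersSelf_coe, Set.range_id, fderivWithin_univ]
    have he : extChartAt 𝓘(ℂ, Cn n) p₀ p₀ = chartAt (Cn n) p₀ p₀ := rfl
    rw [he, hev.fderiv_eq]
    rfl
  unfold linearization ofCoeffs
  refine Finset.sum_congr rfl fun i _ => Finset.sum_congr rfl fun j _ => ?_
  rw [key]
  rfl

end Charts

/-! ### The infinitesimal action in local coordinates -/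

section Action

open Filter Topology

variable {n m : ℕ} {P : Type u} [TopologicalSpace P] [ChartedSpace (Cn n) P]
  [MulAction (Torus m) P]

lemma sigma_eq_zero_of_fixed {q : P} (hq : ∀ t : Torus m, t • q = q) : sigma n m q = 0 := by
  have : (fun t : Torus m => t • q) = fun _ => q := funext hq
  unfold sigma
  rw [this, mfderiv_const]
  rfl

variable [ContMDiffSMul 𝓘(ℂ, Fin m → ℂ) 𝓘(ℂ, Cn n) ω (Torus m) P]

lemma contMDiff_orbitMap (q : P) :
    ContMDiff 𝓘(ℂ, Fin m → ℂ) 𝓘(ℂ, Cn n) ω (fun t : Torus m => t • q) := by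
  have h1 : ContMDiff (𝓘(ℂ, Fin m → ℂ).prod 𝓘(ℂ, Cn n)) 𝓘(ℂ, Cn n) ω
      (fun p : Torus m × P => p.1 • p.2) := contMDiff_smul
  have h2 : ContMDiff 𝓘(ℂ, Fin m → ℂ) (𝓘(ℂ, Fin m → ℂ).prod 𝓘(ℂ, Cn n)) ω
      (fun t : Torus m => (t, q)) := contMDiff_id.prodMk contMDiff_const
  exact h1.comp h2

lemma mdifferentiableAt_orbitMap (q : P) :
    MDifferentiableAt 𝓘(ℂ, Fin m → ℂ) 𝓘(ℂ, Cn n) (fun t : Torus m => t • q) 1 :=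
  (contMDiff_orbitMap q).mdifferentiable (by simp) 1

/-- The derivative of a vector valued function along the infinitesimal action. -/
lemma mvfderiv_sigma {E : Type*} [NormedAddCommGroup E] [NormedSpace ℂ E] {f : P → E} {q : P}
    (hf : MDifferentiableAt 𝓘(ℂ, Cn n) 𝓘(ℂ, E) f q) (x : TorusLie m) :
    mvfderiv 𝓘(ℂ, Cn n) f q (sigma n m q x)
      = mvfderiv 𝓘(ℂ, Fin m → ℂ) (fun t : Torus m => f (t • q)) 1 x := by
  have h := mfderiv_comp_of_eq (I := 𝓘(ℂ, Fin m → ℂ)) (I' := 𝓘(ℂ, Cn n)) (I'' := 𝓘(ℂ, E))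
    (x := (1 : Torus m)) (g := f) (f := fun t : Torus m => t • q) hf
    (mdifferentiableAt_orbitMap q) (one_smul _ q)
  -- The chain rule produces a derivative at `1 • q`, whose tangent space is that of `q` only after
  -- rewriting; a general base point `y` allows the transport.
  have h1 : ∀ y : P, y = q → ∀ v : Cn n, (mfderiv 𝓘(ℂ, Cn n) 𝓘(ℂ, E) f y : Cn n → E) v
      = (mfderiv 𝓘(ℂ, Cn n) 𝓘(ℂ, E) f q : Cn n → E) v := by
    rintro y rfl v
    rfl
  have h2 : (mfderiv 𝓘(ℂ, Fin m → ℂ) 𝓘(ℂ, E) (f ∘ fun t : Torus m => t • q) 1 : TorusLie m → E) x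
      = (mfderiv 𝓘(ℂ, Cn n) 𝓘(ℂ, E) f ((1 : Torus m) • q) : Cn n → E) (sigma n m q x) :=
    congrArg (fun L => L x) h
  exact (h1 _ (one_smul _ q) _).symm.trans h2.symm

/-- Differentials of weight vectors along the infinitesimal action. -/
lemma IsWeightVector.dAt_sigma {f : P → ℂ} (hw : IsWeightVector m f)
    (hf : MDifferentiable 𝓘(ℂ, Cn n) 𝓘(ℂ, ℂ) f) (x : TorusLie m) :
    ∃ c : ℂ, ∀ q, dAt n f q (sigma n m q x) = f q * c := by
  by_cases h0 : ∀ q, f q = 0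
  · refine ⟨0, fun q => ?_⟩
    have : f = fun _ => 0 := funext h0
    rw [this]
    unfold dAt mvfderiv
    rw [mfderiv_const]
    simp
  · push Not at h0
    obtain ⟨q₀, hq₀⟩ := h0
    obtain ⟨χ, hχ⟩ := hw
    -- The constant is the logarithmic derivative at a point where `f` is nonzero. Since `f (t • q)`
    -- is proportional to `f (t • q₀)` as a function of `t`, the character itself is never
    -- differentiated.
    refine ⟨(f q₀)⁻¹ * dAt n f q₀ (sigma n m q₀ x), fun q => ?_⟩
    have e1 : dAt n f q (sigma n m q x) = _ := mvfderiv_sigma (hf q) x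
    have e2 : dAt n f q₀ (sigma n m q₀ x) = _ := mvfderiv_sigma (hf q₀) x
    have hfun : (fun t : Torus m => f (t • q)) = fun t => (f q * (f q₀)⁻¹) • f (t • q₀) := by
      ext t
      rw [hχ, hχ, smul_eq_mul]
      field_simp
    have hd : MDifferentiableAt 𝓘(ℂ, Fin m → ℂ) 𝓘(ℂ, ℂ) (fun t : Torus m => f (t • q₀)) 1 := by
      have : MDifferentiableAt 𝓘(ℂ, Cn n) 𝓘(ℂ, ℂ) f ((1 : Torus m) • q₀) := hf _
      exact this.comp 1 (mdifferentiableAt_orbitMap q₀)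
    have e3 : mvfderiv 𝓘(ℂ, Fin m → ℂ) (fun t : Torus m => (f q * (f q₀)⁻¹) • f (t • q₀)) 1 x
        = (f q * (f q₀)⁻¹) * mvfderiv 𝓘(ℂ, Fin m → ℂ) (fun t : Torus m => f (t • q₀)) 1 x := by
      have := const_smul_mfderiv hd (f q * (f q₀)⁻¹)
      exact congrArg (fun L => L x) this
    rw [e1, e2, hfun, e3, mul_assoc]

variable [IsManifold 𝓘(ℂ, Cn n) ω P]

/-- The vector field `σ(x)` in the preferred chart at `p₀`. -/
def sigmaInChart (n m : ℕ) {P : Type u} [TopologicalSpace P] [ChartedSpace (Cn n) P]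
    [MulAction (Torus m) P] (p₀ : P) (x : TorusLie m) (y : Cn n) : Cn n :=
  chartMap n p₀ ((chartAt (Cn n) p₀).symm y) (sigma n m ((chartAt (Cn n) p₀).symm y) x)

/-- The action is jointly analytic in coordinates on the torus and on `P`; the vector field is its
partial derivative at the identity in the torus variable. -/
lemma analyticAt_sigmaInChart {p₀ : P} {y₀ : Cn n} (hy₀ : y₀ ∈ (chartAt (Cn n) p₀).target)
    (x : TorusLie m) : AnalyticAt ℂ (sigmaInChart n m p₀ x) y₀ := by
  set ψ := chartAt (Cn n) p₀
  set e := chartAt (Fin m → ℂ) (1 : Torus m)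
  let x' : Fin m → ℂ := x
  let G : (Fin m → ℂ) × Cn n → Cn n := fun p => ψ (e.symm p.1 • ψ.symm p.2)
  have hG : ∀ y ∈ ψ.target, AnalyticAt ℂ G (e 1, y) := by
    intro y hy
    have he : ContMDiffAt 𝓘(ℂ, Fin m → ℂ) 𝓘(ℂ, Fin m → ℂ) ω e.symm (e 1) :=
      (contMDiffOn_chart_symm (I := 𝓘(ℂ, Fin m → ℂ)) (x := (1 : Torus m))).contMDiffAt
        (e.open_target.mem_nhds (e.map_source (mem_chart_source _ _)))
    have hψs : ContMDiffAt 𝓘(ℂ, Cn n) 𝓘(ℂ, Cn n) ω ψ.symm y :=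
      (contMDiffOn_chart_symm (I := 𝓘(ℂ, Cn n)) (x := p₀)).contMDiffAt (ψ.open_target.mem_nhds hy)
    have hsm : ContMDiff (𝓘(ℂ, Fin m → ℂ).prod 𝓘(ℂ, Cn n)) 𝓘(ℂ, Cn n) ω
      (fun p : Torus m × P => p.1 • p.2) := contMDiff_smul
    have h1 : ContMDiffAt 𝓘(ℂ, (Fin m → ℂ) × Cn n) 𝓘(ℂ, Fin m → ℂ) ω
        (fun p : (Fin m → ℂ) × Cn n => e.symm p.1) (e 1, y) :=
      he.comp (e 1, y) (contDiff_fst.contMDiff.contMDiffAt)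
    have h2 : ContMDiffAt 𝓘(ℂ, (Fin m → ℂ) × Cn n) 𝓘(ℂ, Cn n) ω
        (fun p : (Fin m → ℂ) × Cn n => ψ.symm p.2) (e 1, y) :=
      hψs.comp (e 1, y) (contDiff_snd.contMDiff.contMDiffAt)
    have h3 := hsm.contMDiffAt.comp (e 1, y) (h1.prodMk h2)
    have hval : e.symm (e 1) • ψ.symm y = ψ.symm y := by
      rw [e.left_inv (mem_chart_source _ _), one_smul]
    have h4 : ContMDiffAt 𝓘(ℂ, Cn n) 𝓘(ℂ, Cn n) ω ψ (e.symm (e 1) • ψ.symm y) := by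
      rw [hval]
      exact (contMDiffOn_chart (I := 𝓘(ℂ, Cn n)) (x := p₀)).contMDiffAt
        (ψ.open_source.mem_nhds (ψ.map_target hy))
    have h5 : ContMDiffAt 𝓘(ℂ, (Fin m → ℂ) × Cn n) 𝓘(ℂ, Cn n) ω G (e 1, y) :=
      ContMDiffAt.comp (e 1, y) (g := ψ) (f := fun p : (Fin m → ℂ) × Cn n =>
        e.symm p.1 • ψ.symm p.2) h4 h3
    rw [contMDiffAt_iff_contDiffAt] at h5
    exact h5.analyticAt
  have key : ∀ y ∈ ψ.target, sigmaInChart n m p₀ x y = fderiv ℂ G (e 1, y) (x', 0) := by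
    intro y hy
    have hs := ψ.map_target hy
    have hψd : MDifferentiableAt 𝓘(ℂ, Cn n) 𝓘(ℂ, Cn n) ψ (ψ.symm y) :=
      (mdifferentiable_chartAt (n := n) p₀).mdifferentiableAt hs
    have e1 : sigmaInChart n m p₀ x y
        = mvfderiv 𝓘(ℂ, Fin m → ℂ) (fun t : Torus m => ψ (t • ψ.symm y)) 1 x :=
      mvfderiv_sigma hψd x
    have hd : MDifferentiableAt 𝓘(ℂ, Fin m → ℂ) 𝓘(ℂ, Cn n)
        (fun t : Torus m => ψ (t • ψ.symm y)) 1 := by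
      have : MDifferentiableAt 𝓘(ℂ, Cn n) 𝓘(ℂ, Cn n) ψ ((1 : Torus m) • ψ.symm y) := by
        rwa [one_smul]
      exact this.comp 1 (mdifferentiableAt_orbitMap (ψ.symm y))
    have e2 : mvfderiv 𝓘(ℂ, Fin m → ℂ) (fun t : Torus m => ψ (t • ψ.symm y)) 1
        = fderiv ℂ (fun z : Fin m → ℂ => ψ (e.symm z • ψ.symm y)) (e 1) := by
      rw [hd.mvfderiv]
      simp only [modelWithCornersSelf_coe, Set.range_id, fderivWithin_univ]
      rfl
    have e0 : HasFDerivAt (𝕜 := ℂ) (fun z : Fin m → ℂ => (z, y)) _ (e 1) :=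
      hasFDerivAt_prodMk_left (e 1) y
    have e3 : HasFDerivAt (fun z : Fin m → ℂ => ψ (e.symm z • ψ.symm y))
        ((fderiv ℂ G (e 1, y)).comp (ContinuousLinearMap.inl ℂ (Fin m → ℂ) (Cn n))) (e 1) :=
      HasFDerivAt.comp (g := G) (e 1) (hG y hy).differentiableAt.hasFDerivAt e0
    rw [e1, e2, e3.fderiv]
    rfl
  have hfin : AnalyticAt ℂ (fun y => fderiv ℂ G (e 1, y) (x', 0)) y₀ := by
    have h1 : AnalyticAt ℂ (fun y : Cn n => ((e 1, y) : (Fin m → ℂ) × Cn n)) y₀ :=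
      analyticAt_const.prod analyticAt_id
    have h2 : AnalyticAt ℂ (fun y => fderiv ℂ G (e 1, y)) y₀ := (hG y₀ hy₀).fderiv.fun_comp h1
    exact ((ContinuousLinearMap.apply ℂ (Cn n) (x', (0 : Cn n))).analyticAt _).comp h2
  refine hfin.congr ?_
  filter_upwards [ψ.open_target.mem_nhds hy₀] with y hy
  exact (key y hy).symm

lemma analyticAt_sigmaInChart_apply {p₀ : P} {y₀ : Cn n}
    (hy₀ : y₀ ∈ (chartAt (Cn n) p₀).target) (x : TorusLie m) (k : Fin n) :
    AnalyticAt ℂ (fun y => sigmaInChart n m p₀ x y k) y₀ :=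
  ((EuclideanSpace.proj (𝕜 := ℂ) k : Cn n →L[ℂ] ℂ).analyticAt _).comp
    (analyticAt_sigmaInChart hy₀ x)

end Action

/-! ### Open leaves -/

section OpenLeaf

open Filter Topology

lemma finrank_real_Cn (n : ℕ) : Module.finrank ℝ (Cn n) = 2 * n := by
  rw [finrank_real_of_complex]
  simp

variable {n : ℕ} {P : Type u} [TopologicalSpace P] [ChartedSpace (Cn n) P]
  [IsManifold 𝓘(ℂ, Cn n) ω P]

/-- The image of a holomorphic map from a second countable manifold of smaller dimension contains
no nonempty open set. -/
lemma le_of_isOpen_range {k : ℕ} {N : Type u} [TopologicalSpace N] [ChartedSpace (Cn k) N]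
    [SecondCountableTopology N] [IsManifold 𝓘(ℂ, Cn k) ω N] {ι : N → P}
    (hι : ContMDiff 𝓘(ℂ, Cn k) 𝓘(ℂ, Cn n) ω ι) (hopen : IsOpen (Set.range ι)) [Nonempty N] :
    n ≤ k := by
  obtain ⟨x₀⟩ := ‹Nonempty N›
  set ψ := chartAt (Cn n) (ι x₀)
  set S : Set (Cn n) := ψ '' (ψ.source ∩ Set.range ι)
  have hSopen : IsOpen S := ψ.isOpen_image_source_inter hopen
  have hSne : ψ (ι x₀) ∈ S := ⟨ι x₀, ⟨mem_chart_source _ _, x₀, rfl⟩, rfl⟩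
  -- Compare Hausdorff dimensions over `ℝ`. A nonempty open set has dimension `2n`; by second
  -- countability `S` is covered by countably many locally Lipschitz images of subsets of `ℂᵏ`, each
  -- of dimension at most `2k`.
  have hdimS : dimH S = ((2 * n : ℕ) : ENNReal) := by
    rw [Real.dimH_of_mem_nhds (hSopen.mem_nhds hSne), finrank_real_Cn]
  let χ : N → OpenPartialHomeomorph N (Cn k) := fun y => chartAt (Cn k) y
  let O : N → Set (Cn k) := fun y => (χ y).target ∩ (χ y).symm ⁻¹' (ι ⁻¹' ψ.source)
  let g : N → Cn k → Cn n := fun y => ψ ∘ ι ∘ (χ y).symm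
  have hdim : ∀ y, dimH (g y '' O y) ≤ ((2 * k : ℕ) : ENNReal) := by
    intro y
    have hlip : ∀ z ∈ O y, ∃ C : NNReal, ∃ t ∈ 𝓝[O y] z, LipschitzOnWith C (g y) t := by
      rintro z ⟨hz, hzs⟩
      have h1 : ContMDiffAt 𝓘(ℂ, Cn k) 𝓘(ℂ, Cn k) ω (χ y).symm z :=
        (contMDiffOn_chart_symm (I := 𝓘(ℂ, Cn k)) (x := y)).contMDiffAt
          ((χ y).open_target.mem_nhds hz)
      have h2 : ContMDiffAt 𝓘(ℂ, Cn n) 𝓘(ℂ, Cn n) ω ψ (ι ((χ y).symm z)) :=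
        (contMDiffOn_chart (I := 𝓘(ℂ, Cn n)) (x := ι x₀)).contMDiffAt
          (ψ.open_source.mem_nhds hzs)
      have h3 : ContMDiffAt 𝓘(ℂ, Cn k) 𝓘(ℂ, Cn n) ω (g y) z :=
        ContMDiffAt.comp z (g := ψ) h2 (hι.contMDiffAt.comp z h1)
      rw [contMDiffAt_iff_contDiffAt] at h3
      have h4 : ContDiffAt ℝ 1 (g y) z := (h3.of_le (by simp)).restrict_scalars ℝ
      obtain ⟨K, t, ht, hK⟩ := h4.exists_lipschitzOnWith
      exact ⟨K, t, mem_nhdsWithin_of_mem_nhds ht, hK⟩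
    refine (dimH_image_le_of_locally_lipschitzOn hlip).trans ?_
    refine (dimH_mono (Set.subset_univ _)).trans ?_
    rw [Real.dimH_univ_eq_finrank, finrank_real_Cn]
  obtain ⟨c, hc, hcov⟩ := TopologicalSpace.countable_cover_nhds
    (f := fun y : N => (χ y).source) fun y => (χ y).open_source.mem_nhds (mem_chart_source _ _)
  have hsub : S ⊆ ⋃ y ∈ c, g y '' O y := by
    rintro _ ⟨_, ⟨hs, z, rfl⟩, rfl⟩
    have hz : z ∈ ⋃ y ∈ c, (χ y).source := by rw [hcov]; trivial
    simp only [Set.mem_iUnion, exists_prop] at hz ⊢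
    obtain ⟨y, hy, hzy⟩ := hz
    refine ⟨y, hy, χ y z, ⟨(χ y).map_source hzy, ?_⟩, ?_⟩
    · simp only [Set.mem_preimage, (χ y).left_inv hzy]
      exact hs
    · simp only [g, Function.comp, (χ y).left_inv hzy]
  have hle : dimH S ≤ ((2 * k : ℕ) : ENNReal) := by
    refine (dimH_mono hsub).trans ?_
    rw [dimH_bUnion hc]
    exact iSup₂_le fun y _ => hdim y
  rw [hdimS] at hle
  have : 2 * n ≤ 2 * k := by exact_mod_cast hle
  omega

/-- The immersed topology may be finer than that of `P`, so openness is used through dimension: `n ≤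
k`, and an injective differential from a `k`-dimensional space is then onto. -/
lemma IsIntegralManifold.eq_top {A : ∀ p : P, Submodule ℂ (Tan n p)} {L : Set P}
    (hL : IsIntegralManifold A L) (hopen : IsOpen L) {p : P} (hp : p ∈ L) : A p = ⊤ := by
  obtain ⟨k, N, iT, iC, ι, hT2, hsc, hconn, hman, hι, hinj, hrange, hd⟩ := hL
  subst hrange
  obtain ⟨x, rfl⟩ := hp
  obtain ⟨h1, h2⟩ := hd x
  have : FiniteDimensional ℂ (TangentSpace 𝓘(ℂ, Cn n) (ι x)) :=
    inferInstanceAs (FiniteDimensional ℂ (Cn n))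
  have hk := le_of_isOpen_range hι hopen
  rw [← h2]
  apply Submodule.eq_top_of_finrank_eq
  refine le_antisymm (Submodule.finrank_le _) ?_
  rw [LinearMap.finrank_range_of_inj h1]
  have e1 : Module.finrank ℂ (Tan n (ι x)) = n := by
    change Module.finrank ℂ (Cn n) = n; simp
  have e2 : Module.finrank ℂ (TangentSpace 𝓘(ℂ, Cn k) x) = k := by
    change Module.finrank ℂ (Cn k) = k; simp
  rw [e1, e2]
  exact hk

end OpenLeaf

/-! ### Jacobians in charts and the identity theorem. -/

section IdentityTheorem

open Filter Topology

variable {n : ℕ} {P : Type u} [TopologicalSpace P] [ChartedSpace (Cn n) P]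

lemma pairingDual_wedgeD (Φ : Fin n → P → ℂ) (p : P) (w : ⋀[ℂ]^n (Tan n p)) :
    exteriorPower.pairingDual ℂ _ n (wedgeD n Φ p) w = pair w (fun i => dAt n (Φ i) p) := rfl

variable [IsManifold 𝓘(ℂ, Cn n) ω P]

/-- Coefficients of `dφ₁ ∧ ⋯ ∧ dφ_n` in the charts, up to the linear isomorphism `chartMap`. -/
lemma pair_dAt_eq_jac {p₀ : P} {Φ : Fin n → P → ℂ} (hΦ : ∀ i, HolOn n (Φ i) Set.univ) {x : Cn n}
    (hx : x ∈ (chartAt (Cn n) p₀).target)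
    (w : ⋀[ℂ]^n (Tan n ((chartAt (Cn n) p₀).symm x))) :
    pair w (fun i => dAt n (Φ i) ((chartAt (Cn n) p₀).symm x))
      = jac (fun i => inChart n p₀ (Φ i)) x
        * pair w (fun i => dAt n (coord n p₀ i) ((chartAt (Cn n) p₀).symm x)) := by
  have hs := (chartAt (Cn n) p₀).map_target hx
  rw [jac, ← pair_matrix]
  congr 1
  ext i : 1
  rw [dAt_eq_comp_chartMap hs ((hΦ i).mdifferentiableAt isOpen_univ trivial),
    (chartAt (Cn n) p₀).right_inv hx, covec_eq_sum]
  ext v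
  simp only [LinearMap.comp_apply, LinearMap.sum_apply, LinearMap.smul_apply, dAt_coord hs]
  rfl

lemma coordVec_pairing {p₀ : P} {Φ : Fin n → P → ℂ} (hΦ : ∀ i, HolOn n (Φ i) Set.univ) {x : Cn n}
    (hx : x ∈ (chartAt (Cn n) p₀).target) :
    exteriorPower.pairingDual ℂ _ n (wedgeD n Φ ((chartAt (Cn n) p₀).symm x))
      (exteriorPower.ιMulti ℂ n (fun j => coordVec n p₀ j x))
      = jac (fun i => inChart n p₀ (Φ i)) x := by
  have hs := (chartAt (Cn n) p₀).map_target hx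
  rw [pairingDual_wedgeD, pair_dAt_eq_jac hΦ hx, pair_ιMulti]
  have : (Matrix.of fun i j => (dAt n (coord n p₀ j) ((chartAt (Cn n) p₀).symm x))
      (coordVec n p₀ i x)) = (1 : Matrix (Fin n) (Fin n) ℂ) := by
    ext i j
    rw [Matrix.of_apply, dAt_coord hs, LinearMap.comp_apply, chartMap_coordVec p₀ i hx,
      stdBasis_coord, Matrix.one_apply, PiLp.single_apply]
    simp [eq_comm]
  rw [this, Matrix.det_one, mul_one]

lemma ιMulti_ne_zero_of_linearIndependent {E : Type*} [AddCommGroup E] [Module ℂ E] {k : ℕ}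
    {α : Fin k → E} (hα : LinearIndependent ℂ α) : exteriorPower.ιMulti ℂ k α ≠ 0 := by
  choose δ hδ using fun j : Fin k => exists_dual_of_linearIndependent hα (Pi.single j 1)
  intro h
  have h1 : pair (exteriorPower.ιMulti ℂ k α) δ = 1 := by
    rw [pair_ιMulti, ← Matrix.det_one (n := Fin k)]
    congr 1
    ext i j
    rw [Matrix.of_apply, hδ, Matrix.one_apply, Pi.single_apply]
  rw [h, pair_zero] at h1
  exact zero_ne_one h1

lemma linearIndependent_dAt_iff {p₀ : P} {Φ : Fin n → P → ℂ}
    (hΦ : ∀ i, HolOn n (Φ i) Set.univ) {x : Cn n} (hx : x ∈ (chartAt (Cn n) p₀).target) :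
    LinearIndependent ℂ (fun i => dAt n (Φ i) ((chartAt (Cn n) p₀).symm x)) ↔
      jac (fun i => inChart n p₀ (Φ i)) x ≠ 0 := by
  have hs := (chartAt (Cn n) p₀).map_target hx
  have hd : (fun i => dAt n (Φ i) ((chartAt (Cn n) p₀).symm x))
      = (chartMap n p₀ ((chartAt (Cn n) p₀).symm x)).dualMap ∘
        fun i => covec (inChart n p₀ (Φ i)) x := by
    ext i : 1
    rw [dAt_eq_comp_chartMap hs ((hΦ i).mdifferentiableAt isOpen_univ trivial),
      (chartAt (Cn n) p₀).right_inv hx]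
    rfl
  have hinj : LinearMap.ker (chartMap n p₀ ((chartAt (Cn n) p₀).symm x)).dualMap = ⊥ :=
    LinearMap.ker_eq_bot.2 (LinearMap.dualMap_injective_of_surjective (chartMap_bijective hs).2)
  rw [hd, LinearMap.linearIndependent_iff _ hinj]
  have hrow : (Matrix.of fun i k => pderiv k (inChart n p₀ (Φ i)) x).row
      = (stdBasis n).dualBasis.equivFun ∘ fun i => covec (inChart n p₀ (Φ i)) x := by
    ext i k
    simp [covec, pderiv]
  rw [jac, ← isUnit_iff_ne_zero, ← Matrix.isUnit_iff_isUnit_det,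
    ← Matrix.linearIndependent_rows_iff_isUnit, hrow]
  exact (LinearMap.linearIndependent_iff _ (LinearEquiv.ker _)).symm

lemma analyticAt_jac_inChart {p₀ : P} {Φ : Fin n → P → ℂ} (hΦ : ∀ i, HolOn n (Φ i) Set.univ)
    {x : Cn n} (hx : x ∈ (chartAt (Cn n) p₀).target) :
    AnalyticAt ℂ (jac (fun i => inChart n p₀ (Φ i))) x :=
  analyticAt_jac fun i => (hΦ i).analyticAt_inChart isOpen_univ hx trivial

/-- The differentials of an independent family of holomorphic functions on a connected manifold
are linearly independent on a dense set. -/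
lemma dense_linearIndependent_dAt [ConnectedSpace P] {Φ : Fin n → P → ℂ}
    (hΦ : ∀ i, HolOn n (Φ i) Set.univ) (hind : Independent n Φ) :
    Dense {p | LinearIndependent ℂ (fun i => dAt n (Φ i) p)} := by
  set Z : Set P := {p | LinearIndependent ℂ (fun i => dAt n (Φ i) p)} with hZ
  set V : Set P := interior Zᶜ with hV
  -- The interior of the degeneracy locus is also closed: at a limit point, the Jacobian in a chart
  -- vanishes on part of a ball, hence on all of it. Connectedness leaves only the empty set or all
  -- of `P`, and independence at one point excludes the latter.
  have hclosed : IsClosed V := by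
    rw [← closure_subset_iff_isClosed]
    intro q hq
    set ψ := chartAt (Cn n) q
    have hx₀ : ψ q ∈ ψ.target := ψ.map_source (mem_chart_source _ _)
    obtain ⟨r, hr, hball⟩ := Metric.isOpen_iff.1 ψ.open_target _ hx₀
    have hnb : ψ.source ∩ ψ ⁻¹' Metric.ball (ψ q) r ∈ 𝓝 q :=
      (ψ.isOpen_inter_preimage Metric.isOpen_ball).mem_nhds
        ⟨mem_chart_source _ _, Metric.mem_ball_self hr⟩
    obtain ⟨y, ⟨hys, hyb⟩, hyV⟩ := mem_closure_iff_nhds.1 hq _ hnb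
    have han : AnalyticOnNhd ℂ (jac (fun i => inChart n q (Φ i))) (Metric.ball (ψ q) r) :=
      fun x hx => analyticAt_jac_inChart hΦ (hball hx)
    have hev : jac (fun i => inChart n q (Φ i)) =ᶠ[𝓝 (ψ y)] 0 := by
      have h1 : ∀ᶠ x in 𝓝 (ψ y), ψ.symm x ∈ V := by
        have := ψ.symm.continuousAt (x := ψ y) (ψ.map_source hys)
        rw [ContinuousAt, ψ.left_inv hys] at this
        exact this.eventually (isOpen_interior.mem_nhds hyV)
      filter_upwards [h1, ψ.open_target.mem_nhds (ψ.map_source hys)] with x hx hxt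
      by_contra hne
      exact interior_subset hx ((linearIndependent_dAt_iff hΦ hxt).2 hne)
    have hzero := han.eqOn_zero_of_preconnected_of_eventuallyEq_zero
      (convex_ball _ _).isPreconnected hyb hev
    refine mem_interior_iff_mem_nhds.2 (mem_of_superset hnb ?_)
    rintro z ⟨hzs, hzb⟩ hzZ
    have hz2 : LinearIndependent ℂ (fun i => dAt n (Φ i) (ψ.symm (ψ z))) := by
      rw [ψ.left_inv hzs]; exact hzZ
    exact (linearIndependent_dAt_iff hΦ (ψ.map_source hzs)).1 hz2 (hzero hzb)
  obtain ⟨p, hp⟩ := hind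
  have hpZ : p ∈ Z := by
    by_contra hdep
    exact hp ((exteriorPower.ιMulti ℂ n).map_linearDependent _ hdep)
  rcases isClopen_iff.1 ⟨hclosed, isOpen_interior⟩ with h | h
  · rwa [hV, interior_eq_empty_iff_dense_compl, compl_compl] at h
  · exact absurd hpZ (interior_subset (h ▸ Set.mem_univ p))

lemma not_eventually_jac_zero [ConnectedSpace P] {Φ : Fin n → P → ℂ}
    (hΦ : ∀ i, HolOn n (Φ i) Set.univ) (hind : Independent n Φ) {p₀ : P} {x : Cn n}
    (hx : x ∈ (chartAt (Cn n) p₀).target) :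
    ¬ jac (fun i => inChart n p₀ (Φ i)) =ᶠ[𝓝 x] 0 := by
  intro h
  set ψ := chartAt (Cn n) p₀
  have hcont : Tendsto ψ (𝓝 (ψ.symm x)) (𝓝 x) := by
    have := ψ.continuousAt (ψ.map_target hx)
    rwa [ContinuousAt, ψ.right_inv hx] at this
  have h1 : ∀ᶠ q in 𝓝 (ψ.symm x), jac (fun i => inChart n p₀ (Φ i)) (ψ q) = 0 := hcont.eventually h
  have h2 := h1.and (ψ.open_source.mem_nhds (ψ.map_target hx))
  obtain ⟨q, ⟨hq, hqs⟩, hqZ⟩ := mem_closure_iff_nhds.1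
    ((dense_linearIndependent_dAt hΦ hind) (ψ.symm x)) _ h2
  have hz2 : LinearIndependent ℂ (fun i => dAt n (Φ i) (ψ.symm (ψ q))) := by
    rw [ψ.left_inv hqs]; exact hqZ
  exact (linearIndependent_dAt_iff hΦ (ψ.map_source hqs)).1 hz2 hq

/-- A function vanishing near `x` gives the Jacobian matrix a zero row there. This supplies the
hypothesis of `ord_prod`. -/
lemma not_eventually_zero_of_jac {φ : Fin n → Cn n → ℂ} {x : Cn n} (h : ¬ jac φ =ᶠ[𝓝 x] 0)
    (i : Fin n) : ¬ φ i =ᶠ[𝓝 x] 0 := by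
  intro h0
  apply h
  filter_upwards [h0.eventually_nhds] with y hy
  refine Matrix.det_eq_zero_of_row_eq_zero i fun k => ?_
  rw [Matrix.of_apply, pderiv, EventuallyEq.fderiv_eq (f₁ := φ i) (f := fun _ => 0) hy]
  simp

end IdentityTheorem

/-! ### The coefficient of a top degree multivector field, and degrees -/

section TopCoefficient

open Filter Topology

lemma coe_map_eq_pow_mul_ιMulti {V W : Type*} [AddCommGroup V] [Module ℂ V] [AddCommGroup W]
    [Module ℂ W] (f : V →ₗ[ℂ] W) {k r d : ℕ} {w : ⋀[ℂ]^k V} {b : ⋀[ℂ]^2 V} {u : Fin d → V}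
    (h : (w : ExteriorAlgebra ℂ V) = (b : ExteriorAlgebra ℂ V) ^ r * ExteriorAlgebra.ιMulti ℂ d u) :
    (exteriorPower.map k f w : ExteriorAlgebra ℂ W)
      = (exteriorPower.map 2 f b : ExteriorAlgebra ℂ W) ^ r *
        ExteriorAlgebra.ιMulti ℂ d (fun i => f (u i)) := by
  rw [coe_exteriorPower_map, coe_exteriorPower_map, h, map_mul, map_pow,
    ExteriorAlgebra.map_apply_ιMulti]
  rfl

variable {n m : ℕ} {P : Type u} [TopologicalSpace P] [ChartedSpace (Cn n) P]

/-- The coefficient of `∂₁ ∧ ⋯ ∧ ∂_n` in an `n`-vector field, in the preferred chart at `p₀`. -/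
def topCoeff (p₀ : P) (Pf : MultivectorField n n P) (x : Cn n) : ℂ :=
  pair (Pf ((chartAt (Cn n) p₀).symm x))
    (fun j => dAt n (coord n p₀ j) ((chartAt (Cn n) p₀).symm x))

instance uniqueOrderEmb (n : ℕ) : Unique (Fin n ↪o Fin n) where
  default := RelEmbedding.refl _
  uniq := orderEmb_eq_refl

lemma vecDeg_eq (Pf : MultivectorField n n P) (p₀ : P) :
    vecDeg Pf p₀ = (ord (topCoeff p₀ Pf) (chartAt (Cn n) p₀ p₀) : ℤ) - n := by
  unfold vecDeg
  rw [vanishingOrder_eq_ord]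
  rfl

lemma chartAt_self_mem_target (p₀ : P) : chartAt (Cn n) p₀ p₀ ∈ (chartAt (Cn n) p₀).target :=
  (chartAt (Cn n) p₀).map_source (mem_chart_source _ _)

lemma eventually_mem_target (p₀ : P) :
    ∀ᶠ x in 𝓝 (chartAt (Cn n) p₀ p₀), x ∈ (chartAt (Cn n) p₀).target :=
  (chartAt (Cn n) p₀).open_target.mem_nhds (chartAt_self_mem_target p₀)

variable [IsManifold 𝓘(ℂ, Cn n) ω P]

lemma formDeg_wedgeD {Φ : Fin n → P → ℂ} (hΦ : ∀ i, HolOn n (Φ i) Set.univ) (p₀ : P) :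
    formDeg (wedgeD n Φ) p₀
      = (ord (jac (fun i => inChart n p₀ (Φ i))) (chartAt (Cn n) p₀ p₀) : ℤ) + n := by
  unfold formDeg
  rw [vanishingOrder_eq_ord]
  congr 2
  refine ord_congr ?_
  filter_upwards [eventually_mem_target p₀] with x hx
  exact coordVec_pairing hΦ hx

variable [MulAction (Torus m) P]

/-- `Pf = ∧ʳ π ∧ σ(x₁) ∧ ⋯ ∧ σ(x_d)`. -/
def IsPfaffianForm (π : MultivectorField n 2 P) (r : ℕ) {d : ℕ} (x : Fin d → TorusLie m)
    (Pf : MultivectorField n n P) : Prop :=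
  ∀ q : P, (Pf q : ExteriorAlgebra ℂ (Tan n q)) =
    (π q : ExteriorAlgebra ℂ (Tan n q)) ^ r *
      ExteriorAlgebra.ιMulti ℂ d (fun i => sigma n m q (x i))

/-- A functional on the exterior algebra computing the coefficients `topCoeff`. -/
lemma IsPfaffianForm.exists_functional_topCoeff {π : MultivectorField n 2 P} {r d : ℕ}
    {x : Fin d → TorusLie m} {Pf : MultivectorField n n P} (hPf : IsPfaffianForm π r x Pf) (p₀ : P) :
    ∃ T : ExteriorAlgebra ℂ (Cn n) →ₗ[ℂ] ℂ, ∀ y ∈ (chartAt (Cn n) p₀).target, topCoeff p₀ Pf y =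
      T ((bivInChart p₀ π y : ExteriorAlgebra ℂ (Cn n)) ^ r *
        ExteriorAlgebra.ιMulti ℂ d (fun i => sigmaInChart n m p₀ (x i) y)) := by
  obtain ⟨T, hT⟩ := exists_functional_pair (fun i => (stdBasis n).coord i)
  refine ⟨T, fun y hy => ?_⟩
  rw [topCoeff, pair_dAt_coord ((chartAt (Cn n) p₀).map_target hy), ← hT,
    coe_map_eq_pow_mul_ιMulti _ (hPf _)]
  rfl

lemma IsPfaffianForm.analyticAt_topCoeff
    [ContMDiffSMul 𝓘(ℂ, Fin m → ℂ) 𝓘(ℂ, Cn n) ω (Torus m) P] {π : MultivectorField n 2 P}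
    (hπ : IsPoisson π) {r d : ℕ} {x : Fin d → TorusLie m} {Pf : MultivectorField n n P}
    (hPf : IsPfaffianForm π r x Pf) {p₀ : P} {y : Cn n} (hy : y ∈ (chartAt (Cn n) p₀).target) :
    AnalyticAt ℂ (topCoeff p₀ Pf) y := by
  obtain ⟨T, hT⟩ := hPf.exists_functional_topCoeff p₀
  have h : CoeffsIn (analyticSubalgebra y) (fun y =>
      (bivInChart p₀ π y : ExteriorAlgebra ℂ (Cn n)) ^ r *
        ExteriorAlgebra.ιMulti ℂ d (fun i => sigmaInChart n m p₀ (x i) y)) :=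
    coeffsIn_pow_mul_ιMulti (fun k l => analyticAt_bcoef hπ hy k l)
      (fun i k => analyticAt_sigmaInChart_apply hy (x i) k) r
  refine AnalyticAt.congr (h T) ?_
  filter_upwards [(chartAt (Cn n) p₀).open_target.mem_nhds hy] with z hz
  exact (hT z hz).symm

end TopCoefficient

/-! ### The Pfaffian and log-canonical systems -/

section LogCanonical

open Filter Topology

lemma pow_mul_ιMulti_mem {V : Type*} [AddCommGroup V] [Module ℂ V] (b : ⋀[ℂ]^2 V) {r d n : ℕ}
    (h : 2 * r + d = n) (u : Fin d → V) :
    (b : ExteriorAlgebra ℂ V) ^ r * ExteriorAlgebra.ιMulti ℂ d u ∈ ⋀[ℂ]^n V := by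
  have h1 : (b : ExteriorAlgebra ℂ V) ^ r ∈
      LinearMap.range (ExteriorAlgebra.ι ℂ (M := V)) ^ (2 * r) := by
    rw [pow_mul]
    exact Submodule.pow_mem_pow _ b.2 r
  have h2 : ExteriorAlgebra.ιMulti ℂ d u ∈ LinearMap.range (ExteriorAlgebra.ι ℂ (M := V)) ^ d :=
    ExteriorAlgebra.ιMulti_range ℂ d ⟨u, rfl⟩
  rw [← h]
  change _ ∈ LinearMap.range (ExteriorAlgebra.ι ℂ (M := V)) ^ (2 * r + d)
  rw [pow_add]
  exact Submodule.mul_mem_mul h1 h2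

/-- The diagonal endomorphism of `ℂⁿ`. -/
def diagMap {n : ℕ} (c : Fin n → ℂ) : Cn n →ₗ[ℂ] Cn n where
  toFun v := WithLp.toLp 2 fun i => c i * v i
  map_add' v w := by ext i; simp [mul_add]
  map_smul' a v := by ext i; simp [mul_left_comm]

lemma coord_comp_diagMap {n : ℕ} (c : Fin n → ℂ) (i : Fin n) :
    (stdBasis n).coord i ∘ₗ diagMap c = c i • (stdBasis n).coord i := by
  ext v
  simp only [LinearMap.comp_apply, LinearMap.smul_apply, stdBasis_coord, smul_eq_mul]
  rfl

/-- The linear map to `ℂⁿ` whose components are the given functionals. -/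
def mapOfFunctionals {n : ℕ} {V : Type*} [AddCommGroup V] [Module ℂ V]
    (α : Fin n → Module.Dual ℂ V) : V →ₗ[ℂ] Cn n where
  toFun v := WithLp.toLp 2 fun i => α i v
  map_add' v w := by ext i; simp
  map_smul' a v := by ext i; simp

lemma coord_comp_mapOfFunctionals {n : ℕ} {V : Type*} [AddCommGroup V] [Module ℂ V]
    (α : Fin n → Module.Dual ℂ V) (i : Fin n) :
    (stdBasis n).coord i ∘ₗ mapOfFunctionals α = α i := by
  ext v
  rw [LinearMap.comp_apply, stdBasis_coord]
  rfl

lemma bcoef_map {n : ℕ} {V : Type*} [AddCommGroup V] [Module ℂ V] (f : V →ₗ[ℂ] Cn n)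
    (w : ⋀[ℂ]^2 V) (i j : Fin n) : bcoef (exteriorPower.map 2 f w) i j
      = pair w ![(stdBasis n).coord i ∘ₗ f, (stdBasis n).coord j ∘ₗ f] := by
  rw [bcoef, pair_map]
  congr 1
  ext a : 1
  fin_cases a <;> rfl

variable {n m : ℕ} {P : Type u} [TopologicalSpace P] [ChartedSpace (Cn n) P]
  [MulAction (Torus m) P]
  [ContMDiffSMul 𝓘(ℂ, Fin m → ℂ) 𝓘(ℂ, Cn n) ω (Torus m) P] {π : MultivectorField n 2 P}

/-- Log-canonicity and the weight property say that the map `A` with components `dφᵢ` and the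
diagonal map `D = diag(φᵢ(q))` produce the same bivector and vectors, from the Pfaffian data at `q`
and from constant data respectively. The factor `∏ φᵢ(q)` is the determinant of `D`. -/
lemma IsPfaffianForm.exists_pair_eq {r d : ℕ} (hrd : 2 * r + d = n) {x : Fin d → TorusLie m}
    {Pf : MultivectorField n n P} (hPf : IsPfaffianForm π r x Pf) {Φ : Fin n → P → ℂ}
    (hΦ : IsTLogCanonicalSystem m π Φ) :
    ∃ c : ℂ, ∀ q, pair (Pf q) (fun i => dAt n (Φ i) q) = c * ∏ i, Φ i q := by
  choose c hc using hΦ.logCanonical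
  choose χ hχ using fun (i : Fin n) (a : Fin d) => (hΦ.weight i).dAt_sigma
    (fun q => (hΦ.holomorphic i).mdifferentiableAt isOpen_univ (Set.mem_univ q)) (x a)
  -- The constant `n`-vector built from the structure constants `c i j` and the infinitesimal
  -- weights `χ i a`; it is independent of `q`.
  let w₀ : ⋀[ℂ]^n (Cn n) := ⟨_, pow_mul_ιMulti_mem (ofCoeffs c) hrd
    (fun a => WithLp.toLp 2 fun i => χ i a)⟩
  refine ⟨pair w₀ fun i => (stdBasis n).coord i, fun q => ?_⟩
  set A := mapOfFunctionals fun i => dAt n (Φ i) q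
  set D := diagMap fun i => Φ i q
  have hbiv : exteriorPower.map 2 A (π q) = exteriorPower.map 2 D (ofCoeffs c) := by
    refine bivector_ext (stdBasis n) fun i j hij => ?_
    change bcoef _ i j = bcoef _ i j
    rw [bcoef_map, bcoef_map, coord_comp_mapOfFunctionals, coord_comp_mapOfFunctionals,
      coord_comp_diagMap, coord_comp_diagMap]
    have h1 := hc i j q
    rw [bracket] at h1
    have h2 : pair (ofCoeffs c) ![Φ i q • (stdBasis n).coord i, Φ j q • (stdBasis n).coord j]
        = (∏ a, ![Φ i q, Φ j q] a) * bcoef (ofCoeffs c) i j := by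
      rw [bcoef, ← pair_smul_univ]
      congr 1
      ext a : 1
      fin_cases a <;> rfl
    rw [h1, h2, bcoef_ofCoeffs c hij, Fin.prod_univ_two]
    simp only [Matrix.cons_val_zero, Matrix.cons_val_one]
    ring
  have hmap : exteriorPower.map n A (Pf q) = exteriorPower.map n D w₀ := by
    apply Subtype.ext
    rw [coe_map_eq_pow_mul_ιMulti A (hPf q), coe_map_eq_pow_mul_ιMulti D (w := w₀) rfl, hbiv]
    congr 2
    ext a i
    exact hχ i a q
  have h1 : (fun i => dAt n (Φ i) q) = fun i => (stdBasis n).coord i ∘ₗ A := by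
    ext i : 1
    rw [coord_comp_mapOfFunctionals]
  rw [h1, ← pair_map, hmap, pair_map]
  simp only [D, coord_comp_diagMap]
  rw [pair_smul_univ, mul_comm]

end LogCanonical

/-! ### Nonvanishing of the Pfaffian -/

section Nonvanishing

open Filter Topology

variable {n m : ℕ} {P : Type u} [TopologicalSpace P] [ChartedSpace (Cn n) P]
  [MulAction (Torus m) P] {π : MultivectorField n 2 P}

instance (q : P) : FiniteDimensional ℂ (Tan n q) := inferInstanceAs (FiniteDimensional ℂ (Cn n))

instance : FiniteDimensional ℂ (TorusLie m) := inferInstanceAs (FiniteDimensional ℂ (Fin m → ℂ))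

lemma finrank_tan (q : P) : Module.finrank ℂ (Tan n q) = n := by
  change Module.finrank ℂ (Cn n) = n
  simp

/-- A complement of the leaf stabilizer has dimension `n - rk π(p)` where the anchor is onto. -/
lemma finrank_add_finrank_sharpRange {p : P} (htop : anchorRange m π p = ⊤)
    {C : Submodule ℂ (TorusLie m)} (hC : IsCompl C (leafStabilizer m π p)) :
    Module.finrank ℂ C + Module.finrank ℂ (sharpRange (π p)) = n := by
  set S := sharpRange (π p)
  set g : TorusLie m →ₗ[ℂ] Tan n p ⧸ S := S.mkQ ∘ₗ sigma n m p
  have hker : LinearMap.ker g = leafStabilizer m π p := by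
    rw [LinearMap.ker_comp, Submodule.ker_mkQ]
    rfl
  have hrange : LinearMap.range g = ⊤ := by
    rw [LinearMap.range_comp, eq_top_iff, ← Submodule.map_top S.mkQ |>.trans S.range_mkQ, ← htop,
      anchorRange, Submodule.map_sup, Submodule.mkQ_map_self, sup_bot_eq]
  have h1 := LinearMap.finrank_range_add_finrank_ker g
  rw [hker, hrange, finrank_top] at h1
  have h2 := Submodule.finrank_add_eq_of_isCompl hC
  have h3 := Submodule.finrank_quotient_add_finrank S
  rw [finrank_tan] at h3
  omega

lemma span_sup_sharpRange_eq_top {p : P} (htop : anchorRange m π p = ⊤) {d : ℕ}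
    {x : Fin d → TorusLie m}
    (hC : IsCompl (Submodule.span ℂ (Set.range x)) (leafStabilizer m π p)) :
    sharpRange (π p) ⊔ Submodule.span ℂ (Set.range fun i => sigma n m p (x i)) = ⊤ := by
  rw [eq_top_iff, ← htop, anchorRange, ← Submodule.map_top, ← hC.sup_eq_top, Submodule.map_sup,
    Submodule.map_span, ← Set.range_comp]
  refine sup_le (sup_le le_sup_right (le_trans ?_ le_sup_left)) le_sup_left
  exact Submodule.map_comap_le _ _

/-- The complement has dimension both `d` and `n - rk π(p)`, so `2r = rk π(p)`, and `bivector_rank`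
applies to vectors that span the tangent space together with the range of `π(p)^#`. -/
lemma IsPfaffianForm.ne_zero {p : P} (htop : anchorRange m π p = ⊤) {r d : ℕ} (hrd : 2 * r + d = n)
    {x : Fin d → TorusLie m} (hx : LinearIndependent ℂ x)
    (hC : IsCompl (Submodule.span ℂ (Set.range x)) (leafStabilizer m π p))
    {Pf : MultivectorField n n P} (hPf : IsPfaffianForm π r x Pf) : Pf p ≠ 0 := by
  intro h0
  obtain ⟨k, hk, -, -, h⟩ := bivector_rank (π p)
  have h1 := finrank_add_finrank_sharpRange htop hC
  rw [finrank_span_eq_card hx, Fintype.card_fin, hk] at h1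
  obtain rfl : k = r := by omega
  refine h d (fun i => sigma n m p (x i)) (by rw [finrank_tan]; exact hrd)
    (span_sup_sharpRange_eq_top htop hC) ?_
  rw [← hPf p, h0]
  rfl

variable [IsManifold 𝓘(ℂ, Cn n) ω P]

lemma topCoeff_ne_zero {p : P} {Pf : MultivectorField n n P} (h : Pf p ≠ 0) :
    topCoeff p Pf (chartAt (Cn n) p p) ≠ 0 := by
  have hs := mem_chart_source (Cn n) p
  let e : Tan n p ≃ₗ[ℂ] Cn n := LinearEquiv.ofBijective (chartMap n p p) (chartMap_bijective hs)
  have h1 := pair_top_ne_zero ((stdBasis n).map e.symm) h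
  have h2 : ∀ q, q = p → pair (Pf q) (fun j => dAt n (coord n p j) q)
      = pair (Pf p) (fun j => dAt n (coord n p j) p) := by
    rintro q rfl; rfl
  rw [topCoeff, h2 _ ((chartAt (Cn n) p).left_inv hs)]
  convert h1 using 3 with i
  rw [dAt_coord hs]
  ext v
  simp [e]

variable [ContMDiffSMul 𝓘(ℂ, Fin m → ℂ) 𝓘(ℂ, Cn n) ω (Torus m) P]

/-- The relation between the coefficients of the Pfaffian and of a log-canonical system. -/
lemma jac_mul_topCoeff {Pf : MultivectorField n n P} {Φ : Fin n → P → ℂ}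
    (hΦ : ∀ i, HolOn n (Φ i) Set.univ) {c : ℂ}
    (hc : ∀ q, pair (Pf q) (fun i => dAt n (Φ i) q) = c * ∏ i, Φ i q) {p₀ : P} {x : Cn n}
    (hx : x ∈ (chartAt (Cn n) p₀).target) :
    jac (fun i => inChart n p₀ (Φ i)) x * topCoeff p₀ Pf x = c * ∏ i, inChart n p₀ (Φ i) x := by
  rw [topCoeff, ← pair_dAt_eq_jac hΦ hx, hc]
  rfl

/-- If `c = 0`, the Jacobian vanishes wherever the Pfaffian does not, in particular near `p`,
against the identity theorem. -/
lemma IsPfaffianForm.const_ne_zero [ConnectedSpace P] (hπ : IsPoisson π) {p : P}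
    {r d : ℕ} {x : Fin d → TorusLie m} {Pf : MultivectorField n n P} (hPf : IsPfaffianForm π r x Pf)
    (hp : Pf p ≠ 0) {Φ : Fin n → P → ℂ}
    (hΦ : IsLogCanonicalSystem π Φ) {c : ℂ}
    (hc : ∀ q, pair (Pf q) (fun i => dAt n (Φ i) q) = c * ∏ i, Φ i q) : c ≠ 0 := by
  rintro rfl
  have hx := chartAt_self_mem_target (n := n) p
  have h1 := (hPf.analyticAt_topCoeff hπ hx).continuousAt.eventually_ne (topCoeff_ne_zero hp)
  refine not_eventually_jac_zero hΦ.holomorphic hΦ.independent hx ?_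
  filter_upwards [h1, eventually_mem_target p] with y hy hyt
  have := jac_mul_topCoeff hΦ.holomorphic hc hyt
  rw [zero_mul] at this
  exact (mul_eq_zero.1 this).resolve_right hy

lemma logVolumeDeg_eq_ord [ConnectedSpace P] {Φ : Fin n → P → ℂ} (hΦ : IsLogCanonicalSystem π Φ)
    (p₀ : P) : logVolumeDeg Φ p₀
      = (ord (jac (fun i => inChart n p₀ (Φ i))) (chartAt (Cn n) p₀ p₀) : ℤ) + n
        - ((∑ i, ord (inChart n p₀ (Φ i)) (chartAt (Cn n) p₀ p₀) : ℕ) : ℤ) := by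
  have hx := chartAt_self_mem_target (n := n) p₀
  have hJ := not_eventually_jac_zero hΦ.holomorphic hΦ.independent hx
  rw [logVolumeDeg, formDeg_wedgeD hΦ.holomorphic, ← (ord_prod Finset.univ
    (fun i => (hΦ.holomorphic i).analyticAt_inChart isOpen_univ hx trivial)
    (not_eventually_zero_of_jac hJ)).1]
  rfl

/-- Compare orders in `J h = c ∏ φᵢ`. The right-hand side is not locally zero, hence neither is `h`,
at any `p₀`. -/
lemma IsPfaffianForm.ord_topCoeff [ConnectedSpace P] (hπ : IsPoisson π)
    {r d : ℕ} {x : Fin d → TorusLie m} {Pf : MultivectorField n n P} (hPf : IsPfaffianForm π r x Pf)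
    {Φ : Fin n → P → ℂ} (hΦ : IsLogCanonicalSystem π Φ) {c : ℂ} (hc0 : c ≠ 0)
    (hc : ∀ q, pair (Pf q) (fun i => dAt n (Φ i) q) = c * ∏ i, Φ i q) (p₀ : P) :
    ¬ topCoeff p₀ Pf =ᶠ[𝓝 (chartAt (Cn n) p₀ p₀)] 0 ∧
    ord (jac (fun i => inChart n p₀ (Φ i))) (chartAt (Cn n) p₀ p₀)
      + ord (topCoeff p₀ Pf) (chartAt (Cn n) p₀ p₀)
      = ∑ i, ord (inChart n p₀ (Φ i)) (chartAt (Cn n) p₀ p₀) := by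
  set x₀ := chartAt (Cn n) p₀ p₀
  have hx := chartAt_self_mem_target (n := n) p₀
  have hJ := not_eventually_jac_zero hΦ.holomorphic hΦ.independent hx
  have hJan := analyticAt_jac_inChart hΦ.holomorphic hx
  have hhan := hPf.analyticAt_topCoeff hπ hx
  have hφan : ∀ i, AnalyticAt ℂ (inChart n p₀ (Φ i)) x₀ := fun i =>
    (hΦ.holomorphic i).analyticAt_inChart isOpen_univ hx trivial
  obtain ⟨hprod, hprod0⟩ := ord_prod Finset.univ hφan (not_eventually_zero_of_jac hJ)
  have hprodan : AnalyticAt ℂ (fun x => ∏ i, inChart n p₀ (Φ i) x) x₀ :=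
    Finset.analyticAt_fun_prod _ fun i _ => hφan i
  obtain ⟨hcp, hcp0⟩ := ord_mul (analyticAt_const (v := c)) hprodan
    (not_eventually_zero_const hc0 x₀) hprod0
  have heq : (fun x => jac (fun i => inChart n p₀ (Φ i)) x * topCoeff p₀ Pf x) =ᶠ[𝓝 x₀]
      fun x => c * ∏ i, inChart n p₀ (Φ i) x := by
    filter_upwards [eventually_mem_target p₀] with y hy
    exact jac_mul_topCoeff hΦ.holomorphic hc hy
  have hh0 : ¬ topCoeff p₀ Pf =ᶠ[𝓝 x₀] 0 := by
    intro h
    apply hcp0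
    filter_upwards [heq, h] with y hy hy0
    rw [← hy, hy0]
    simp
  refine ⟨hh0, ?_⟩
  rw [← (ord_mul hJan hhan hJ hh0).1, ord_congr heq, hcp, ord_const hc0, hprod, zero_add]

lemma IsPfaffianForm.logVolumeDeg_eq [ConnectedSpace P] (hπ : IsPoisson π)
    {r d : ℕ} {x : Fin d → TorusLie m} {Pf : MultivectorField n n P} (hPf : IsPfaffianForm π r x Pf)
    {Φ : Fin n → P → ℂ} (hΦ : IsLogCanonicalSystem π Φ) {c : ℂ} (hc0 : c ≠ 0)
    (hc : ∀ q, pair (Pf q) (fun i => dAt n (Φ i) q) = c * ∏ i, Φ i q) (p₀ : P) :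
    logVolumeDeg Φ p₀ = - vecDeg Pf p₀ := by
  rw [logVolumeDeg_eq_ord hΦ, vecDeg_eq, ← (hPf.ord_topCoeff hπ hΦ hc0 hc p₀).2]
  push_cast
  ring

end Nonvanishing

/-! ### The rank of a bivector field -/

section Rank

variable {n : ℕ} {P : Type u} [TopologicalSpace P] [ChartedSpace (Cn n) P]

lemma finrank_sharpRange_le_rank (π : MultivectorField n 2 P) (q : P) :
    Module.finrank ℂ (sharpRange (π q)) ≤ rank π := by
  refine le_ciSup (f := fun p : P => Module.finrank ℂ (sharpRange (π p))) ⟨n, ?_⟩ q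
  rintro _ ⟨p, rfl⟩
  exact (Submodule.finrank_le _).trans_eq (finrank_tan p)

/-- The ranks are bounded by `n`, so their supremum is attained; it is even by the normal form. -/
lemma exists_rank_eq [Nonempty P] (π : MultivectorField n 2 P) :
    ∃ k q, rank π = 2 * k ∧ 2 * k ≤ n ∧ (π q : ExteriorAlgebra ℂ (Tan n q)) ^ k ≠ 0 := by
  obtain ⟨q, hq⟩ : rank π ∈ Set.range fun p : P => Module.finrank ℂ (sharpRange (π p)) := by
    refine Nat.sSup_mem (Set.range_nonempty _) ⟨n, ?_⟩
    rintro _ ⟨p, rfl⟩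
    exact (Submodule.finrank_le _).trans_eq (finrank_tan p)
  obtain ⟨k, hk, hk'⟩ := exists_finrank_sharpRange_eq (π q)
  refine ⟨k, q, hq.symm.trans hk, ?_, hk'⟩
  exact hk.symm.trans_le ((Submodule.finrank_le _).trans_eq (finrank_tan q))

end Rank

/-! ### Lowest degree terms at a zero of the Poisson structure -/

section LowestTerms

open Filter Topology

variable {n m : ℕ} {P : Type u} [TopologicalSpace P] [ChartedSpace (Cn n) P]
  {π : MultivectorField n 2 P}

lemma bcoef_bivInChart_eq_zero {p₀ : P} (h : π p₀ = 0) (i j : Fin n) :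
    bcoef (bivInChart p₀ π (chartAt (Cn n) p₀ p₀)) i j = 0 := by
  have h1 : ∀ q, q = p₀ → exteriorPower.map 2 (chartMap n p₀ q) (π q) = 0 := by
    rintro q rfl
    rw [h, map_zero]
  rw [bivInChart, h1 _ ((chartAt (Cn n) p₀).left_inv (mem_chart_source _ _)), bcoef, pair_zero]

variable [IsManifold 𝓘(ℂ, Cn n) ω P]

lemma bcoef_linearization (hπ : IsPoisson π) (p₀ : P) (v : Cn n) (i j : Fin n) :
    bcoef (linearization π p₀ v) i j
      = fderiv ℂ (fun y => bcoef (bivInChart p₀ π y) i j) (chartAt (Cn n) p₀ p₀) v := by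
  rw [linearization_eq hπ]
  refine bcoef_ofCoeffs_of_skew (fun k l => ?_) i j
  have : (fun y => bcoef (bivInChart p₀ π y) l k) = fun y => - bcoef (bivInChart p₀ π y) k l :=
    funext fun y => bcoef_swap _ _ _
  rw [this, fderiv_fun_neg]
  rfl

lemma bracket_low_eq_zero (hπ : IsPoisson π) {p₀ : P} (h : π p₀ = 0) {Φ : Fin n → P → ℂ}
    (hΦ : IsLogCanonicalSystem π Φ) (i j : Fin n) (v : Cn n) :
    pair (linearization π p₀ v) ![covec (low (Φ i) p₀) v, covec (low (Φ j) p₀) v] = 0 := by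
  have hx := chartAt_self_mem_target (n := n) p₀
  have han : ∀ i, AnalyticAt ℂ (inChart n p₀ (Φ i)) (chartAt (Cn n) p₀ p₀) := fun i =>
    (hΦ.holomorphic i).analyticAt_inChart isOpen_univ hx trivial
  have hmd : ∀ i q, MDifferentiableAt 𝓘(ℂ, Cn n) 𝓘(ℂ, ℂ) (Φ i) q := fun i q =>
    (hΦ.holomorphic i).mdifferentiableAt isOpen_univ trivial
  obtain ⟨c, hc⟩ := hΦ.logCanonical i j
  have h1 := lowest_terms_involution (han i) (han j)
    (M := fun k l y => bcoef (bivInChart p₀ π y) k l) (fun k l => analyticAt_bcoef hπ hx k l)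
    (bcoef_bivInChart_eq_zero h) (c := c) (by
      filter_upwards [eventually_mem_target p₀] with y hy
      rw [← pair_covec, ← bracket_eq_pair π hy (hmd i _) (hmd j _), hc]
      rfl) v
  refine (pair_covec (linearization π p₀ v) _ _ v).trans (Eq.trans ?_ h1)
  refine Finset.sum_congr rfl fun k _ => Finset.sum_congr rfl fun l _ => ?_
  rw [bcoef_linearization hπ]
  rfl

/-- The lowest degree terms of a log-canonical system contain an integrable system as soon as
`deg (μ_Φ^low) = rk(π₀) / 2`. -/
lemma containsPolynomialIntegrableSystem_low [ConnectedSpace P] (hπ : IsPoisson π) {p₀ : P}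
    (h : π p₀ = 0) {Φ : Fin n → P → ℂ} (hΦ : IsLogCanonicalSystem π Φ)
    (hI : PropertyI π Φ p₀) :
    ContainsPolynomialIntegrableSystem (linearization π p₀) (fun i => low (Φ i) p₀) := by
  have hx := chartAt_self_mem_target (n := n) p₀
  refine ⟨fun i => isPolynomialFun_homPart _ _ _, fun i j v => ?_, ?_⟩
  · rw [bracket, dAt_eq_covec, dAt_eq_covec]
    exact bracket_low_eq_zero hπ h hΦ i j v
  · obtain ⟨k, -, hk, hkn, -⟩ := exists_rank_eq (linearization π p₀)
    obtain ⟨v, hv⟩ := exists_homPart_ne_zero (analyticAt_jac_inChart hΦ.holomorphic hx)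
      (not_eventually_jac_zero hΦ.holomorphic hΦ.independent hx)
    obtain ⟨T, hT, hcard⟩ := exists_independent_gradients
      (fun i => (hΦ.holomorphic i).analyticAt_inChart isOpen_univ hx trivial) hv
    rw [PropertyI, logVolumeDeg_eq_ord hΦ, hk] at hI
    -- Property I turns `∑ ord φᵢ - ord J ≤ |T|` into `n - k ≤ |T|`; exactly `n - k` functions are
    -- kept.
    obtain ⟨T', hT', hcard'⟩ := Finset.exists_subset_card_eq (s := T) (n := n - k) (by omega)
    refine ⟨n - k, (T'.orderEmbOfFin hcard').toEmbedding, by omega, v, ?_⟩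
    refine ιMulti_ne_zero_of_linearIndependent ?_
    have h1 := hT.comp (fun a : Fin (n - k) =>
      (⟨T'.orderEmbOfFin hcard' a, hT' (T'.orderEmbOfFin_mem hcard' a)⟩ : T))
      (fun a b hab => by simpa using hab)
    simp only [dAt_eq_covec]
    exact h1

/-- At a zero of `π`, the degree of `μ_Φ^low` is at least `rk(π₀) / 2`. -/
lemma rank_linearization_le [ConnectedSpace P] (hπ : IsPoisson π) {p₀ : P}
    (h : π p₀ = 0) {Φ : Fin n → P → ℂ} (hΦ : IsLogCanonicalSystem π Φ) :
    (rank (linearization π p₀) : ℤ) ≤ 2 * logVolumeDeg Φ p₀ := by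
  have hx := chartAt_self_mem_target (n := n) p₀
  obtain ⟨k, v₀, hk, hkn, hv₀⟩ := exists_rank_eq (linearization π p₀)
  let W : Cn n → ⋀[ℂ]^2 (Cn n) := linearization π p₀
  have hpoly : CoeffsIn (polynomialSubalgebra n) fun v =>
      (W v : ExteriorAlgebra ℂ (Cn n)) ^ k := by
    refine (coeffsIn_bivector fun i j => ?_).pow k
    rw [show (fun v => bcoef (W v) i j) = _ from funext fun v => bcoef_linearization hπ p₀ v i j]
    exact IsPolynomialFun.of_linear _
  obtain ⟨T, hT⟩ : ∃ T : ExteriorAlgebra ℂ (Cn n) →ₗ[ℂ] ℂ,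
      T ((W v₀ : ExteriorAlgebra ℂ (Cn n)) ^ k) ≠ 0 := by
    by_contra! hall
    have hW : (W v₀ : ExteriorAlgebra ℂ (Cn n)) ^ k ≠ 0 := hv₀
    exact hW ((Module.forall_dual_apply_eq_zero_iff ℂ _).1 hall)
  -- A direction generic in two ways: the lowest term of the Jacobian is nonzero there and `π₀(v)`
  -- has maximal rank.
  obtain ⟨v, hv, hvT⟩ := (isPolynomialFun_homPart _ _ _).exists_mul_ne_zero (hpoly T)
    (exists_homPart_ne_zero (analyticAt_jac_inChart hΦ.holomorphic hx)
      (not_eventually_jac_zero hΦ.holomorphic hΦ.independent hx)) ⟨v₀, hT⟩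
  obtain ⟨S, hS, hcard⟩ := exists_independent_gradients
    (fun i => (hΦ.holomorphic i).analyticAt_inChart isOpen_univ hx trivial) hv
  have hrk : 2 * k ≤ Module.finrank ℂ (sharpRange (W v)) :=
    two_mul_le_finrank_sharpRange fun h0 => hvT ((congrArg T h0).trans (map_zero T))
  -- The differentials at `v` are isotropic for `π₀(v)`, so `|S| ≤ n - k`, while `|S| ≥ n - deg
  -- μ^low`.
  have hiso := isotropic_card_le (W v) hS
    fun i j => bracket_low_eq_zero hπ h hΦ i j v
  rw [Fintype.card_coe, finrank_euclideanSpace_fin] at hiso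
  rw [logVolumeDeg_eq_ord hΦ, hk]
  push_cast
  have : ((∑ i, ord (inChart n p₀ (Φ i)) (chartAt (Cn n) p₀ p₀) : ℕ) : ℤ) ≤
    ord (jac fun i => inChart n p₀ (Φ i)) (chartAt (Cn n) p₀ p₀) + S.card := by exact_mod_cast hcard
  push_cast at this
  omega

variable [MulAction (Torus m) P] [ContMDiffSMul 𝓘(ℂ, Fin m → ℂ) 𝓘(ℂ, Cn n) ω (Torus m) P]

/-- At a fixed point where `π` vanishes, the degree of the lowest degree term of the Pfaffian is
at least `- rk(π₀) / 2`. -/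
lemma IsPfaffianForm.neg_rank_le (hπ : IsPoisson π) {r d : ℕ} (hrd : 2 * r + d = n)
    {x : Fin d → TorusLie m} {Pf : MultivectorField n n P} (hPf : IsPfaffianForm π r x Pf) {p₀ : P}
    (h : π p₀ = 0) (hfix : ∀ t : Torus m, t • p₀ = p₀)
    (h0 : ¬ topCoeff p₀ Pf =ᶠ[𝓝 (chartAt (Cn n) p₀ p₀)] 0) :
    -(rank (linearization π p₀) : ℤ) ≤ 2 * vecDeg Pf p₀ := by
  set x₀ := chartAt (Cn n) p₀ p₀
  have hx : x₀ ∈ _ := chartAt_self_mem_target (n := n) p₀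
  obtain ⟨k, -, hk, hkn, -⟩ := exists_rank_eq (linearization π p₀)
  obtain ⟨T, hT⟩ := hPf.exists_functional_topCoeff p₀
  -- At a fixed point the infinitesimal action vanishes, so each factor `σ(xᵢ)` contributes at least
  -- one order.
  have hσ0 : ∀ y, sigmaInChart n m p₀ y x₀ = 0 := by
    intro y
    have h1 : ∀ q, q = p₀ → chartMap n p₀ q (sigma n m q y) = 0 := by
      rintro q rfl
      rw [sigma_eq_zero_of_fixed hfix, LinearMap.zero_apply, map_zero]
    exact h1 _ ((chartAt (Cn n) p₀).left_inv (mem_chart_source _ _))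
  have hle : n - k ≤ ord (topCoeff p₀ Pf) x₀ := by
    have han := hPf.analyticAt_topCoeff hπ hx
    refine le_ord han (fun v => ?_) ⟨_, exists_homPart_ne_zero han h0⟩
    -- On the line, `π = s π₀(v) + O(s²)` with `π₀(v) ^ (k + 1) = 0`; the resulting exponent is `2r
    -- + d - k = n - k`.
    have h1 := isOrd_pow_mul_ιMulti (W := fun s : ℂ => bivInChart p₀ π (x₀ + s • v))
      (W₀ := linearization π p₀ v) (fun i j => ?_)
      (pow_succ_eq_zero_of_finrank_sharpRange_le (V := Cn n)
        ((finrank_sharpRange_le_rank _ v).trans_eq hk))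
      (U := fun i s => sigmaInChart n m p₀ (x i) (x₀ + s • v)) (fun i j => ?_) r (n - k) (by omega)
    · refine (h1 T).congr' ?_ EventuallyEq.rfl
      filter_upwards [(tendsto_line x₀ v).eventually (eventually_mem_target p₀)] with s hs
      exact (hT _ hs).symm
    · simp only [bcoef_linearization hπ]
      exact onLine_sub_linear_isBigO (analyticAt_bcoef hπ hx i j) (bcoef_bivInChart_eq_zero h i j) v
    · exact onLine_isBigO_one (analyticAt_sigmaInChart_apply hx (x i) j)
        (by rw [hσ0]; rfl) v
  rw [vecDeg_eq, hk]
  change n - k ≤ ord (topCoeff p₀ Pf) (chartAt (Cn n) p₀ p₀) at hle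
  omega

end LowestTerms

/-! ### Existence of the Pfaffian -/

section Existence

open Filter Topology

variable {n m : ℕ} {P : Type u} [TopologicalSpace P] [ChartedSpace (Cn n) P]
  [IsManifold 𝓘(ℂ, Cn n) ω P] [MulAction (Torus m) P] {π : MultivectorField n 2 P}

/-- The rank of a Poisson structure is attained on any dense set. -/
lemma exists_mem_finrank_sharpRange_eq [Nonempty P] (hπ : IsPoisson π) {L : Set P} (hL : Dense L) :
    ∃ p ∈ L, Module.finrank ℂ (sharpRange (π p)) = rank π := by
  obtain ⟨k, q, hk, -, hq⟩ := exists_rank_eq π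
  set ψ := chartAt (Cn n) q
  have hx := chartAt_self_mem_target (n := n) q
  have hmap : ∀ y, ((bivInChart q π y : ⋀[ℂ]^2 (Cn n)) : ExteriorAlgebra ℂ (Cn n)) ^ k
      = ExteriorAlgebra.map (chartMap n q (ψ.symm y))
        ((π (ψ.symm y) : ExteriorAlgebra ℂ (Tan n (ψ.symm y))) ^ k) := by
    intro y
    rw [bivInChart, coe_exteriorPower_map, map_pow]
  have hne : ((bivInChart q π (ψ q) : ⋀[ℂ]^2 (Cn n)) : ExteriorAlgebra ℂ (Cn n)) ^ k ≠ 0 := by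
    have h1 : ∀ q', q' = q → ExteriorAlgebra.map (chartMap n q q')
        ((π q' : ExteriorAlgebra ℂ (Tan n q')) ^ k) ≠ 0 := by
      rintro q' rfl h0
      exact hq (ExteriorAlgebra.map_injective_field
        (LinearMap.ker_eq_bot.2 (chartMap_bijective (mem_chart_source _ _)).1)
        (h0.trans (map_zero _).symm))
    rw [hmap]
    exact h1 _ (ψ.left_inv (mem_chart_source _ _))
  obtain ⟨T, hT⟩ : ∃ T : ExteriorAlgebra ℂ (Cn n) →ₗ[ℂ] ℂ,
      T (((bivInChart q π (ψ q) : ⋀[ℂ]^2 (Cn n)) : ExteriorAlgebra ℂ (Cn n)) ^ k) ≠ 0 := by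
    by_contra! hall
    exact hne ((Module.forall_dual_apply_eq_zero_iff ℂ _).1 hall)
  have han : AnalyticAt ℂ (fun y =>
      T (((bivInChart q π y : ⋀[ℂ]^2 (Cn n)) : ExteriorAlgebra ℂ (Cn n)) ^ k)) (ψ q) :=
    ((coeffsIn_bivector (R := analyticSubalgebra (ψ q))
      fun i j => analyticAt_bcoef hπ hx i j).pow k) T
  -- Some coefficient of `π ^ k` is nonzero at `q`, hence near `q`, and density provides a point of
  -- `L` there.
  have hev := (ψ.continuousAt (mem_chart_source _ q)).eventually
    (han.continuousAt.eventually_ne hT)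
  obtain ⟨p, ⟨hpT, hps⟩, hpL⟩ := mem_closure_iff_nhds.1 (hL q) _
    (hev.and (ψ.open_source.mem_nhds (mem_chart_source _ q)))
  refine ⟨p, hpL, le_antisymm (finrank_sharpRange_le_rank π p) ?_⟩
  rw [hk]
  refine two_mul_le_finrank_sharpRange fun h0 => hpT ?_
  have h1 : ∀ q', q' = p → ExteriorAlgebra.map (chartMap n q q')
      ((π q' : ExteriorAlgebra ℂ (Tan n q')) ^ k) = 0 := by
    rintro q' rfl
    rw [h0, map_zero]
  rw [hmap, h1 _ (ψ.left_inv hps), map_zero]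

/-- At a point of `L` where the rank is maximal, a complement of the stabilizer has dimension
exactly `n - 2r`, as the degree of the Pfaffian requires. -/
lemma exists_isTPfaffian [Nonempty P] (hπ : IsPoisson π) {L : Set P} (hL : Dense L)
    (htop : ∀ p ∈ L, anchorRange m π p = ⊤) :
    ∃ Pf : MultivectorField n n P, IsTPfaffian m π L Pf := by
  obtain ⟨p, hpL, hp⟩ := exists_mem_finrank_sharpRange_eq hπ hL
  obtain ⟨r, -, hr, -, -⟩ := exists_rank_eq π
  obtain ⟨C, hC⟩ := Submodule.exists_isCompl (leafStabilizer m π p)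
  have hdim := finrank_add_finrank_sharpRange (htop p hpL) hC.symm
  have hrd : 2 * r + Module.finrank ℂ C = n := by omega
  have b := Module.finBasis ℂ C
  have hspan : Submodule.span ℂ (Set.range fun i => (b i : TorusLie m)) = C := by
    have : (Set.range fun i => (b i : TorusLie m)) = C.subtype '' Set.range b := by
      rw [← Set.range_comp]; rfl
    rw [this, ← Submodule.map_span, b.span_eq, Submodule.map_top, Submodule.range_subtype]
  refine ⟨fun q => ⟨_, pow_mul_ιMulti_mem (π q) hrd fun i => sigma n m q (b i)⟩, p, hpL, r, _,
    fun i => b i, hr.symm, hrd, ?_, ?_, fun q => rfl⟩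
  · exact b.linearIndependent.map' C.subtype (Submodule.ker_subtype C)
  · rw [hspan]
    exact hC.symm

end Existence

end TPoisson

end

/-! ### The main theorem. -/

theorem theoremC {n m : ℕ} {P : Type u} [TopologicalSpace P] [T2Space P]
    [SecondCountableTopology P] [ConnectedSpace P] [ChartedSpace (TPoisson.Cn n) P]
    [IsManifold 𝓘(ℂ, TPoisson.Cn n) ω P]
    [MulAction (TPoisson.Torus m) P]
    [ContMDiffSMul 𝓘(ℂ, Fin m → ℂ) 𝓘(ℂ, TPoisson.Cn n) ω (TPoisson.Torus m) P]
    (π : TPoisson.MultivectorField n 2 P) (hπ : TPoisson.IsPoisson π)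
    (hinv : TPoisson.ActsByPoisson m π)
    (L : Set P) (hL : TPoisson.IsTLeaf m π L) (hLopen : IsOpen L) (hLdense : Dense L) :
    (∃ Pf : TPoisson.MultivectorField n n P, TPoisson.IsTPfaffian m π L Pf) ∧
    ∀ Pf : TPoisson.MultivectorField n n P, TPoisson.IsTPfaffian m π L Pf →
      (∀ Φ : Fin n → P → ℂ, TPoisson.IsTLogCanonicalSystem m π Φ →
        (∃ c : ℂ, c ≠ 0 ∧ ∀ p : P,
          exteriorPower.pairingDual ℂ _ n (TPoisson.wedgeD n Φ p) (Pf p) = c * ∏ i, Φ i p) ∧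
        ∀ p₀ : P, TPoisson.logVolumeDeg Φ p₀ = -TPoisson.vecDeg Pf p₀) ∧
      (∀ p₀ : P, π p₀ = 0 →
        2 * TPoisson.vecDeg Pf p₀ = -(TPoisson.rank (TPoisson.linearization π p₀) : ℤ) →
        ∀ Φ : Fin n → P → ℂ, TPoisson.IsTLogCanonicalSystem m π Φ →
          TPoisson.PropertyI π Φ p₀ ∧
          TPoisson.ContainsPolynomialIntegrableSystem (TPoisson.linearization π p₀)
            (fun i => TPoisson.low (Φ i) p₀)) ∧
      (∀ p₀ : P, π p₀ = 0 → (∀ t : TPoisson.Torus m, t • p₀ = p₀) →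
        (∃ Φ : Fin n → P → ℂ, TPoisson.IsTLogCanonicalSystem m π Φ) →
        2 * TPoisson.vecDeg Pf p₀ = -(TPoisson.rank (TPoisson.linearization π p₀) : ℤ) ∧
        ∀ Φ : Fin n → P → ℂ, TPoisson.IsTLogCanonicalSystem m π Φ →
          TPoisson.PropertyI π Φ p₀) := by
  have htop : ∀ p ∈ L, TPoisson.anchorRange m π p = ⊤ := fun p hp => hL.prop.eq_top hLopen hp
  refine ⟨TPoisson.exists_isTPfaffian hπ hLdense htop, ?_⟩
  rintro Pf ⟨p, hp, r, d, x, -, hrd, hx, hC, hPf'⟩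
  have hPf : TPoisson.IsPfaffianForm π r x Pf := hPf'
  have hPfp : Pf p ≠ 0 := hPf.ne_zero (htop p hp) hrd hx hC
  have hconst : ∀ Φ : Fin n → P → ℂ, TPoisson.IsTLogCanonicalSystem m π Φ → ∃ c : ℂ, c ≠ 0 ∧
      ∀ q, TPoisson.pair (Pf q) (fun i => TPoisson.dAt n (Φ i) q) = c * ∏ i, Φ i q := by
    intro Φ hΦ
    obtain ⟨c, hc⟩ := hPf.exists_pair_eq hrd hΦ
    exact ⟨c, hPf.const_ne_zero hπ hPfp hΦ.toIsLogCanonicalSystem hc, hc⟩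
  have hdeg : ∀ Φ : Fin n → P → ℂ, TPoisson.IsTLogCanonicalSystem m π Φ → ∀ p₀ : P,
      TPoisson.logVolumeDeg Φ p₀ = -TPoisson.vecDeg Pf p₀ := by
    intro Φ hΦ p₀
    obtain ⟨c, hc0, hc⟩ := hconst Φ hΦ
    exact hPf.logVolumeDeg_eq hπ hΦ.toIsLogCanonicalSystem hc0 hc p₀
  have hI : ∀ p₀ : P,
      2 * TPoisson.vecDeg Pf p₀ = -(TPoisson.rank (TPoisson.linearization π p₀) : ℤ) →
      ∀ Φ : Fin n → P → ℂ, TPoisson.IsTLogCanonicalSystem m π Φ → TPoisson.PropertyI π Φ p₀ := by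
    intro p₀ h Φ hΦ
    rw [TPoisson.PropertyI, hdeg Φ hΦ, mul_neg, h, neg_neg]
  refine ⟨fun Φ hΦ => ⟨hconst Φ hΦ, hdeg Φ hΦ⟩, fun p₀ h0 h Φ hΦ => ?_, fun p₀ h0 hfix hex => ?_⟩
  · exact ⟨hI p₀ h Φ hΦ, TPoisson.containsPolynomialIntegrableSystem_low hπ h0
      hΦ.toIsLogCanonicalSystem (hI p₀ h Φ hΦ)⟩
  · have h : 2 * TPoisson.vecDeg Pf p₀ = -(TPoisson.rank (TPoisson.linearization π p₀) : ℤ) := by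
      obtain ⟨Φ, hΦ⟩ := hex
      obtain ⟨c, hc0, hc⟩ := hconst Φ hΦ
      -- Isotropy of the lowest terms bounds the degree of the Pfaffian from above; vanishing of `π`
      -- and `σ` at `p₀` bounds it from below by the same number.
      have h1 := TPoisson.rank_linearization_le hπ h0 hΦ.toIsLogCanonicalSystem
      have h2 := hPf.neg_rank_le hπ hrd h0 hfix
        (hPf.ord_topCoeff hπ hΦ.toIsLogCanonicalSystem hc0 hc p₀).1
      rw [hdeg Φ hΦ] at h1
      linarith
    exact ⟨h, hI p₀ h⟩
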